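/- **Setting.** For a squarefree integer $d\ge1$ put $\omega_d=\sqrt{-d}$ if $d\not\equiv3\pmod 4$ and $\omega_d=\frac{1+\sqrt{-d}}2$ if $d\equiv 3\pmod 4$. Let $\mathbb H^3=\mathbb C\times\mathbb R_{>0}$ be hyperbolic upper half space, with boundary $\mathbb C\cup\{\infty\}$, on which $\mathrm{PSL}(2,\mathbb Z[\omega_d])$ acts by (Poincaré extensions of) Möbius transformations. More generally a matrix $A\in \mathrm{GL}(2,\mathbb Z[\omega_d])$ acts on $\mathbb H^3$ through a complex scalar multiple of $A$ with determinant $1$. *Standard cell.* Let $W_d\subset\mathbb C$ be the rectangle with corners $0,1,\omega_d,\omega_d+1$ if $d\not\equiv3\pmod4$, and the triangle with corners $0,1,\omega_d$ if $d\equiv3\pmod 4$. A *wall* is a vertical half-plane over the line through an edge of $W_d$. The *standard cell* $\mathcal C_d$ is the closure in $\mathbb H^3$ of the set of points of $W_d\times\mathbb R_{>0}$ that lie above the union of all half-spheres (that is, non-degenerate spheres) of the form $A\cdot X$ with $A\in\mathrm{PSL}(2,\mathbb Z[\omega_d])$ and $X$ a wall. *Farey polygons.* Let $T$ be the closed ideal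 hyperbolic triangle with vertices $0,\infty,1$. For $d\in\{2,7\}$ let $Q$ be the closed ideal quadrangle with vertices $0,\infty,\omega_d,1/\overline{\omega_d}$. For $d=11$ let $H$ be the closed ideal hexagon with vertices $0,\infty,\omega_d,2/\overline{\omega_d},\omega_d/2,1/\overline{\omega_d}$. Farey triangles, quadrangles and hexagons are the images $A\cdot T$, $A\cdot Q$, $A\cdot H$, where $A$ ranges over $\mathrm{SL}(2,\mathbb Z[\omega_d])$ if $d\in\{2,3,7,11\}$ and over $\mathrm{GL}(2,\mathbb Z[\omega_1])$ (matrices over $\mathbb Z[i]$ whose determinant is a unit) if $d=1$. The *cusps* of a Farey polygon are its ideal vertices. Two cusps $\frac pq,\frac rs$ (reduced fractions over $\mathbb Z[\omega_d]$, with $\infty=\frac10$) are *neighboring* if $|ps-qr|=1$. *Polyhedra.* A (hyperbolic) polyhedron is a finite intersection of closed half-spaces of $\mathbb H^3$ with non-empty interior; its faces are its two-dimensional intersections with the bounding planes of an irredundant set of such half-spaces. Its cusps are its accumulation points in $\mathbb C\cup\{\infty\}$. **Proposition.** For each $d\in\{1,2,3,7,11\}$ the standard cell $\mathcal C_d$ is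 a hyperbolic polyhedron with set of cusps $S_d$. Its faces are exactly the Farey polygons, of the types named below, whose edges connect neighboring cusps taken from $S_d$; the number of faces is as stated, and the boundary of $\mathcal C_d$ in $\mathbb H^3$ is the union of these faces. 1. $\mathcal C_1$ is an octahedron: it has $8$ faces, which are all such Farey triangles, and $$S_1=\Big\{\tfrac01,\tfrac10,\tfrac11,\tfrac{\omega_1}1,\tfrac{\omega_1+1}1,\tfrac1{1-\omega_1}\Big\}.$$ 2. $\mathcal C_2$ is a tetradecahedron: it has $14$ faces, which are all such Farey triangles and Farey quadrangles, and $$S_2=\Big\{\tfrac01,\tfrac10,\tfrac11,\tfrac{\omega_2}1,\tfrac{\omega_2+1}1,\tfrac1{-\omega_2},\tfrac{1-\omega_2}{-\omega_2},\tfrac{\omega_2+1}2,\tfrac{\omega_2-1}{\omega_2+1},\tfrac2{1-\omega_2},\tfrac1{1-\omega_2},\tfrac{\omega_2}{\omega_2+1}\Big\}.$$ 3. $\mathcal C_3$ is a tetrahedron: it has $4$ faces, which are all such Farey triangles, and $$S_3=\Big\{\tfrac01,\tfrac10,\tfrac11,\tfrac{\omega_3}1\Big\}.$$ 4. $\mathcal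 C_7$ is a pentahedron: it has $5$ faces, which are all such Farey triangles and Farey quadrangles, and $$S_7=\Big\{\tfrac01,\tfrac10,\tfrac11,\tfrac{\omega_7}1,\tfrac1{1-\omega_7},\tfrac{\omega_7-1}{\omega_7}\Big\}.$$ 5. $\mathcal C_{11}$ is an octahedron in the sense of having $8$ faces, which are all such Farey triangles and Farey hexagons, and $$S_{11}=\Big\{\tfrac01,\tfrac10,\tfrac11,\tfrac{\omega_{11}}1,\tfrac1{1-\omega_{11}},\tfrac{\omega_{11}-1}{\omega_{11}},\tfrac{\omega_{11}}2,\tfrac{\omega_{11}+1}2,\tfrac{\omega_{11}-2}{\omega_{11}},\tfrac2{1-\omega_{11}},\tfrac{\omega_{11}-1}{\omega_{11}+1},\tfrac2{2-\omega_{11}}\Big\}.$$ -/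

import Mathlib

open scoped MatrixGroups

noncomputable section

namespace FareyCell

/-- Hyperbolic upper half space `ℂ × ℝ_{>0}`; its boundary at infinity is `OnePoint ℂ`. -/
abbrev H3 : Type := {p : ℂ × ℝ // 0 < p.2}

/-- `ω_d`, the standard generator of the ring of integers of `ℚ(√-d)`. -/
def omega (d : ℕ) : ℂ :=
  if d % 4 = 3 then (1 + (Real.sqrt d : ℂ) * Complex.I) / 2 else (Real.sqrt d : ℂ) * Complex.I

/-- The ring `ℤ[ω_d]`. -/
def intRing (d : ℕ) : Subalgebra ℤ ℂ := Algebra.adjoin ℤ {omega d}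

/-- The matrices of `SL(2, ℤ[ω_d])`, as a subgroup of `GL(2, ℂ)`. -/
def bianchi (d : ℕ) : Subgroup (GL (Fin 2) ℂ) :=
  ((Matrix.GeneralLinearGroup.map (intRing d).val.toRingHom).comp
    (Matrix.SpecialLinearGroup.toGL : SL(2, intRing d) →* GL (Fin 2) (intRing d))).range

/-- The matrices of `GL(2, ℤ[ω_d])` (determinant a unit), as a subgroup of `GL(2, ℂ)`. -/
def extendedBianchi (d : ℕ) : Subgroup (GL (Fin 2) ℂ) :=
  (Matrix.GeneralLinearGroup.map (n := Fin 2) (intRing d).val.toRingHom).range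

/-- The denominator `|cz + d|² + |c|²t²` of the action on `H3`. -/
def denom (A : GL (Fin 2) ℂ) (p : H3) : ℝ :=
  ‖A 1 0 * p.1.1 + A 1 1‖ ^ 2 + ‖A 1 0‖ ^ 2 * p.1.2 ^ 2

theorem denom_pos (A : GL (Fin 2) ℂ) (p : H3) : 0 < denom A p := by
  have ht := p.2
  unfold denom
  by_cases hc : A 1 0 = 0
  · have hd : A 1 1 ≠ 0 := by
      intro hd
      have hdet : (A : Matrix (Fin 2) (Fin 2) ℂ).det ≠ 0 := A.det_ne_zero
      rw [Matrix.det_fin_two] at hdet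
      apply hdet
      rw [hc, hd]
      simp
    rw [hc]
    have := norm_pos_iff.mpr hd
    simp only [zero_mul, zero_add, norm_zero]
    positivity
  · have := norm_pos_iff.mpr hc
    positivity

/-- The action on `H3` by Poincaré extension. When `det A = 1` it is
`w ↦ (a w + b)(c w + d)⁻¹` with `(z, t)` read as the quaternion `w = z + t j`; in general it is
that of a complex scalar multiple of `A` with determinant `1`. -/
def moebius (A : GL (Fin 2) ℂ) (p : H3) : H3 :=
  ⟨(((A 0 0 * p.1.1 + A 0 1) * (starRingEnd ℂ) (A 1 0 * p.1.1 + A 1 1)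
      + A 0 0 * (starRingEnd ℂ) (A 1 0) * (p.1.2 : ℂ) ^ 2) / (denom A p : ℂ),
    ‖(A : Matrix (Fin 2) (Fin 2) ℂ).det‖ * p.1.2 / denom A p),
    div_pos (mul_pos (norm_pos_iff.mpr A.det_ne_zero) p.2) (denom_pos A p)⟩

/-! ### The standard cell -/

/-- The rectangle or triangle `W_d`. -/
def W (d : ℕ) : Set ℂ :=
  if d % 4 = 3 then convexHull ℝ {0, 1, omega d} else convexHull ℝ {0, 1, omega d, omega d + 1}

/-- The edges of `W_d`, each given by its end points. -/
def edges (d : ℕ) : Set (ℂ × ℂ) :=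
  if d % 4 = 3 then {(0, 1), (1, omega d), (omega d, 0)}
  else {(0, 1), (1, omega d + 1), (omega d + 1, omega d), (omega d, 0)}

/-- A wall: the vertical half-plane over the line through an edge of `W_d`. -/
def IsWall (d : ℕ) (X : Set H3) : Prop :=
  ∃ e ∈ edges d, X = {p : H3 | p.1.1 ∈ line[ℝ, e.1, e.2]}

/-- Half-spheres with centre on `ℂ × {0}`, that is, the non-degenerate ones. -/
def IsHemisphere (Y : Set H3) : Prop :=
  ∃ (c : ℂ) (r : ℝ), 0 < r ∧ Y = {p : H3 | ‖p.1.1 - c‖ ^ 2 + p.1.2 ^ 2 = r ^ 2}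

/-- The union of all non-degenerate spheres `A · X` with `A ∈ PSL(2, ℤ[ω_d])` and `X` a wall. -/
def hemispheres (d : ℕ) : Set H3 :=
  ⋃₀ {Y | IsHemisphere Y ∧ ∃ A ∈ bianchi d, ∃ X, IsWall d X ∧ Y = moebius A '' X}

/-- The standard cell `𝒞_d`: the closure in `H3` of the set of points over `W_d` that lie above
all points of `hemispheres d`. -/
def standardCell (d : ℕ) : Set H3 :=
  closure {p : H3 | p.1.1 ∈ W d ∧ ∀ q ∈ hemispheres d, q.1.1 = p.1.1 → q.1.2 < p.1.2}

/-! ### Cusps and Farey polygons -/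

/-- The boundary point `p/q`, with `p/0 = ∞`. -/
def cusp (p q : ℂ) : OnePoint ℂ :=
  if q = 0 then OnePoint.infty else ((p / q : ℂ) : OnePoint ℂ)

/-- Neighbouring cusps: `|ps - qr| = 1` for reduced fractions `p/q`, `r/s` over `ℤ[ω_d]`. -/
def Neighbouring (d : ℕ) (x y : OnePoint ℂ) : Prop :=
  ∃ p q r s : intRing d, IsCoprime p q ∧ IsCoprime r s ∧ x = cusp p q ∧ y = cusp r s ∧
    ‖(p : ℂ) * s - q * r‖ = 1

/-- The points over the segment from `a` to `b`. -/
def overSegment (a b : ℂ) : Set H3 := {p | p.1.1 ∈ segment ℝ a b}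

/-- The points on or outside the half-sphere with diameter `[a, b]`. For points over `[a, b]` this
means: on or above the geodesic from `a` to `b`. -/
def outside (a b : ℂ) : Set H3 :=
  {p | (‖b - a‖ / 2) ^ 2 ≤ ‖p.1.1 - (a + b) / 2‖ ^ 2 + p.1.2 ^ 2}

/-- The closed ideal triangle with vertices `0, ∞, 1`. -/
def triangle : Set H3 := overSegment 0 1 ∩ outside 0 1

/-- The closed ideal quadrangle with vertices `0, ∞, ω, 1/ω̄` (for `d = 2, 7`, where
`1/ω̄ = ω/2`). -/
def quadrangle (d : ℕ) : Set H3 :=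
  overSegment 0 (omega d) ∩ outside 0 (1 / (starRingEnd ℂ) (omega d)) ∩
    outside (1 / (starRingEnd ℂ) (omega d)) (omega d)

/-- The closed ideal hexagon with vertices `0, ∞, ω, 2/ω̄, ω/2, 1/ω̄` (for `d = 11`, where
`1/ω̄ = ω/3` and `2/ω̄ = 2ω/3`). -/
def hexagon (d : ℕ) : Set H3 :=
  overSegment 0 (omega d) ∩ outside 0 (1 / (starRingEnd ℂ) (omega d)) ∩
    outside (1 / (starRingEnd ℂ) (omega d)) (omega d / 2) ∩
    outside (omega d / 2) (2 / (starRingEnd ℂ) (omega d)) ∩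
    outside (2 / (starRingEnd ℂ) (omega d)) (omega d)

/-- `Q = A · P` for some `A ∈ G`, with cusps `c i = pᵢ/qᵢ`, where the columns `(pᵢ, qᵢ)` are the
images under `A` of the columns `v i`. -/
def IsImagePolygon (G : Subgroup (GL (Fin 2) ℂ)) {n : ℕ} (P : Set H3) (v : Fin n → Fin 2 → ℂ)
    (Q : Set H3) (c : Fin n → OnePoint ℂ) : Prop :=
  ∃ A ∈ G, Q = moebius A '' P ∧
    ∀ i, c i = cusp (((A : Matrix (Fin 2) (Fin 2) ℂ).mulVec (v i)) 0)
      (((A : Matrix (Fin 2) (Fin 2) ℂ).mulVec (v i)) 1)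

/-- `Q` is the Farey triangle with cusps `c` (in cyclic order), under matrices of `G`. -/
def IsFareyTriangle (G : Subgroup (GL (Fin 2) ℂ)) (Q : Set H3) (c : Fin 3 → OnePoint ℂ) : Prop :=
  IsImagePolygon G triangle ![![0, 1], ![1, 0], ![1, 1]] Q c

/-- `Q` is the Farey quadrangle with cusps `c` (in cyclic order). -/
def IsFareyQuadrangle (d : ℕ) (Q : Set H3) (c : Fin 4 → OnePoint ℂ) : Prop :=
  IsImagePolygon (bianchi d) (quadrangle d)
    ![![0, 1], ![1, 0], ![omega d, 1], ![1, (starRingEnd ℂ) (omega d)]] Q c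

/-- `Q` is the Farey hexagon with cusps `c` (in cyclic order). -/
def IsFareyHexagon (d : ℕ) (Q : Set H3) (c : Fin 6 → OnePoint ℂ) : Prop :=
  IsImagePolygon (bianchi d) (hexagon d)
    ![![0, 1], ![1, 0], ![omega d, 1], ![2, (starRingEnd ℂ) (omega d)], ![omega d, 2],
      ![1, (starRingEnd ℂ) (omega d)]] Q c

/-- The cusps `c` (in cyclic order) lie in `S` and consecutive ones are neighbouring. -/
def ConnectsNeighbours (d : ℕ) (S : Set (OnePoint ℂ)) {n : ℕ} [NeZero n]
    (c : Fin n → OnePoint ℂ) : Prop :=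
  (∀ i, c i ∈ S) ∧ ∀ i, Neighbouring d (c i) (c (i + 1))

/-- All Farey triangles whose edges connect neighbouring cusps taken from `S`. -/
def fareyTriangles (d : ℕ) (G : Subgroup (GL (Fin 2) ℂ)) (S : Set (OnePoint ℂ)) :
    Set (Set H3) :=
  {Q | ∃ c, IsFareyTriangle G Q c ∧ ConnectsNeighbours d S c}

/-- All Farey quadrangles whose edges connect neighbouring cusps taken from `S`. -/
def fareyQuadrangles (d : ℕ) (S : Set (OnePoint ℂ)) : Set (Set H3) :=
  {Q | ∃ c, IsFareyQuadrangle d Q c ∧ ConnectsNeighbours d S c}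

/-- All Farey hexagons whose edges connect neighbouring cusps taken from `S`. -/
def fareyHexagons (d : ℕ) (S : Set (OnePoint ℂ)) : Set (Set H3) :=
  {Q | ∃ c, IsFareyHexagon d Q c ∧ ConnectsNeighbours d S c}

/-! ### Hyperbolic polyhedra -/

/-- For `|β|² - αγ > 0` the zero set of this form is a hyperbolic plane: the half-sphere with
centre `-β/α` and squared radius `(|β|² - αγ)/α²` if `α ≠ 0`, a vertical half-plane if `α = 0`;
every hyperbolic plane is of this kind. -/
def planeForm (h : ℝ × ℂ × ℝ) (p : H3) : ℝ :=
  h.1 * (‖p.1.1‖ ^ 2 + p.1.2 ^ 2) + 2 * ((starRingEnd ℂ) h.2.1 * p.1.1).re + h.2.2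

/-- `P` is a hyperbolic polyhedron whose set of (two-dimensional) faces is `F`: a finite
intersection of closed half-spaces with non-empty interior, one half-space for each face, where
the face is the intersection of `P` with the bounding plane and has non-empty interior in it. -/
def IsPolyhedronWithFaces (P : Set H3) (F : Set (Set H3)) : Prop :=
  F.Finite ∧ (interior P).Nonempty ∧
  ∃ h : Set H3 → ℝ × ℂ × ℝ,
    (∀ f ∈ F, 0 < ‖(h f).2.1‖ ^ 2 - (h f).1 * (h f).2.2) ∧
    P = {p | ∀ f ∈ F, 0 ≤ planeForm (h f) p} ∧
    ∀ f ∈ F, f = P ∩ {p | planeForm (h f) p = 0} ∧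
      ∃ U : Set H3, IsOpen U ∧ (U ∩ f).Nonempty ∧ U ∩ {p | planeForm (h f) p = 0} ⊆ f

/-- The ideal points of `P`: its accumulation points in the boundary `ℂ ∪ {∞}` of `H3`. -/
def idealPoints (P : Set H3) : Set (OnePoint ℂ) :=
  {x | (∃ z : ℂ, x = (z : OnePoint ℂ) ∧ ((z, 0) : ℂ × ℝ) ∈ closure (Subtype.val '' P)) ∨
    (x = OnePoint.infty ∧ ¬ Bornology.IsBounded (Subtype.val '' P : Set (ℂ × ℝ)))}

/-- `P` is a polyhedron with exactly `n` faces, namely the members of `F`; its boundary in `H3` is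
the union of these faces, and its ideal points are exactly the cusps in `S`. -/
structure IsHedron (n : ℕ) (P : Set H3) (F : Set (Set H3)) (S : Set (OnePoint ℂ)) : Prop where
  polyhedron : IsPolyhedronWithFaces P F
  card_faces : F.ncard = n
  boundary : frontier P = ⋃₀ F
  cusps : idealPoints P = S

/-! ### The lists of cusps -/

/-- The cusps listed for `𝒞₁`. -/
def cusps1 : Set (OnePoint ℂ) :=
  let ω := omega 1
  {cusp 0 1, cusp 1 0, cusp 1 1, cusp ω 1, cusp (ω + 1) 1, cusp 1 (1 - ω)}

/-- The cusps listed for `𝒞₂`. -/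
def cusps2 : Set (OnePoint ℂ) :=
  let ω := omega 2
  {cusp 0 1, cusp 1 0, cusp 1 1, cusp ω 1, cusp (ω + 1) 1, cusp 1 (-ω), cusp (1 - ω) (-ω),
    cusp (ω + 1) 2, cusp (ω - 1) (ω + 1), cusp 2 (1 - ω), cusp 1 (1 - ω), cusp ω (ω + 1)}

/-- The cusps listed for `𝒞₃`. -/
def cusps3 : Set (OnePoint ℂ) :=
  let ω := omega 3
  {cusp 0 1, cusp 1 0, cusp 1 1, cusp ω 1}

/-- The cusps listed for `𝒞₇`. -/
def cusps7 : Set (OnePoint ℂ) :=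
  let ω := omega 7
  {cusp 0 1, cusp 1 0, cusp 1 1, cusp ω 1, cusp 1 (1 - ω), cusp (ω - 1) ω}

/-- The cusps listed for `𝒞₁₁`. -/
def cusps11 : Set (OnePoint ℂ) :=
  let ω := omega 11
  {cusp 0 1, cusp 1 0, cusp 1 1, cusp ω 1, cusp 1 (1 - ω), cusp (ω - 1) ω, cusp ω 2,
    cusp (ω + 1) 2, cusp (ω - 2) ω, cusp 2 (1 - ω), cusp (ω - 1) (ω + 1), cusp 2 (2 - ω)}

end FareyCell

end

noncomputable section

namespace FareyCell

open Matrix ComplexConjugate Topology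

/-! ### Points and planes as Hermitian matrices -/

/-! Upper half space is the projectivised cone of positive definite Hermitian 2×2 matrices: `(z, s)`
becomes the matrix with rows `(|z|² + s², z)` and `(z̄, 1)`. A matrix `A` acts by `X ↦ A X A*` up to
a positive factor, the cusp `p/q` is the rank-one matrix `v v*` with `v = (p, q)`, and hyperbolic
planes are the zero sets of the trace forms of Hermitian matrices of negative determinant. In
coordinates with respect to `1, ω`, the listed cusps, the bounding planes and the matrices over
`ℤ[ω]` are integer vectors, and each cell is the part of upper half space in a rational polyhedral
cone in `ℝ⁴`. What remains splits into finite integer checks and three arguments.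

Convexity. By `mem_cone_of_pairing_nonneg` the cone cut out by the face forms is spanned by the
light vectors of the cusps. Therefore each face is the hull of the vertices on it
(`faceSet_eq_hull`), and the listed cusps are exactly the ideal points (`idealPoints_cell`).

The standard cell is this polyhedron (`standardCell_eq`). Every non-vertical face plane is the image
of a wall under an explicit matrix of determinant 1, so nothing below such a plane is in the
standard cell. Conversely, the discriminant of a plane is invariant under the group (`disc_pull`),
and walls have discriminant `1` or `n = |ω|²`. So every hemisphere that matters is the zero set of
an integral form `g` with `g 0 > 0` and one of these discriminants. Completing the square
(`pairing_identity`) bounds how negative such a form can be at a cusp, and integrality then excludes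
negative values at the listed cusps. For `d = 2` and `d = 11` a few cusps with large denominator
escape this bound and need a further argument with congruences and finitely many cases. Being
nonnegative at the vertices, the forms are nonnegative on the whole cell, which thus lies on or
above all hemispheres.

Faces are Farey polygons. The standard polygons are hulls of light vectors too. A reduced fraction
determines `v v*`, and `polar` of two light vectors is `|ps - qr|²`, which is preserved by matrices
with determinant of absolute value 1. Hence a Farey polygon with listed cusps is an assignment of
its vertices to listed cusps that preserves `polar`; an exhaustive search (`FillsFace`) shows that
each such assignment fills a face. Explicit matrices (`MapsOntoFace`) show that each face arises. -/

/-- The Hermitian matrix `v v*`. -/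
def lightMat (v : Fin 2 → ℂ) : Matrix (Fin 2) (Fin 2) ℂ := vecMulVec v (star v)

/-- The Hermitian matrix of a point of upper half space, normalised by its last entry. -/
def posMat (p : H3) : Matrix (Fin 2) (Fin 2) ℂ :=
  !![((‖p.1.1‖ ^ 2 + p.1.2 ^ 2 : ℝ) : ℂ), p.1.1; conj p.1.1, 1]

/-- The pairing of two Hermitian matrices. -/
def traceForm (H X : Matrix (Fin 2) (Fin 2) ℂ) : ℝ := (H * X).trace.re

theorem normSq_cast (z : ℂ) : ((‖z‖ : ℂ)) ^ 2 = z * conj z := by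
  rw [Complex.mul_conj']

/-- This makes the Poincaré extension linear: it is congruence of Hermitian matrices, and the
denominator is only the factor that restores the last entry `1`. The inverse law and the transport
of planes and hulls all come from here. -/
theorem posMat_moebius (A : GL (Fin 2) ℂ) (p : H3) :
    (denom A p) • posMat (moebius A p)
      = (A : Matrix (Fin 2) (Fin 2) ℂ) * posMat p * (A : Matrix (Fin 2) (Fin 2) ℂ)ᴴ := by
  have hd : ((denom A p : ℝ) : ℂ) ≠ 0 := by exact_mod_cast (denom_pos A p).ne'
  have hd' : ((denom A p : ℝ) : ℂ) = (A 1 0 * p.1.1 + A 1 1) * conj (A 1 0 * p.1.1 + A 1 1)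
      + A 1 0 * conj (A 1 0) * (p.1.2 : ℂ) ^ 2 := by
    rw [denom]; push_cast; rw [normSq_cast, normSq_cast]
  have e01 : ((denom A p : ℝ) : ℂ) * (moebius A p).1.1
      = (A 0 0 * p.1.1 + A 0 1) * conj (A 1 0 * p.1.1 + A 1 1)
      + A 0 0 * conj (A 1 0) * (p.1.2 : ℂ) ^ 2 := by
    simp only [moebius]; field_simp
  have e2 : ((denom A p : ℝ) : ℂ) * ((moebius A p).1.2 : ℂ)
      = (‖(A : Matrix (Fin 2) (Fin 2) ℂ).det‖ : ℂ) * p.1.2 := by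
    simp only [moebius]; push_cast; field_simp
  have e01' := congrArg conj e01
  simp only [map_mul, map_add, Complex.conj_ofReal, Complex.conj_conj, map_pow] at e01'
  have hdet : ((‖(A : Matrix (Fin 2) (Fin 2) ℂ).det‖ : ℂ)) ^ 2
      = (A 0 0 * A 1 1 - A 0 1 * A 1 0) * conj (A 0 0 * A 1 1 - A 0 1 * A 1 0) := by
    rw [normSq_cast, det_fin_two]
  -- The formula for the action does not contain `|z|² + s²`. Multiplied by the denominator once
  -- more, the claim becomes a polynomial identity, with `|det A|²` supplying the term of the
  -- height.
  have e00 : ((denom A p : ℝ) : ℂ) * (((‖(moebius A p).1.1‖ : ℂ)) ^ 2 + ((moebius A p).1.2 : ℂ) ^ 2)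
      = (A 0 0 * p.1.1 + A 0 1) * conj (A 0 0 * p.1.1 + A 0 1)
        + A 0 0 * conj (A 0 0) * (p.1.2 : ℂ) ^ 2 := by
    apply mul_left_cancel₀ hd
    have : ((denom A p : ℝ) : ℂ) * (((denom A p : ℝ) : ℂ) *
        (((‖(moebius A p).1.1‖ : ℂ)) ^ 2 + ((moebius A p).1.2 : ℂ) ^ 2))
        = (((denom A p : ℝ) : ℂ) * (moebius A p).1.1) * (((denom A p : ℝ) : ℂ)
          * conj (moebius A p).1.1) + (((denom A p : ℝ) : ℂ) * ((moebius A p).1.2 : ℂ)) ^ 2 := by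
      rw [normSq_cast]; ring
    rw [this, e01, e01', e2, mul_pow, hdet, hd']
    simp only [map_mul, map_add, map_sub]
    ring
  ext i j
  fin_cases i <;> fin_cases j <;>
    simp only [posMat, Matrix.smul_apply, Matrix.mul_apply, Fin.sum_univ_two, conjTranspose_apply,
      Complex.real_smul, Fin.zero_eta, Fin.mk_one, Matrix.of_apply, cons_val', cons_val_zero,
      cons_val_one, cons_val_fin_one, Complex.ofReal_add, Complex.ofReal_pow, normSq_cast,
      RCLike.star_def] at e00 ⊢
  · rw [e00]; simp only [map_mul, map_add]; ring
  · rw [e01]; simp only [map_mul, map_add]; ring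
  · rw [e01']; ring
  · rw [hd']; simp only [map_mul, map_add]; ring

theorem posMat_injective : Function.Injective posMat := by
  intro p q h
  have h01 : p.1.1 = q.1.1 := by simpa [posMat] using congrFun (congrFun h 0) 1
  have h00 := congrFun (congrFun h 0) 0
  simp only [posMat, Matrix.of_apply, cons_val', cons_val_zero, cons_val_fin_one, h01] at h00
  have h2 : p.1.2 ^ 2 = q.1.2 ^ 2 := by
    have := Complex.ofReal_injective h00
    linarith
  have h3 : p.1.2 = q.1.2 := by
    have := p.2; have := q.2
    exact (pow_left_inj₀ p.2.le q.2.le two_ne_zero).1 h2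
  exact Subtype.ext (Prod.ext h01 h3)

theorem posMat_eq_of_smul {p q : H3} {c : ℝ} (h : c • posMat p = posMat q) : p = q := by
  have h11 : c = 1 := by
    have := congrFun (congrFun h 1) 1
    simpa [posMat] using this
  rw [h11, one_smul] at h
  exact posMat_injective h

theorem moebius_inv_apply (A : GL (Fin 2) ℂ) (p : H3) : moebius A⁻¹ (moebius A p) = p := by
  have h1 := posMat_moebius A p
  have h2 := posMat_moebius A⁻¹ (moebius A p)
  apply posMat_eq_of_smul (c := denom A p * denom A⁻¹ (moebius A p))
  have hi : ((A⁻¹ : GL (Fin 2) ℂ) : Matrix (Fin 2) (Fin 2) ℂ) * (A : Matrix (Fin 2) (Fin 2) ℂ) = 1 := by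
    rw [← Units.val_mul, inv_mul_cancel]; rfl
  rw [mul_smul, h2, ← Matrix.smul_mul, ← Matrix.mul_smul, h1, ← Matrix.mul_assoc, ← Matrix.mul_assoc,
    hi, Matrix.one_mul, Matrix.mul_assoc, ← conjTranspose_mul, hi, conjTranspose_one,
    Matrix.mul_one]

theorem moebius_apply_inv (A : GL (Fin 2) ℂ) (p : H3) : moebius A (moebius A⁻¹ p) = p := by
  simpa using moebius_inv_apply A⁻¹ p

theorem mem_moebius_image (A : GL (Fin 2) ℂ) (X : Set H3) (p : H3) :
    p ∈ moebius A '' X ↔ moebius A⁻¹ p ∈ X := by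
  constructor
  · rintro ⟨q, hq, rfl⟩
    rwa [moebius_inv_apply]
  · intro h
    exact ⟨_, h, moebius_apply_inv A p⟩

theorem traceForm_smul (H X : Matrix (Fin 2) (Fin 2) ℂ) (c : ℝ) :
    traceForm H (c • X) = c * traceForm H X := by
  simp [traceForm]

theorem traceForm_conj (A H X : Matrix (Fin 2) (Fin 2) ℂ) :
    traceForm H (A * X * Aᴴ) = traceForm (Aᴴ * H * A) X := by
  rw [traceForm, traceForm, ← Matrix.mul_assoc, Matrix.trace_mul_comm, ← Matrix.mul_assoc,
    ← Matrix.mul_assoc]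

theorem traceForm_moebius (A : GL (Fin 2) ℂ) (H : Matrix (Fin 2) (Fin 2) ℂ) (p : H3) :
    denom A p * traceForm H (posMat (moebius A p)) = traceForm
      ((A : Matrix (Fin 2) (Fin 2) ℂ)ᴴ * H * (A : Matrix (Fin 2) (Fin 2) ℂ)) (posMat p) := by
  rw [← traceForm_smul, posMat_moebius, traceForm_conj]

theorem lightMat_mulVec (A : Matrix (Fin 2) (Fin 2) ℂ) (v : Fin 2 → ℂ) :
    lightMat (A *ᵥ v) = A * lightMat v * Aᴴ := by
  rw [lightMat, lightMat, star_mulVec, mul_vecMulVec, vecMulVec_mul]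

/-! ### Convex hulls -/

/-- The points of `H3` in the cone spanned by a family of Hermitian matrices. -/
def hull {ι : Type*} [Fintype ι] (X : ι → Matrix (Fin 2) (Fin 2) ℂ) : Set H3 :=
  {p | ∃ c : ι → ℝ, (∀ i, 0 ≤ c i) ∧ posMat p = ∑ i, c i • X i}

theorem moebius_mem_hull {ι : Type*} [Fintype ι] {X : ι → Matrix (Fin 2) (Fin 2) ℂ}
    (A : GL (Fin 2) ℂ) {p : H3} (hp : p ∈ hull X) :
    moebius A p ∈ hull fun i => (A : Matrix (Fin 2) (Fin 2) ℂ) * X i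
      * (A : Matrix (Fin 2) (Fin 2) ℂ)ᴴ := by
  obtain ⟨c, hc, h⟩ := hp
  have hd := denom_pos A p
  refine ⟨fun i => (denom A p)⁻¹ * c i, fun i => by have := hc i; positivity, ?_⟩
  have h1 := posMat_moebius A p
  rw [h, Matrix.mul_sum, Matrix.sum_mul] at h1
  simp only [Matrix.mul_smul, Matrix.smul_mul] at h1
  simp only [mul_smul, ← Finset.smul_sum]
  rw [← h1, smul_smul, inv_mul_cancel₀ hd.ne', one_smul]

theorem moebius_image_hull {ι : Type*} [Fintype ι] (X : ι → Matrix (Fin 2) (Fin 2) ℂ)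
    (A : GL (Fin 2) ℂ) :
    moebius A '' hull X = hull fun i => (A : Matrix (Fin 2) (Fin 2) ℂ) * X i
      * (A : Matrix (Fin 2) (Fin 2) ℂ)ᴴ := by
  ext p
  rw [mem_moebius_image]
  constructor
  · intro h
    simpa [moebius_apply_inv] using moebius_mem_hull A h
  · intro h
    have := moebius_mem_hull A⁻¹ h
    have hi : ((A⁻¹ : GL (Fin 2) ℂ) : Matrix (Fin 2) (Fin 2) ℂ)
        * (A : Matrix (Fin 2) (Fin 2) ℂ) = 1 := by
      rw [← Units.val_mul, inv_mul_cancel]; rfl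
    convert this using 2
    ext1 i
    rw [← Matrix.mul_assoc, ← Matrix.mul_assoc, hi, Matrix.one_mul, Matrix.mul_assoc,
      ← conjTranspose_mul, hi, conjTranspose_one, Matrix.mul_one]

theorem hull_subset_of_range {ι κ : Type*} [Fintype ι] [Fintype κ]
    {X : ι → Matrix (Fin 2) (Fin 2) ℂ} {Y : κ → Matrix (Fin 2) (Fin 2) ℂ}
    (h : ∀ i, ∃ k, X i = Y k) : hull X ⊆ hull Y := by
  classical
  rintro p ⟨c, hc, hp⟩
  choose f hf using h
  -- Several indices may carry the same matrix, so the coefficients are added up over the fibres of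
  -- `f`.
  refine ⟨fun k => ∑ i with f i = k, c i, fun k => Finset.sum_nonneg fun i _ => hc i, ?_⟩
  rw [hp, ← Finset.sum_fiberwise Finset.univ f]
  refine Finset.sum_congr rfl fun k _ => ?_
  rw [Finset.sum_smul]
  refine Finset.sum_congr rfl fun i hi => ?_
  rw [hf i, (Finset.mem_filter.1 hi).2]

theorem hull_congr_range {ι κ : Type*} [Fintype ι] [Fintype κ]
    {X : ι → Matrix (Fin 2) (Fin 2) ℂ} {Y : κ → Matrix (Fin 2) (Fin 2) ℂ}
    (h : ∀ i, ∃ k, X i = Y k) (h' : ∀ k, ∃ i, Y k = X i) : hull X = hull Y :=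
  (hull_subset_of_range h).antisymm (hull_subset_of_range h')

/-! ### Integral coordinates -/

/-- `ω` is a non-real quadratic integer with trace `t` and norm `n`. -/
structure IsQuadGen (ω : ℂ) (t n : ℤ) : Prop where
  add_conj : ω + conj ω = t
  mul_conj : ω * conj ω = n
  im_pos : 0 < ω.im

/-- The pairing of the coordinates of a plane with those of a point. -/
def pairing {R : Type*} [Add R] [Mul R] (g x : Fin 4 → R) : R :=
  g 0 * x 0 + g 1 * x 1 + g 2 * x 2 + g 3 * x 3

/-- The polar form of the determinant on Hermitian matrices, in coordinates. -/
def polar (t n : ℤ) (u v : Fin 4 → ℤ) : ℤ :=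
  u 0 * v 3 + u 3 * v 0 -
    (2 * (u 1 * v 1) + t * (u 1 * v 2 + u 2 * v 1) + 2 * (n * (u 2 * v 2)))

/-- A positive multiple of the discriminant of a plane. -/
def disc (t n : ℤ) (g : Fin 4 → ℤ) : ℤ :=
  n * g 1 ^ 2 - t * (g 1 * g 2) + g 2 ^ 2 - (4 * n - t ^ 2) * (g 0 * g 3)

/-- The coordinates of `v v*`, for `v = (v₀ + v₁ω, v₂ + v₃ω)`. -/
def lvec (t n : ℤ) (v : Fin 4 → ℤ) : Fin 4 → ℤ :=
  ![v 0 * v 0 + t * (v 0 * v 1) + n * (v 1 * v 1),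
    v 0 * v 2 + t * (v 0 * v 3) + n * (v 1 * v 3), v 1 * v 2 - v 0 * v 3,
    v 2 * v 2 + t * (v 2 * v 3) + n * (v 3 * v 3)]

/-- The vector with columns `c₀`, `c₁` applied to the vector `v`. -/
def matVec (t n : ℤ) (c₀ c₁ v : Fin 4 → ℤ) : Fin 4 → ℤ :=
  ![v 0 * c₀ 0 - n * (v 1 * c₀ 1) + (v 2 * c₁ 0 - n * (v 3 * c₁ 1)),
    v 0 * c₀ 1 + v 1 * c₀ 0 + t * (v 1 * c₀ 1) + (v 2 * c₁ 1 + v 3 * c₁ 0 + t * (v 3 * c₁ 1)),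
    v 0 * c₀ 2 - n * (v 1 * c₀ 3) + (v 2 * c₁ 2 - n * (v 3 * c₁ 3)),
    v 0 * c₀ 3 + v 1 * c₀ 2 + t * (v 1 * c₀ 3) + (v 2 * c₁ 3 + v 3 * c₁ 2 + t * (v 3 * c₁ 3))]

/-- The coordinates of a plane pulled back along the matrix with columns `c₀`, `c₁`. -/
def pull (t n : ℤ) (c₀ c₁ g : Fin 4 → ℤ) : Fin 4 → ℤ :=
  let f (v : Fin 4 → ℤ) : ℤ := pairing g (lvec t n (matVec t n c₀ c₁ v))
  ![f ![1, 0, 0, 0], f ![1, 0, 1, 0] - f ![1, 0, 0, 0] - f ![0, 0, 1, 0],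
    f ![0, 1, 1, 0] - n * f ![1, 0, 0, 0] - f ![0, 0, 1, 0], f ![0, 0, 1, 0]]

/-- The complex vector with given integral coordinates. -/
def cvec (ω : ℂ) (v : Fin 4 → ℤ) : Fin 2 → ℂ := ![v 0 + v 1 * ω, v 2 + v 3 * ω]

/-- The complex matrix with columns of given integral coordinates. -/
def cmat (ω : ℂ) (c₀ c₁ : Fin 4 → ℤ) : Matrix (Fin 2) (Fin 2) ℂ :=
  !![c₀ 0 + c₀ 1 * ω, c₁ 0 + c₁ 1 * ω; c₀ 2 + c₀ 3 * ω, c₁ 2 + c₁ 3 * ω]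

/-- The Hermitian matrix with given coordinates. -/
def herm (ω : ℂ) (x : Fin 4 → ℝ) : Matrix (Fin 2) (Fin 2) ℂ :=
  !![(x 0 : ℂ), x 1 + x 2 * ω; conj (x 1 + x 2 * ω : ℂ), x 3]

/-- The off-diagonal entry of the Hermitian matrix of a plane. -/
def offDiag (ω : ℂ) (g : Fin 4 → ℤ) : ℂ := (g 2 - g 1 * ω) / (conj ω - ω)

/-- The Hermitian matrix of a plane. -/
def formMat (ω : ℂ) (g : Fin 4 → ℤ) : Matrix (Fin 2) (Fin 2) ℂ :=
  !![(g 0 : ℂ), offDiag ω g; conj (offDiag ω g), g 3]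

/-- The coordinates of a point. -/
def coord (ω : ℂ) (p : H3) : Fin 4 → ℝ :=
  ![‖p.1.1‖ ^ 2 + p.1.2 ^ 2, p.1.1.re - p.1.1.im / ω.im * ω.re, p.1.1.im / ω.im, 1]

/-- Integral coordinates as real ones. -/
def toReal (v : Fin 4 → ℤ) : Fin 4 → ℝ := fun i => (v i : ℝ)

theorem trace_mul_lightMat (H : Matrix (Fin 2) (Fin 2) ℂ) (v : Fin 2 → ℂ) :
    (H * lightMat v).trace = H 0 0 * (v 0 * conj (v 0)) + H 0 1 * (v 1 * conj (v 0))
      + H 1 0 * (v 0 * conj (v 1)) + H 1 1 * (v 1 * conj (v 1)) := by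
  simp only [lightMat, Matrix.trace, Fin.sum_univ_two, Matrix.mul_apply, vecMulVec_apply,
    Matrix.diag_apply, Pi.star_apply, RCLike.star_def]
  ring

theorem pairing_toReal (g v : Fin 4 → ℤ) :
    pairing (toReal g) (toReal v) = (pairing g v : ℤ) := by
  simp [pairing, toReal]

theorem pairing_add (g x y : Fin 4 → ℝ) : pairing g (x + y) = pairing g x + pairing g y := by
  simp [pairing]; ring

theorem pairing_smul (g x : Fin 4 → ℝ) (c : ℝ) : pairing g (c • x) = c * pairing g x := by
  simp [pairing]; ring

theorem pairing_sub (g x y : Fin 4 → ℝ) : pairing g (x - y) = pairing g x - pairing g y := by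
  simp [pairing]; ring

theorem pairing_sum {ι : Type*} (s : Finset ι) (g : Fin 4 → ℝ) (x : ι → Fin 4 → ℝ) :
    pairing g (∑ i ∈ s, x i) = ∑ i ∈ s, pairing g (x i) := by
  classical
  induction s using Finset.induction_on with
  | empty => simp [pairing]
  | insert a s ha ih => rw [Finset.sum_insert ha, Finset.sum_insert ha, pairing_add, ih]

theorem herm_add (ω : ℂ) (x y : Fin 4 → ℝ) : herm ω (x + y) = herm ω x + herm ω y := by
  ext i j
  fin_cases i <;> fin_cases j <;> simp [herm] <;> ring

theorem herm_smul (ω : ℂ) (c : ℝ) (x : Fin 4 → ℝ) : herm ω (c • x) = c • herm ω x := by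
  ext i j
  fin_cases i <;> fin_cases j <;> simp [herm] <;> ring

theorem herm_sum {ι : Type*} (ω : ℂ) (s : Finset ι) (x : ι → Fin 4 → ℝ) :
    herm ω (∑ i ∈ s, x i) = ∑ i ∈ s, herm ω (x i) := by
  classical
  induction s using Finset.induction_on with
  | empty => ext i j; fin_cases i <;> fin_cases j <;> simp [herm]
  | insert a s ha ih => rw [Finset.sum_insert ha, Finset.sum_insert ha, herm_add, ih]

/-! ### Dictionary between Hermitian matrices and integral coordinates. -/

namespace IsQuadGen

variable {ω : ℂ} {t n : ℤ}

theorem conj_eq (h : IsQuadGen ω t n) : conj ω = t - ω := by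
  rw [← h.add_conj]; ring

theorem sq_eq (h : IsQuadGen ω t n) : ω ^ 2 = t * ω - n := by
  have h1 := h.mul_conj
  rw [h.conj_eq] at h1
  linear_combination -h1

theorem conj_sub_ne (h : IsQuadGen ω t n) : conj ω - ω ≠ 0 := by
  intro h0
  have h1 := congrArg Complex.im h0
  have := h.im_pos
  simp at h1
  linarith

theorem disc_cast (h : IsQuadGen ω t n) : -(conj ω - ω) ^ 2 = (4 * n - t ^ 2 : ℂ) := by
  rw [h.conj_eq]
  linear_combination -4 * h.sq_eq

theorem disc_pos (h : IsQuadGen ω t n) : 0 < 4 * n - t ^ 2 := by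
  have h1 := h.disc_cast
  have h2 : conj ω - ω = (-(2 * ω.im) : ℝ) * Complex.I := by
    apply Complex.ext <;> simp
    ring
  rw [h2, mul_pow, Complex.I_sq] at h1
  have h3 : (2 * ω.im) ^ 2 = ((4 * n - t ^ 2 : ℤ) : ℝ) := by
    have : (((2 * ω.im) ^ 2 : ℝ) : ℂ) = (((4 * n - t ^ 2 : ℤ) : ℝ) : ℂ) := by
      push_cast at h1 ⊢
      rw [← h1]; ring
    exact_mod_cast this
  have h4 : (0 : ℝ) < (2 * ω.im) ^ 2 := by have := h.im_pos; positivity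
  rw [h3] at h4
  exact_mod_cast h4

theorem norm_sq (h : IsQuadGen ω t n) (x y : ℝ) :
    ‖(x + y * ω : ℂ)‖ ^ 2 = x ^ 2 + t * (x * y) + n * y ^ 2 := by
  have : ((‖(x + y * ω : ℂ)‖ ^ 2 : ℝ) : ℂ) = ((x ^ 2 + t * (x * y) + n * y ^ 2 : ℝ) : ℂ) := by
    push_cast
    rw [normSq_cast, map_add, map_mul, Complex.conj_ofReal, Complex.conj_ofReal, h.conj_eq]
    linear_combination (-(y : ℂ) ^ 2) * h.sq_eq
  exact_mod_cast this

theorem coord_spec (h : IsQuadGen ω t n) (p : H3) :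
    ((coord ω p 1 : ℝ) + (coord ω p 2 : ℝ) * ω : ℂ) = p.1.1 := by
  have := h.im_pos.ne'
  apply Complex.ext
  · simp [coord]
  · simp [coord]; field_simp

theorem coord_unique (h : IsQuadGen ω t n) {x y x' y' : ℝ}
    (he : (x + y * ω : ℂ) = x' + y' * ω) : x = x' ∧ y = y' := by
  have hi := congrArg Complex.im he
  have hr := congrArg Complex.re he
  simp at hi hr
  have h1 : y = y' := by
    rcases hi with hi | hi
    · exact hi
    · exact absurd hi h.im_pos.ne'
  subst h1
  exact ⟨by linarith, rfl⟩

theorem posMat_eq (h : IsQuadGen ω t n) (p : H3) : posMat p = herm ω (coord ω p) := by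
  rw [herm, h.coord_spec]
  simp [posMat, coord]

theorem herm_injective (h : IsQuadGen ω t n) : Function.Injective (herm ω) := by
  intro x y he
  have h0 : x 0 = y 0 := by simpa [herm] using congrFun (congrFun he 0) 0
  have h3 : x 3 = y 3 := by simpa [herm] using congrFun (congrFun he 1) 1
  have h1 : (x 1 + x 2 * ω : ℂ) = y 1 + y 2 * ω := by
    simpa [herm] using congrFun (congrFun he 0) 1
  obtain ⟨h1, h2⟩ := h.coord_unique h1
  ext i
  fin_cases i <;> assumption

theorem lightMat_cvec (h : IsQuadGen ω t n) (v : Fin 4 → ℤ) :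
    lightMat (cvec ω v) = herm ω (toReal (lvec t n v)) := by
  have h1 := h.sq_eq
  have e : ∀ a b c d : ℂ, (a + b * ω) * (c + d * (t - ω))
      = (a * c + t * (a * d) + n * (b * d)) + (b * c - a * d) * ω := fun a b c d => by
    linear_combination (-b * d) * h1
  ext i j
  fin_cases i <;> fin_cases j <;>
    simp [lightMat, cvec, herm, vecMulVec_apply, toReal, lvec, h.conj_eq, e]
  · left; ring
  · ring
  · left; ring

theorem cmat_mulVec (h : IsQuadGen ω t n) (c₀ c₁ v : Fin 4 → ℤ) :
    cmat ω c₀ c₁ *ᵥ cvec ω v = cvec ω (matVec t n c₀ c₁ v) := by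
  have h1 := h.sq_eq
  ext i
  fin_cases i <;> simp [cmat, cvec, matVec, Matrix.mulVec, dotProduct, Fin.sum_univ_two]
  · linear_combination (v 1 * c₀ 1 + v 3 * c₁ 1 : ℂ) * h1
  · linear_combination (v 1 * c₀ 3 + v 3 * c₁ 3 : ℂ) * h1

/-- With `offDiag_mul_add` this characterises `offDiag`: the trace form contributes `β w̄ + β̄ w`
for `w = x₁ + x₂ω`, and this has to equal `g₁x₁ + g₂x₂`. -/
theorem offDiag_add_conj (h : IsQuadGen ω t n) (g : Fin 4 → ℤ) :
    offDiag ω g + conj (offDiag ω g) = g 1 := by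
  have h0 := h.conj_sub_ne
  have h0' : ω - conj ω ≠ 0 := by rw [← neg_sub]; exact neg_ne_zero.2 h0
  simp only [offDiag, map_div₀, map_sub, map_mul, Complex.conj_conj, map_intCast]
  rw [div_add_div _ _ h0 h0', div_eq_iff (mul_ne_zero h0 h0')]
  ring

theorem offDiag_mul_add (h : IsQuadGen ω t n) (g : Fin 4 → ℤ) :
    offDiag ω g * conj ω + conj (offDiag ω g) * ω = g 2 := by
  have h0 := h.conj_sub_ne
  have h0' : ω - conj ω ≠ 0 := by rw [← neg_sub]; exact neg_ne_zero.2 h0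
  simp only [offDiag, map_div₀, map_sub, map_mul, Complex.conj_conj, map_intCast]
  rw [div_mul_eq_mul_div, div_mul_eq_mul_div, div_add_div _ _ h0 h0',
    div_eq_iff (mul_ne_zero h0 h0')]
  ring

theorem offDiag_mul_conj (h : IsQuadGen ω t n) (g : Fin 4 → ℤ) :
    (4 * n - t ^ 2 : ℂ) * (offDiag ω g * conj (offDiag ω g))
      = n * g 1 ^ 2 - t * (g 1 * g 2) + g 2 ^ 2 := by
  have h0 := h.conj_sub_ne
  have h0' : ω - conj ω ≠ 0 := by rw [← neg_sub]; exact neg_ne_zero.2 h0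
  simp only [offDiag, map_div₀, map_sub, map_mul, Complex.conj_conj, map_intCast]
  rw [← h.disc_cast, div_mul_div_comm, ← mul_div_assoc, div_eq_iff (mul_ne_zero h0 h0'),
    ← h.add_conj, ← h.mul_conj]
  ring

theorem traceForm_herm (h : IsQuadGen ω t n) (g : Fin 4 → ℤ) (x : Fin 4 → ℝ) :
    traceForm (formMat ω g) (herm ω x) = pairing (toReal g) x := by
  have h1 := h.offDiag_add_conj g
  have h2 := h.offDiag_mul_add g
  have : (formMat ω g * herm ω x).trace = ((pairing (toReal g) x : ℝ) : ℂ) := by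
    simp [formMat, herm, Matrix.trace, Fin.sum_univ_two, pairing, toReal]
    linear_combination (x 1 : ℂ) * h1 + (x 2 : ℂ) * h2
  rw [traceForm, this, Complex.ofReal_re]

theorem traceForm_posMat (h : IsQuadGen ω t n) (g : Fin 4 → ℤ) (p : H3) :
    traceForm (formMat ω g) (posMat p) = pairing (toReal g) (coord ω p) := by
  rw [h.posMat_eq, h.traceForm_herm]

theorem traceForm_cvec (h : IsQuadGen ω t n) (g : Fin 4 → ℤ) (v : Fin 4 → ℤ) :
    traceForm (formMat ω g) (lightMat (cvec ω v)) = (pairing g (lvec t n v) : ℤ) := by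
  rw [h.lightMat_cvec, h.traceForm_herm, pairing_toReal]

theorem det_formMat (h : IsQuadGen ω t n) (g : Fin 4 → ℤ) :
    (4 * n - t ^ 2 : ℂ) * (formMat ω g).det = -(disc t n g : ℤ) := by
  have h1 := h.offDiag_mul_conj g
  rw [formMat, det_fin_two_of, disc]
  push_cast
  linear_combination -h1

theorem formMat_isHermitian (ω : ℂ) (g : Fin 4 → ℤ) : (formMat ω g).IsHermitian := by
  ext i j
  fin_cases i <;> fin_cases j <;> simp [formMat]

/-- A Hermitian matrix with integral values at the integral vectors. -/
theorem eq_formMat (h : IsQuadGen ω t n) {H : Matrix (Fin 2) (Fin 2) ℂ} (hH : H.IsHermitian)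
    (f : (Fin 4 → ℤ) → ℤ) (hf : ∀ v, traceForm H (lightMat (cvec ω v)) = f v) :
    H = formMat ω ![f ![1, 0, 0, 0], f ![1, 0, 1, 0] - f ![1, 0, 0, 0] - f ![0, 0, 1, 0],
    f ![0, 1, 1, 0] - n * f ![1, 0, 0, 0] - f ![0, 0, 1, 0], f ![0, 0, 1, 0]] := by
  have h00 : conj (H 0 0) = H 0 0 := hH.apply 0 0
  have h11 : conj (H 1 1) = H 1 1 := hH.apply 1 1
  have h10 : H 1 0 = conj (H 0 1) := (hH.apply 1 0).symm
  have tr : ∀ v, (f v : ℂ) = (H * lightMat (cvec ω v)).trace := by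
    intro v
    have h1 : conj (H * lightMat (cvec ω v)).trace = (H * lightMat (cvec ω v)).trace := by
      have := Matrix.trace_conjTranspose (H * lightMat (cvec ω v))
      rw [conjTranspose_mul, hH.eq, lightMat, conjTranspose_vecMulVec, star_star,
        Matrix.trace_mul_comm] at this
      exact this.symm
    rw [← Complex.conj_eq_iff_re.1 h1]
    exact_mod_cast congrArg Complex.ofReal (hf v).symm
  -- The values at `(1,0)`, `(0,1)`, `(1,1)` and `(ω,1)` give the two diagonal entries and the
  -- numbers `β + β̄` and `βω̄ + β̄ω`, which determine the off-diagonal entry `β`.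
  have a := tr ![1, 0, 0, 0]
  have b := tr ![0, 0, 1, 0]
  have c := tr ![1, 0, 1, 0]
  have e := tr ![0, 1, 1, 0]
  have h0 := h.conj_sub_ne
  simp only [trace_mul_lightMat] at a b c e
  simp [cvec] at a b c e
  have hoff : offDiag ω ![f ![1, 0, 0, 0], f ![1, 0, 1, 0] - f ![1, 0, 0, 0] - f ![0, 0, 1, 0],
      f ![0, 1, 1, 0] - n * f ![1, 0, 0, 0] - f ![0, 0, 1, 0], f ![0, 0, 1, 0]] = H 0 1 := by
    rw [offDiag, div_eq_iff h0]
    simp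
    rw [a, b, c, e, ← h.mul_conj]
    ring
  ext i j
  fin_cases i <;> fin_cases j <;> simp [formMat, hoff, a, b, h10]

/-- The pulled-back form takes integer values at integral vectors, and `eq_formMat` recovers its
coordinates from them by polarisation. This makes `pull` computable without complex numbers. -/
theorem formMat_pull (h : IsQuadGen ω t n) (c₀ c₁ g : Fin 4 → ℤ) :
    (cmat ω c₀ c₁)ᴴ * formMat ω g * cmat ω c₀ c₁ = formMat ω (pull t n c₀ c₁ g) := by
  apply h.eq_formMat (isHermitian_conjTranspose_mul_mul _ (formMat_isHermitian ω g))
    (fun v => pairing g (lvec t n (matVec t n c₀ c₁ v)))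
  intro v
  rw [← traceForm_conj, ← lightMat_mulVec, h.cmat_mulVec, h.traceForm_cvec]

/-- The discriminant is `-(4n - t²)` times the determinant, which congruence multiplies by `|det|² =
1`. It is the invariant that confines all images of walls to the discriminants of the walls. -/
theorem disc_pull (h : IsQuadGen ω t n) (c₀ c₁ g : Fin 4 → ℤ)
    (hdet : ‖(cmat ω c₀ c₁).det‖ = 1) : disc t n (pull t n c₀ c₁ g) = disc t n g := by
  have h1 := h.det_formMat (pull t n c₀ c₁ g)
  rw [← h.formMat_pull, det_mul, det_mul, det_conjTranspose] at h1
  have h2 : star (cmat ω c₀ c₁).det * (cmat ω c₀ c₁).det = 1 := by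
    have := Complex.conj_mul' (cmat ω c₀ c₁).det
    rw [hdet] at this
    simpa using this
  have h3 := h.det_formMat g
  have h4 : (disc t n (pull t n c₀ c₁ g) : ℂ) = (disc t n g : ℂ) := by
    linear_combination h1 - h3 - ((4 * n - t ^ 2 : ℂ) * (formMat ω g).det) * h2
  exact_mod_cast h4

theorem norm_offDiag (h : IsQuadGen ω t n) (g : Fin 4 → ℤ) :
    ((4 * n - t ^ 2 : ℤ) : ℝ) * (‖offDiag ω g‖ ^ 2 - g 0 * g 3) = disc t n g := by
  have h1 := h.offDiag_mul_conj g
  rw [← normSq_cast] at h1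
  rw [disc]
  have : ((((4 * n - t ^ 2 : ℤ) : ℝ) * (‖offDiag ω g‖ ^ 2 - g 0 * g 3) : ℝ) : ℂ)
      = ((n * g 1 ^ 2 - t * (g 1 * g 2) + g 2 ^ 2 - (4 * n - t ^ 2) * (g 0 * g 3) : ℤ) : ℝ) := by
    push_cast
    linear_combination h1
  exact_mod_cast this

theorem planeForm_eq (h : IsQuadGen ω t n) (g : Fin 4 → ℤ) (p : H3) :
    planeForm ((g 0 : ℝ), offDiag ω g, (g 3 : ℝ)) p = pairing (toReal g) (coord ω p) := by
  have h1 := h.offDiag_add_conj g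
  have h2 := h.offDiag_mul_add g
  have h3 : 2 * (conj (offDiag ω g) * p.1.1).re = g 1 * coord ω p 1 + g 2 * coord ω p 2 := by
    have : ((2 * (conj (offDiag ω g) * p.1.1).re : ℝ) : ℂ)
        = ((g 1 * coord ω p 1 + g 2 * coord ω p 2 : ℝ) : ℂ) := by
      push_cast
      rw [← h1, ← h2, Complex.re_eq_add_conj, map_mul, Complex.conj_conj, ← h.coord_spec p]
      simp only [map_add, map_mul, Complex.conj_ofReal]
      ring
    exact_mod_cast this
  rw [planeForm, h3]
  simp [pairing, toReal, coord]
  ring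

/-- The value `1` of `polar` thus has two readings: the two columns form a matrix with determinant
of absolute value 1, and the two cusps are neighbouring. -/
theorem polar_lvec (h : IsQuadGen ω t n) (c₀ c₁ : Fin 4 → ℤ) :
    ‖(cmat ω c₀ c₁).det‖ ^ 2 = (polar t n (lvec t n c₀) (lvec t n c₁) : ℤ) := by
  have : ((‖(cmat ω c₀ c₁).det‖ ^ 2 : ℝ) : ℂ)
      = (((polar t n (lvec t n c₀) (lvec t n c₁) : ℤ) : ℝ) : ℂ) := by
    have e : (cmat ω c₀ c₁).det
        = ((c₀ 0 * c₁ 2 - n * (c₀ 1 * c₁ 3) - (c₁ 0 * c₀ 2 - n * (c₁ 1 * c₀ 3)) : ℤ) : ℝ)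
          + ((c₀ 0 * c₁ 3 + c₀ 1 * c₁ 2 + t * (c₀ 1 * c₁ 3)
            - (c₁ 0 * c₀ 3 + c₁ 1 * c₀ 2 + t * (c₁ 1 * c₀ 3)) : ℤ) : ℝ) * ω := by
      rw [cmat, det_fin_two_of]
      push_cast
      linear_combination (c₀ 1 * c₁ 3 - c₁ 1 * c₀ 3 : ℂ) * h.sq_eq
    rw [e, h.norm_sq]
    norm_cast
    simp only [polar, lvec, cons_val]
    ring
  exact_mod_cast this

end IsQuadGen

/-! ### Cones generated by light vectors -/

/-- A three by three minor. -/
def minor (g h k : Fin 4 → ℤ) (a b c : Fin 4) : ℤ :=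
  g a * (h b * k c - h c * k b) - g b * (h a * k c - h c * k a) + g c * (h a * k b - h b * k a)

/-- The determinant of four vectors. -/
def det4 (f g h k : Fin 4 → ℤ) : ℤ :=
  f 0 * minor g h k 1 2 3 - f 1 * minor g h k 0 2 3 + f 2 * minor g h k 0 1 3
    - f 3 * minor g h k 0 1 2

/-- Cramer's rule: each `det4 f g h k * x a` is a combination of the four pairings with minors as
coefficients. -/
theorem eq_zero_of_det4 {f g h k : Fin 4 → ℤ} (hd : det4 f g h k ≠ 0) {x : Fin 4 → ℝ}
    (hf : pairing (toReal f) x = 0) (hg : pairing (toReal g) x = 0)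
    (hh : pairing (toReal h) x = 0) (hk : pairing (toReal k) x = 0) : x = 0 := by
  have hd' : (det4 f g h k : ℝ) ≠ 0 := by exact_mod_cast hd
  have key : ∀ a b c e : Fin 4, (a, b, c, e) ∈
      ([(0, 1, 2, 3), (1, 0, 2, 3), (2, 0, 1, 3), (3, 0, 1, 2)] : List _) →
      (det4 f g h k : ℝ) * x a = 0 := by
    intro a b c e hm
    simp only [List.mem_cons, Prod.mk.injEq, List.not_mem_nil, or_false] at hm
    simp only [pairing, toReal] at hf hg hh hk
    have sgn : (det4 f g h k : ℝ) * x a = (-1) ^ (a : ℕ) *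
        (minor g h k b c e * (f 0 * x 0 + f 1 * x 1 + f 2 * x 2 + f 3 * x 3)
        - minor f h k b c e * (g 0 * x 0 + g 1 * x 1 + g 2 * x 2 + g 3 * x 3)
        + minor f g k b c e * (h 0 * x 0 + h 1 * x 1 + h 2 * x 2 + h 3 * x 3)
        - minor f g h b c e * (k 0 * x 0 + k 1 * x 1 + k 2 * x 2 + k 3 * x 3)) := by
      rcases hm with ⟨rfl, rfl, rfl, rfl⟩ | ⟨rfl, rfl, rfl, rfl⟩ | ⟨rfl, rfl, rfl, rfl⟩ |
        ⟨rfl, rfl, rfl, rfl⟩ <;> simp [det4, minor] <;> ring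
    rw [sgn, hf, hg, hh, hk]
    ring
  ext a
  fin_cases a
  · exact (mul_eq_zero.1 (key 0 1 2 3 (by simp))).resolve_left hd'
  · exact (mul_eq_zero.1 (key 1 0 2 3 (by simp))).resolve_left hd'
  · exact (mul_eq_zero.1 (key 2 0 1 3 (by simp))).resolve_left hd'
  · exact (mul_eq_zero.1 (key 3 0 1 2 (by simp))).resolve_left hd'

/-- Moving away from `v` until the first of the constraints becomes tight. -/
theorem exists_tight {ι : Type*} [Fintype ι] (R : ι → Prop) (φ : ι → (Fin 4 → ℝ))
    {x v : Fin 4 → ℝ} (hx : ∀ i, R i → 0 ≤ pairing (φ i) x) (hv : ∀ i, R i → 0 ≤ pairing (φ i) v)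
    (hpos : ∃ i, R i ∧ 0 < pairing (φ i) v) :
    ∃ c : ℝ, 0 ≤ c ∧ (∀ i, R i → 0 ≤ pairing (φ i) (x - c • v)) ∧
      ∃ k, R k ∧ 0 < pairing (φ k) v ∧ pairing (φ k) (x - c • v) = 0 := by
  classical
  set s := Finset.univ.filter fun i => R i ∧ 0 < pairing (φ i) v with hs
  have hne : s.Nonempty := by
    obtain ⟨i, hi⟩ := hpos
    exact ⟨i, by simp [hs, hi]⟩
  obtain ⟨k, hk, hmin⟩ := s.exists_min_image (fun i => pairing (φ i) x / pairing (φ i) v) hne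
  have hk' : R k ∧ 0 < pairing (φ k) v := by simpa [hs] using hk
  refine ⟨pairing (φ k) x / pairing (φ k) v, div_nonneg (hx k hk'.1) hk'.2.le, ?_, k, hk'.1,
    hk'.2, ?_⟩
  · intro i hi
    rw [pairing_sub, pairing_smul]
    rcases (hv i hi).eq_or_lt with h0 | h0
    · rw [← h0]; simpa using hx i hi
    · have := hmin i (by simp [hs, hi, h0])
      rw [le_div_iff₀ h0] at this
      linarith
  · rw [pairing_sub, pairing_smul, div_mul_cancel₀ _ hk'.2.ne', sub_self]

/-- Two faces share an edge. -/
def Adjacent {m N : ℕ} (face : Fin N → Fin 4 → ℤ) (l : Fin m → Fin 4 → ℤ) (j k : Fin N) : Prop :=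
  j ≠ k ∧ ∃ a, (pairing (face j) (l a) = 0 ∧ pairing (face k) (l a) = 0) ∧
    ∃ b, a ≠ b ∧ pairing (face j) (l b) = 0 ∧ pairing (face k) (l b) = 0

instance {m N : ℕ} (face : Fin N → Fin 4 → ℤ) (l : Fin m → Fin 4 → ℤ) (j k : Fin N) :
    Decidable (Adjacent face l j k) := by unfold Adjacent; infer_instance

/-- The common edge of two faces ends at two further faces adjacent to the first one. -/
def IsEdge {m N : ℕ} (face : Fin N → Fin 4 → ℤ) (l : Fin m → Fin 4 → ℤ) (j k : Fin N) : Prop :=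
  ∃ a, (pairing (face j) (l a) = 0 ∧ pairing (face k) (l a) = 0) ∧
    ∃ b, (a ≠ b ∧ pairing (face j) (l b) = 0 ∧ pairing (face k) (l b) = 0) ∧
      ∃ p, (pairing (face p) (l a) = 0 ∧ 0 < pairing (face p) (l b) ∧ Adjacent face l j p) ∧
      ∃ q, (pairing (face q) (l b) = 0 ∧ 0 < pairing (face q) (l a) ∧ Adjacent face l j q) ∧
        det4 (face j) (face k) (face p) (face q) ≠ 0

instance {m N : ℕ} (face : Fin N → Fin 4 → ℤ) (l : Fin m → Fin 4 → ℤ) (j k : Fin N) :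
    Decidable (IsEdge face l j k) := by unfold IsEdge; infer_instance

/-- Every face which does not contain the vertex `o` has a vertex such that its edges away from
this vertex are bounded. -/
def FloorCert {m N : ℕ} (face : Fin N → Fin 4 → ℤ) (l : Fin m → Fin 4 → ℤ) (o : Fin m) : Prop :=
  ∀ j, 0 < pairing (face j) (l o) → ∃ v, pairing (face j) (l v) = 0 ∧
    (∃ k, 0 < pairing (face k) (l v) ∧ Adjacent face l j k) ∧
    ∀ k, 0 < pairing (face k) (l v) → Adjacent face l j k → IsEdge face l j k

instance {m N : ℕ} (face : Fin N → Fin 4 → ℤ) (l : Fin m → Fin 4 → ℤ) (o : Fin m) :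
    Decidable (FloorCert face l o) := by unfold FloorCert; infer_instance

theorem single_apply_nonneg {m : ℕ} (a i : Fin m) {r : ℝ} (hr : 0 ≤ r) :
    0 ≤ (Pi.single a r : Fin m → ℝ) i := by
  rcases eq_or_ne i a with rfl | h
  · simpa using hr
  · simp [h]

/-- On the two-dimensional space where `j` and `k` vanish, `p` and `q` serve as coordinates: `p`
vanishes at `a` and is positive at `b`, and `q` behaves the other way round. Only the inequalities
of `p` and `q` are needed, and both are adjacent to `j`, so it suffices to control the faces
adjacent to `j`. -/
theorem mem_cone_of_isEdge {m N : ℕ} {face : Fin N → Fin 4 → ℤ} {l : Fin m → Fin 4 → ℤ}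
    {j k : Fin N} (h : IsEdge face l j k) {x : Fin 4 → ℝ}
    (hj : pairing (toReal (face j)) x = 0) (hk : pairing (toReal (face k)) x = 0)
    (hx : ∀ i, Adjacent face l j i → 0 ≤ pairing (toReal (face i)) x) :
    ∃ c : Fin m → ℝ, (∀ i, 0 ≤ c i) ∧ x = ∑ i, c i • toReal (l i) := by
  classical
  obtain ⟨a, ⟨ja, ka⟩, b, ⟨-, jb, kb⟩, p, ⟨pa, pb, hp⟩, q, ⟨qb, qa, hq⟩, hdet⟩ := h
  have P : ∀ f v {z : ℤ}, pairing (face f) (l v) = z →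
      pairing (toReal (face f)) (toReal (l v)) = z := fun f v z hz => by
    rw [pairing_toReal, hz]
  have qa' : (0 : ℝ) < (pairing (face q) (l a) : ℤ) := by exact_mod_cast qa
  have pb' : (0 : ℝ) < (pairing (face p) (l b) : ℤ) := by exact_mod_cast pb
  set r := pairing (toReal (face q)) x / (pairing (face q) (l a) : ℤ) with hr
  set s := pairing (toReal (face p)) x / (pairing (face p) (l b) : ℤ) with hs
  -- The difference is killed by four independent forms, by the choice of `r` and `s`.
  have h0 : x - r • toReal (l a) - s • toReal (l b) = 0 := by
    apply eq_zero_of_det4 hdet <;> simp only [pairing_sub, pairing_smul]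
    · rw [hj, P _ _ ja, P _ _ jb]; simp
    · rw [hk, P _ _ ka, P _ _ kb]; simp
    · rw [P _ _ pa, P _ _ rfl, hs, div_mul_cancel₀ _ pb'.ne']; simp
    · rw [P _ _ qb, P _ _ rfl, hr, div_mul_cancel₀ _ qa'.ne']; simp
  refine ⟨Pi.single a r + Pi.single b s, fun i => ?_, ?_⟩
  · have hr0 : 0 ≤ r := div_nonneg (hx q hq) qa'.le
    have hs0 : 0 ≤ s := div_nonneg (hx p hp) pb'.le
    exact add_nonneg (single_apply_nonneg a i hr0) (single_apply_nonneg b i hs0)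
  · have h1 : ∀ (e : Fin m) (c : ℝ), ∑ i, (Pi.single e c : Fin m → ℝ) i • toReal (l i)
        = c • toReal (l e) := fun e c => by
      rw [Finset.sum_eq_single e]
      · simp
      · intro i _ hi; simp [hi]
      · simp
    simp only [Pi.add_apply, add_smul, Finset.sum_add_distrib, h1]
    rw [sub_sub, sub_eq_zero] at h0
    exact h0

theorem cone_add_smul {m : ℕ} {l : Fin m → Fin 4 → ℤ} {x : Fin 4 → ℝ} (v : Fin m) {r : ℝ}
    (hr : 0 ≤ r)
    (h : ∃ c : Fin m → ℝ, (∀ i, 0 ≤ c i) ∧ x - r • toReal (l v) = ∑ i, c i • toReal (l i)) :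
    ∃ c : Fin m → ℝ, (∀ i, 0 ≤ c i) ∧ x = ∑ i, c i • toReal (l i) := by
  classical
  obtain ⟨c, hc, h⟩ := h
  refine ⟨c + Pi.single v r, fun i => add_nonneg (hc i) (single_apply_nonneg v i hr), ?_⟩
  have h1 : ∑ i, (Pi.single v r : Fin m → ℝ) i • toReal (l i) = r • toReal (l v) := by
    rw [Finset.sum_eq_single v]
    · simp
    · intro i _ hi; simp [hi]
    · simp
  simp only [Pi.add_apply, add_smul, Finset.sum_add_distrib, h1, ← h]
  abel

/-- The cone cut out by the faces is generated by the vertices. -/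
theorem mem_cone_of_pairing_nonneg {m N : ℕ} {face : Fin N → Fin 4 → ℤ} {l : Fin m → Fin 4 → ℤ}
    {o : Fin m} (hnn : ∀ j i, 0 ≤ pairing (face j) (l i))
    (hpos : ∃ j, 0 < pairing (face j) (l o)) (hcert : FloorCert face l o)
    {x : Fin 4 → ℝ} (hx : ∀ j, 0 ≤ pairing (toReal (face j)) x) :
    ∃ c : Fin m → ℝ, (∀ i, 0 ≤ c i) ∧ x = ∑ i, c i • toReal (l i) := by
  have hnn' : ∀ j i, 0 ≤ pairing (toReal (face j)) (toReal (l i)) := fun j i => by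
    rw [pairing_toReal]; exact_mod_cast hnn j i
  have hiff : ∀ {j i}, 0 < pairing (toReal (face j)) (toReal (l i)) ↔
      0 < pairing (face j) (l i) := by
    intro j i; rw [pairing_toReal]; norm_cast
  -- Move away from the vertex `o` until a face `j` not containing `o` becomes tight.
  obtain ⟨r, hr, h1, j, -, hjo, hj⟩ := exists_tight (fun _ => True) (fun j => toReal (face j))
    (fun j _ => hx j) (fun j _ => hnn' j o)
    (by obtain ⟨j, hj⟩ := hpos; exact ⟨j, trivial, hiff.2 hj⟩)
  apply cone_add_smul o hr
  obtain ⟨v, hjv, ⟨k, hk, hjk⟩, hall⟩ := hcert j (hiff.1 hjo)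
  -- Inside the plane of `j`, move away from its vertex `v`, watching only the faces adjacent to
  -- `j`. The one that becomes tight does not contain `v`, so the certificate says that it bounds an
  -- edge of `j`.
  obtain ⟨s, hs, h2, k, hjk, hkv, hk⟩ := exists_tight (Adjacent face l j)
    (fun j => toReal (face j)) (fun j _ => h1 j trivial) (fun j _ => hnn' j v)
    ⟨k, hjk, hiff.2 hk⟩
  apply cone_add_smul v hs
  refine mem_cone_of_isEdge (hall k (hiff.1 hkv) hjk) ?_ hk h2
  rw [pairing_sub, hj, pairing_smul, pairing_toReal, hjv]
  simp

/-! ### Polyhedra given by integral coordinates of their faces and vertices -/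

/-- The intersection of the half-spaces given by integral coordinates. -/
def cell (ω : ℂ) {N : ℕ} (face : Fin N → Fin 4 → ℤ) : Set H3 :=
  {p | ∀ j, 0 ≤ pairing (toReal (face j)) (coord ω p)}

/-- The part of the cell in a bounding plane. -/
def faceSet (ω : ℂ) {N : ℕ} (face : Fin N → Fin 4 → ℤ) (j : Fin N) : Set H3 :=
  cell ω face ∩ {p | pairing (toReal (face j)) (coord ω p) = 0}

/-- The boundary point of an integral vector. -/
def vcusp (ω : ℂ) (v : Fin 4 → ℤ) : OnePoint ℂ := cusp (cvec ω v 0) (cvec ω v 1)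

/-- The coordinates represent a point of upper half space. -/
def Timelike (t n : ℤ) (x : Fin 4 → ℤ) : Prop :=
  0 < x 3 ∧ x 1 ^ 2 + t * (x 1 * x 2) + n * x 2 ^ 2 < x 0 * x 3

instance (t n : ℤ) (x : Fin 4 → ℤ) : Decidable (Timelike t n x) := by
  unfold Timelike; infer_instance

theorem continuous_pairing_coord (ω : ℂ) (g : Fin 4 → ℝ) :
    Continuous fun p : H3 => pairing g (coord ω p) := by
  simp only [pairing, coord, cons_val]
  fun_prop

theorem isClosed_cell (ω : ℂ) {N : ℕ} (face : Fin N → Fin 4 → ℤ) : IsClosed (cell ω face) := by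
  have : cell ω face = ⋂ j, {p | 0 ≤ pairing (toReal (face j)) (coord ω p)} := by
    ext p; simp [cell]
  rw [this]
  exact isClosed_iInter fun j => isClosed_le continuous_const (continuous_pairing_coord ω _)

theorem isOpen_pairing_pos (ω : ℂ) {N : ℕ} (face : Fin N → Fin 4 → ℤ) (R : Fin N → Prop) :
    IsOpen {p : H3 | ∀ j, R j → 0 < pairing (toReal (face j)) (coord ω p)} := by
  have : {p : H3 | ∀ j, R j → 0 < pairing (toReal (face j)) (coord ω p)}
      = ⋂ j, {p | R j → 0 < pairing (toReal (face j)) (coord ω p)} := by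
    ext p; simp
  rw [this]
  refine isOpen_iInter_of_finite fun j => ?_
  by_cases hR : R j
  · simpa [hR] using isOpen_lt continuous_const (continuous_pairing_coord ω _)
  · simp [hR]

/-- Along a vertical line a form is affine in the squared height with slope `g 0`. So `g 0 = 0`
means a vertical plane, and for `g 0 > 0` nonnegativity means lying on or above a hemisphere. -/
theorem pairing_vertical {ω : ℂ} (g : Fin 4 → ℤ) (p q : H3) (hz : q.1.1 = p.1.1) :
    pairing (toReal g) (coord ω q) = pairing (toReal g) (coord ω p)
      + g 0 * (q.1.2 ^ 2 - p.1.2 ^ 2) := by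
  simp [pairing, coord, toReal, hz]
  ring

/-! ### Points from integer vectors, and the negative side of a plane. -/

namespace IsQuadGen

variable {ω : ℂ} {t n : ℤ}

/-- Dividing by the last coordinate leaves a positive determinant, whose square root is the height.
Points with prescribed signs for all faces can thus be exhibited as integer vectors. -/
theorem exists_coord_eq (h : IsQuadGen ω t n) {x : Fin 4 → ℤ} (hx : Timelike t n x) :
    ∃ p : H3, ∃ c : ℝ, 0 < c ∧ coord ω p = c • toReal x := by
  obtain ⟨h3, hx⟩ := hx
  have h3' : (0 : ℝ) < x 3 := by exact_mod_cast h3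
  have hx' : ((x 1 : ℝ) ^ 2 + t * (x 1 * x 2) + n * x 2 ^ 2) < x 0 * x 3 := by exact_mod_cast hx
  set a : ℝ := x 1 / x 3 with ha
  set b : ℝ := x 2 / x 3 with hb
  have hlt : 0 < x 0 / x 3 - (a ^ 2 + t * (a * b) + n * b ^ 2) := by
    have : x 0 / x 3 - (a ^ 2 + t * (a * b) + n * b ^ 2)
        = (x 0 * x 3 - ((x 1 : ℝ) ^ 2 + t * (x 1 * x 2) + n * x 2 ^ 2)) / (x 3 : ℝ) ^ 2 := by
      rw [ha, hb]; field_simp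
    rw [this]
    exact div_pos (by linarith) (by positivity)
  refine ⟨⟨(a + b * ω, √(x 0 / x 3 - (a ^ 2 + t * (a * b) + n * b ^ 2))), Real.sqrt_pos.2 hlt⟩,
    (x 3 : ℝ)⁻¹, inv_pos.2 h3', ?_⟩
  have hi := h.im_pos.ne'
  ext i
  fin_cases i
  · simp only [coord, h.norm_sq, Real.sq_sqrt hlt.le, toReal, Fin.zero_eta, cons_val_zero,
      Pi.smul_apply, smul_eq_mul]
    field_simp
    ring
  · simp [coord, toReal, hi]
    rw [ha]; field_simp
  · simp [coord, toReal, hi]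
    rw [hb]; field_simp
  · simp [coord, toReal, h3'.ne']

/-- Near every point of a hyperbolic plane its form takes negative values. -/
theorem exists_pairing_neg (h : IsQuadGen ω t n) {g : Fin 4 → ℤ} (hg : 0 < disc t n g) {p : H3}
    (hp : pairing (toReal g) (coord ω p) = 0) {U : Set H3} (hU : IsOpen U) (hpU : p ∈ U) :
    ∃ q ∈ U, pairing (toReal g) (coord ω q) < 0 := by
  by_cases h0 : g 0 = 0
  -- A vertical plane has normal direction `offDiag ω g`; a horizontal move against it decreases the
  -- form.
  · let φ : ℝ → H3 := fun e => ⟨(p.1.1 - e * offDiag ω g, p.1.2), p.2⟩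
    have hφ : Continuous φ := by
      apply Continuous.subtype_mk; fun_prop
    have hφ0 : φ 0 = p := by
      apply Subtype.ext; simp [φ]
    have hev : ∀ᶠ e in 𝓝[>] (0 : ℝ), φ e ∈ U := by
      apply nhdsWithin_le_nhds
      apply hφ.continuousAt
      rw [hφ0]
      exact hU.mem_nhds hpU
    obtain ⟨e, heU, he⟩ := (hev.and self_mem_nhdsWithin).exists
    refine ⟨φ e, heU, ?_⟩
    have he' : (0 : ℝ) < e := he
    have hnorm : 0 < ‖offDiag ω g‖ ^ 2 := by
      have h1 := h.norm_offDiag g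
      have h2 : (0 : ℝ) < ((4 * n - t ^ 2 : ℤ) : ℝ) := by exact_mod_cast h.disc_pos
      have h3 : (0 : ℝ) < (disc t n g : ℤ) := by exact_mod_cast hg
      rw [← h1, h0] at h3
      simpa using (pos_iff_pos_of_mul_pos h3).1 h2
    have e1 : (conj (offDiag ω g) * (φ e).1.1).re
        = (conj (offDiag ω g) * p.1.1).re - e * ‖offDiag ω g‖ ^ 2 := by
      have : conj (offDiag ω g) * (φ e).1.1
          = conj (offDiag ω g) * p.1.1 - ((e * ‖offDiag ω g‖ ^ 2 : ℝ) : ℂ) := by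
        push_cast; rw [normSq_cast]; simp only [φ]; ring
      rw [this, Complex.sub_re, Complex.ofReal_re]
    rw [← h.planeForm_eq] at hp ⊢
    simp only [planeForm, h0, Int.cast_zero, zero_mul, zero_add] at hp ⊢
    rw [e1]
    have := mul_pos he' hnorm
    linarith
  -- Otherwise a vertical move does it, down if `g 0 > 0` and up if `g 0 < 0`; the exponential keeps
  -- the height positive.
  · let φ : ℝ → H3 := fun e => ⟨(p.1.1, p.1.2 * Real.exp (-(g 0 * e))),
      mul_pos p.2 (Real.exp_pos _)⟩
    have hφ : Continuous φ := by
      apply Continuous.subtype_mk; fun_prop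
    have hφ0 : φ 0 = p := by
      apply Subtype.ext; simp [φ]
    have hev : ∀ᶠ e in 𝓝[>] (0 : ℝ), φ e ∈ U := by
      apply nhdsWithin_le_nhds
      apply hφ.continuousAt
      rw [hφ0]
      exact hU.mem_nhds hpU
    obtain ⟨e, heU, he⟩ := (hev.and self_mem_nhdsWithin).exists
    refine ⟨φ e, heU, ?_⟩
    have he' : (0 : ℝ) < e := he
    rw [pairing_vertical g p (φ e) rfl, hp, zero_add]
    have hT := pow_pos p.2 2
    have e1 : (φ e).1.2 ^ 2 - p.1.2 ^ 2 = p.1.2 ^ 2 * (Real.exp (-(2 * (g 0 * e))) - 1) := by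
      simp only [φ, mul_pow, ← Real.exp_nat_mul]
      push_cast
      ring_nf
    rw [e1]
    rcases lt_or_gt_of_ne h0 with hneg | hpos
    · have hneg' : (g 0 : ℝ) < 0 := by exact_mod_cast hneg
      have h1 : 1 < Real.exp (-(2 * (g 0 * e))) := by
        rw [Real.one_lt_exp_iff]
        nlinarith
      exact mul_neg_of_neg_of_pos hneg' (mul_pos hT (by linarith))
    · have hpos' : (0 : ℝ) < g 0 := by exact_mod_cast hpos
      have h1 : Real.exp (-(2 * (g 0 * e))) < 1 := by
        rw [Real.exp_lt_one_iff]
        nlinarith [mul_pos hpos' he']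
      exact mul_neg_of_pos_of_neg hpos' (mul_neg_of_pos_of_neg hT (by linarith))

end IsQuadGen

/-- Integral data which describe a polyhedron: coordinates of its faces and representatives of its
ideal vertices, among them a vertex `o` at infinity. -/
structure CellData (t n : ℤ) {m N : ℕ} (vert : Fin m → Fin 4 → ℤ) (face : Fin N → Fin 4 → ℤ)
    (o : Fin m) : Prop where
  nonneg : ∀ j i, 0 ≤ pairing (face j) (lvec t n (vert i))
  disc_pos : ∀ j, 0 < disc t n (face j)
  apex : vert o = ![1, 0, 0, 0]
  finite : ∀ i, i ≠ o → 0 < lvec t n (vert i) 3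
  other : ∃ i, i ≠ o
  floor : ∃ j, 0 < pairing (face j) (lvec t n (vert o))
  cert : FloorCert face (fun i => lvec t n (vert i)) o
  point : ∀ j, ∃ w : Fin 4 → ℤ, Timelike t n w ∧ pairing (face j) w = 0 ∧
    ∀ k, k ≠ j → 0 < pairing (face k) w
  inner : ∃ w : Fin 4 → ℤ, Timelike t n w ∧ ∀ k, 0 < pairing (face k) w

/-! ### Interior, frontier and faces of the cell. -/

namespace CellData

variable {ω : ℂ} {t n : ℤ} {m N : ℕ} {vert : Fin m → Fin 4 → ℤ} {face : Fin N → Fin 4 → ℤ}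
  {o : Fin m}

theorem coeff_nonneg (D : CellData t n vert face o) (j : Fin N) : 0 ≤ face j 0 := by
  have := D.nonneg j o
  rw [D.apex] at this
  simpa [pairing, lvec] using this

theorem exists_cone (D : CellData t n vert face o) {x : Fin 4 → ℝ}
    (hx : ∀ j, 0 ≤ pairing (toReal (face j)) x) :
    ∃ c : Fin m → ℝ, (∀ i, 0 ≤ c i) ∧ x = ∑ i, c i • toReal (lvec t n (vert i)) :=
  mem_cone_of_pairing_nonneg D.nonneg D.floor D.cert hx

/-- A point of a face off all other planes serves twice: it separates the faces as sets, and it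
shows that each face has interior in its plane. -/
theorem exists_face_point (D : CellData t n vert face o) (h : IsQuadGen ω t n) (j : Fin N) :
    ∃ p, p ∈ faceSet ω face j ∧ ∀ k, k ≠ j → 0 < pairing (toReal (face k)) (coord ω p) := by
  obtain ⟨w, hw, hj, hk⟩ := D.point j
  obtain ⟨p, c, hc, hp⟩ := h.exists_coord_eq hw
  have h1 : pairing (toReal (face j)) (coord ω p) = 0 := by
    rw [hp, pairing_smul, pairing_toReal, hj]; simp
  have h2 : ∀ k, k ≠ j → 0 < pairing (toReal (face k)) (coord ω p) := fun k hkj => by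
    rw [hp, pairing_smul, pairing_toReal]
    have : (0 : ℝ) < (pairing (face k) w : ℤ) := by exact_mod_cast hk k hkj
    positivity
  refine ⟨p, ⟨fun k => ?_, h1⟩, h2⟩
  by_cases hkj : k = j
  · rw [hkj, h1]
  · exact (h2 k hkj).le

theorem faceSet_injective (D : CellData t n vert face o) (h : IsQuadGen ω t n) :
    Function.Injective (faceSet ω face) := by
  intro j k hjk
  by_contra hne
  obtain ⟨p, hp, hpos⟩ := D.exists_face_point h j
  have h1 := hpos k (Ne.symm hne)
  rw [hjk] at hp
  exact h1.ne' hp.2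

theorem interior_cell (D : CellData t n vert face o) (h : IsQuadGen ω t n) :
    interior (cell ω face) = {p | ∀ j, 0 < pairing (toReal (face j)) (coord ω p)} := by
  apply Set.Subset.antisymm
  · intro p hp j
    refine (interior_subset hp j).lt_of_ne fun h0 => ?_
    obtain ⟨q, hq, hneg⟩ := h.exists_pairing_neg (D.disc_pos j) h0.symm isOpen_interior hp
    exact hneg.not_ge (interior_subset hq j)
  · apply interior_maximal
    · exact fun p hp j => (hp j).le
    · simpa using isOpen_pairing_pos ω face fun _ => True

theorem frontier_cell (D : CellData t n vert face o) (h : IsQuadGen ω t n) :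
    frontier (cell ω face) = ⋃₀ Set.range (faceSet ω face) := by
  rw [(isClosed_cell ω face).frontier_eq, D.interior_cell h]
  ext p
  simp only [Set.mem_sdiff, Set.mem_ofPred_eq, not_forall, not_lt, Set.sUnion_range, Set.mem_iUnion]
  constructor
  · rintro ⟨hp, j, hj⟩
    exact ⟨j, hp, hj.antisymm (hp j)⟩
  · rintro ⟨j, hp, hj⟩
    exact ⟨hp, j, le_of_eq hj⟩

theorem isPolyhedronWithFaces (D : CellData t n vert face o) (h : IsQuadGen ω t n) :
    IsPolyhedronWithFaces (cell ω face) (Set.range (faceSet ω face)) := by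
  classical
  refine ⟨Set.finite_range _, ?_, ?_⟩
  · rw [D.interior_cell h]
    obtain ⟨w, hw, hk⟩ := D.inner
    obtain ⟨p, c, hc, hp⟩ := h.exists_coord_eq hw
    refine ⟨p, fun k => ?_⟩
    rw [hp, pairing_smul, pairing_toReal]
    have : (0 : ℝ) < (pairing (face k) w : ℤ) := by exact_mod_cast hk k
    positivity
  -- The half-spaces have to be indexed by the faces as sets; injectivity of `faceSet` makes the
  -- chosen index the right one.
  · let H : Set H3 → ℝ × ℂ × ℝ := fun f =>
      if hf : ∃ j, faceSet ω face j = f then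
        ((face hf.choose 0 : ℝ), offDiag ω (face hf.choose), (face hf.choose 3 : ℝ)) else 0
    have hH : ∀ j, H (faceSet ω face j)
        = ((face j 0 : ℝ), offDiag ω (face j), (face j 3 : ℝ)) := by
      intro j
      have hf : ∃ k, faceSet ω face k = faceSet ω face j := ⟨j, rfl⟩
      have := D.faceSet_injective h hf.choose_spec
      simp only [H, dif_pos hf, this]
    refine ⟨H, ?_, ?_, ?_⟩
    · rintro _ ⟨j, rfl⟩
      rw [hH]
      have h1 := h.norm_offDiag (face j)
      have h2 : (0 : ℝ) < ((4 * n - t ^ 2 : ℤ) : ℝ) := by exact_mod_cast h.disc_pos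
      have h3 : (0 : ℝ) < (disc t n (face j) : ℤ) := by exact_mod_cast D.disc_pos j
      rw [← h1] at h3
      exact (pos_iff_pos_of_mul_pos h3).1 h2
    · ext p
      simp only [Set.forall_mem_range, hH, h.planeForm_eq]
      rfl
    · rintro _ ⟨j, rfl⟩
      simp only [hH, h.planeForm_eq]
      refine ⟨rfl, {p | ∀ k, k ≠ j → 0 < pairing (toReal (face k)) (coord ω p)},
        isOpen_pairing_pos ω face _, ?_, ?_⟩
      · obtain ⟨p, hp, hpos⟩ := D.exists_face_point h j
        exact ⟨p, hpos, hp⟩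
      · rintro p ⟨hp, hj⟩
        refine ⟨fun k => ?_, hj⟩
        by_cases hkj : k = j
        · rw [hkj]; exact le_of_eq (Eq.symm hj)
        · exact (hp k hkj).le

/-- A point of the cell is a nonnegative combination of the vertices. Since `face j` is nonnegative
at all of them, it can vanish at the point only if every vertex off its plane has coefficient zero.
-/
theorem faceSet_eq_hull (D : CellData t n vert face o) (h : IsQuadGen ω t n) (j : Fin N) :
    faceSet ω face j = hull fun i : {i // pairing (face j) (lvec t n (vert i)) = 0} =>
      lightMat (cvec ω (vert i)) := by
  classical
  ext p
  constructor
  · rintro ⟨hp, hj⟩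
    obtain ⟨c, hc, hx⟩ := D.exists_cone hp
    have hz : ∀ i, pairing (face j) (lvec t n (vert i)) ≠ 0 → c i = 0 := by
      have h1 : ∑ i, c i * (pairing (face j) (lvec t n (vert i)) : ℤ) = 0 := by
        have hj' : pairing (toReal (face j)) (coord ω p) = 0 := hj
        rw [← hj', hx, pairing_sum]
        simp only [pairing_smul, pairing_toReal]
      have hnn : ∀ i, (0 : ℝ) ≤ (pairing (face j) (lvec t n (vert i)) : ℤ) := fun i => by
        exact_mod_cast D.nonneg j i
      intro i hi
      have := (Finset.sum_eq_zero_iff_of_nonneg fun i _ => mul_nonneg (hc i) (hnn i)).1 h1 i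
        (Finset.mem_univ i)
      exact (mul_eq_zero.1 this).resolve_right (by exact_mod_cast hi)
    refine ⟨fun i => c i, fun i => hc i, ?_⟩
    rw [h.posMat_eq, hx, herm_sum]
    simp only [herm_smul, ← h.lightMat_cvec]
    rw [← Finset.sum_subtype (Finset.univ.filter fun i =>
      pairing (face j) (lvec t n (vert i)) = 0) (by simp)
      (fun i => c i • lightMat (cvec ω (vert i))), Finset.sum_filter_of_ne]
    intro i _ hi
    by_contra hne
    rw [hz i hne, zero_smul] at hi
    exact hi rfl
  · rintro ⟨c, hc, hp⟩
    have hx : coord ω p = ∑ i : {i // pairing (face j) (lvec t n (vert i)) = 0},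
        c i • toReal (lvec t n (vert i)) := by
      apply h.herm_injective
      rw [← h.posMat_eq, hp, herm_sum]
      simp only [herm_smul, ← h.lightMat_cvec]
    have e : ∀ k, pairing (toReal (face k)) (coord ω p)
        = ∑ i : {i // pairing (face j) (lvec t n (vert i)) = 0},
          c i * (pairing (face k) (lvec t n (vert i)) : ℤ) := fun k => by
      rw [hx, pairing_sum]
      simp only [pairing_smul, pairing_toReal]
    refine ⟨fun k => ?_, ?_⟩
    · rw [e]
      exact Finset.sum_nonneg fun i _ => mul_nonneg (hc i) (by exact_mod_cast D.nonneg k i)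
    · rw [Set.mem_ofPred_eq, e]
      exact Finset.sum_eq_zero fun i _ => by rw [i.2]; simp

end CellData

/-! ### Integral matrices -/

/-- The rational part of a determinant. -/
def detRe (n : ℤ) (c₀ c₁ : Fin 4 → ℤ) : ℤ :=
  c₀ 0 * c₁ 2 - n * (c₀ 1 * c₁ 3) - (c₁ 0 * c₀ 2 - n * (c₁ 1 * c₀ 3))

/-- The coefficient of `ω` in a determinant. -/
def detIm (t : ℤ) (c₀ c₁ : Fin 4 → ℤ) : ℤ :=
  c₀ 0 * c₁ 3 + c₀ 1 * c₁ 2 + t * (c₀ 1 * c₁ 3) - (c₁ 0 * c₀ 3 + c₁ 1 * c₀ 2 + t * (c₁ 1 * c₀ 3))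

namespace IsQuadGen

variable {t n : ℤ}

theorem det_cmat {ω : ℂ} (h : IsQuadGen ω t n) (c₀ c₁ : Fin 4 → ℤ) :
    (cmat ω c₀ c₁).det = detRe n c₀ c₁ + detIm t c₀ c₁ * ω := by
  rw [cmat, det_fin_two_of, detRe, detIm]
  push_cast
  linear_combination (c₀ 1 * c₁ 3 - c₁ 1 * c₀ 3 : ℂ) * h.sq_eq

variable {d : ℕ}

theorem mem_intRing (h : IsQuadGen (omega d) t n) {x : ℂ} :
    x ∈ intRing d ↔ ∃ a b : ℤ, x = a + b * omega d := by
  constructor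
  · intro hx
    induction hx using Algebra.adjoin_induction with
    | mem x hx => exact ⟨0, 1, by simpa using hx⟩
    | algebraMap r => exact ⟨r, 0, by simp⟩
    | add x y _ _ hx hy =>
      obtain ⟨a, b, rfl⟩ := hx
      obtain ⟨c, e, rfl⟩ := hy
      exact ⟨a + c, b + e, by push_cast; ring⟩
    | mul x y _ _ hx hy =>
      obtain ⟨a, b, rfl⟩ := hx
      obtain ⟨c, e, rfl⟩ := hy
      refine ⟨a * c - n * (b * e), a * e + b * c + t * (b * e), ?_⟩
      push_cast
      linear_combination (b * e : ℂ) * h.sq_eq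
  · rintro ⟨a, b, rfl⟩
    have hω : omega d ∈ intRing d := Algebra.subset_adjoin rfl
    exact add_mem (intCast_mem _ a) (mul_mem (intCast_mem _ b) hω)

theorem norm_sq_int {ω : ℂ} (h : IsQuadGen ω t n) (a b : ℤ) :
    ‖(a + b * ω : ℂ)‖ ^ 2 = (a ^ 2 + t * (a * b) + n * b ^ 2 : ℤ) := by
  have := h.norm_sq a b
  push_cast at this ⊢
  exact this

theorem one_le_norm_sq (h : IsQuadGen (omega d) t n) {x : ℂ} (hx : x ∈ intRing d) (h0 : x ≠ 0) :
    1 ≤ ‖x‖ ^ 2 := by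
  obtain ⟨a, b, rfl⟩ := h.mem_intRing.1 hx
  have h1 : 0 < ‖(a + b * omega d : ℂ)‖ ^ 2 := by
    have := norm_pos_iff.2 h0
    positivity
  rw [h.norm_sq_int] at h1 ⊢
  exact_mod_cast h1

theorem norm_eq_one_of_mul (h : IsQuadGen (omega d) t n) {x y : ℂ} (hx : x ∈ intRing d)
    (hy : y ∈ intRing d) (hxy : x * y = 1) : ‖x‖ = 1 := by
  have h1 := h.one_le_norm_sq hx (left_ne_zero_of_mul_eq_one hxy)
  have h2 := h.one_le_norm_sq hy (right_ne_zero_of_mul_eq_one hxy)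
  have h3 : ‖x‖ ^ 2 * ‖y‖ ^ 2 = 1 := by
    rw [← mul_pow, ← norm_mul, hxy]; simp
  have h4 : ‖x‖ ^ 2 = 1 := by nlinarith
  exact (pow_eq_one_iff_of_nonneg (norm_nonneg _) two_ne_zero).1 h4

theorem conj_mem (h : IsQuadGen (omega d) t n) {x : ℂ} (hx : x ∈ intRing d) :
    conj x ∈ intRing d := by
  obtain ⟨a, b, rfl⟩ := h.mem_intRing.1 hx
  refine h.mem_intRing.2 ⟨a + b * t, -b, ?_⟩
  simp [h.conj_eq]
  ring

theorem exists_cmat (h : IsQuadGen (omega d) t n) (A : Matrix (Fin 2) (Fin 2) (intRing d)) :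
    ∃ c₀ c₁ : Fin 4 → ℤ, A.map (fun x : intRing d => (x : ℂ)) = cmat (omega d) c₀ c₁ := by
  have H : ∀ i j, ∃ a b : ℤ, (A i j : ℂ) = a + b * omega d := fun i j =>
    h.mem_intRing.1 (A i j).2
  choose a b hab using H
  refine ⟨![a 0 0, b 0 0, a 1 0, b 1 0], ![a 0 1, b 0 1, a 1 1, b 1 1], ?_⟩
  ext i j
  fin_cases i <;> fin_cases j <;> simp [cmat, hab]

theorem exists_map_eq_cmat (h : IsQuadGen (omega d) t n) (c₀ c₁ : Fin 4 → ℤ) :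
    ∃ A : Matrix (Fin 2) (Fin 2) (intRing d),
      A.map (fun x : intRing d => (x : ℂ)) = cmat (omega d) c₀ c₁ := by
  have H : ∀ a b : ℤ, (a + b * omega d : ℂ) ∈ intRing d := fun a b => h.mem_intRing.2 ⟨a, b, rfl⟩
  refine ⟨!![⟨_, H (c₀ 0) (c₀ 1)⟩, ⟨_, H (c₁ 0) (c₁ 1)⟩; ⟨_, H (c₀ 2) (c₀ 3)⟩,
    ⟨_, H (c₁ 2) (c₁ 3)⟩], ?_⟩
  ext i j
  fin_cases i <;> fin_cases j <;> simp [cmat]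

theorem det_map_val (A : Matrix (Fin 2) (Fin 2) (intRing d)) :
    (A.map (fun x : intRing d => (x : ℂ))).det = (A.det : ℂ) := by
  simp [det_fin_two]

theorem exists_of_mem_bianchi (h : IsQuadGen (omega d) t n) {A : GL (Fin 2) ℂ}
    (hA : A ∈ bianchi d) : ∃ c₀ c₁ : Fin 4 → ℤ,
      (A : Matrix (Fin 2) (Fin 2) ℂ) = cmat (omega d) c₀ c₁ ∧ (cmat (omega d) c₀ c₁).det = 1 := by
  obtain ⟨B, rfl⟩ := hA
  obtain ⟨c₀, c₁, hc⟩ := h.exists_cmat B.1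
  refine ⟨c₀, c₁, hc, ?_⟩
  rw [← hc, det_map_val, B.2]
  rfl

theorem exists_of_mem_extendedBianchi (h : IsQuadGen (omega d) t n) {A : GL (Fin 2) ℂ}
    (hA : A ∈ extendedBianchi d) : ∃ c₀ c₁ : Fin 4 → ℤ,
      (A : Matrix (Fin 2) (Fin 2) ℂ) = cmat (omega d) c₀ c₁ ∧
        ‖(cmat (omega d) c₀ c₁).det‖ = 1 := by
  obtain ⟨B, rfl⟩ := hA
  obtain ⟨c₀, c₁, hc⟩ := h.exists_cmat B.1
  refine ⟨c₀, c₁, hc, ?_⟩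
  rw [← hc, det_map_val]
  have hdet : B.1.det * (B⁻¹ : GL (Fin 2) (intRing d)).1.det = 1 := by
    rw [← det_mul, ← Units.val_mul, mul_inv_cancel]; simp
  exact h.norm_eq_one_of_mul B.1.det.2 (B⁻¹ : GL (Fin 2) (intRing d)).1.det.2
    (by exact_mod_cast congrArg Subtype.val hdet)

theorem exists_mem_bianchi (h : IsQuadGen (omega d) t n) {c₀ c₁ : Fin 4 → ℤ}
    (hre : detRe n c₀ c₁ = 1) (him : detIm t c₀ c₁ = 0) :
    ∃ A ∈ bianchi d, (A : Matrix (Fin 2) (Fin 2) ℂ) = cmat (omega d) c₀ c₁ := by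
  obtain ⟨B, hB⟩ := h.exists_map_eq_cmat c₀ c₁
  have hdet : B.det = 1 := by
    apply Subtype.ext
    rw [← det_map_val, hB, h.det_cmat, hre, him]
    simp
  exact ⟨_, ⟨⟨B, hdet⟩, rfl⟩, hB⟩

theorem exists_mem_extendedBianchi (h : IsQuadGen (omega d) t n) {c₀ c₁ : Fin 4 → ℤ}
    (hdet : polar t n (lvec t n c₀) (lvec t n c₁) = 1) :
    ∃ A ∈ extendedBianchi d, (A : Matrix (Fin 2) (Fin 2) ℂ) = cmat (omega d) c₀ c₁ := by
  obtain ⟨B, hB⟩ := h.exists_map_eq_cmat c₀ c₁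
  have h1 := h.polar_lvec c₀ c₁
  rw [hdet, ← hB, det_map_val] at h1
  have hu : IsUnit B.det := by
    -- The inverse of a determinant of norm 1 is its conjugate, which lies in the ring again.
    refine IsUnit.of_mul_eq_one (⟨_, h.conj_mem B.det.2⟩ : intRing d) ?_
    apply Subtype.ext
    have h2 := normSq_cast (B.det : ℂ)
    change (B.det : ℂ) * conj (B.det : ℂ) = 1
    rw [← h2]
    exact_mod_cast h1
  exact ⟨_, ⟨GeneralLinearGroup.mk'' B hu, rfl⟩, hB⟩

theorem bianchi_le_extendedBianchi (d : ℕ) : bianchi d ≤ extendedBianchi d := by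
  rintro _ ⟨B, rfl⟩
  exact ⟨_, rfl⟩

theorem pairing_moebius {ω : ℂ} (h : IsQuadGen ω t n) {A : GL (Fin 2) ℂ} {c₀ c₁ : Fin 4 → ℤ}
    (hA : (A : Matrix (Fin 2) (Fin 2) ℂ) = cmat ω c₀ c₁) (g : Fin 4 → ℤ) (p : H3) :
    denom A p * pairing (toReal g) (coord ω (moebius A p))
      = pairing (toReal (pull t n c₀ c₁ g)) (coord ω p) := by
  rw [← h.traceForm_posMat, traceForm_moebius, hA, h.formMat_pull, h.traceForm_posMat]

theorem mem_moebius_image_plane {ω : ℂ} (h : IsQuadGen ω t n) {A : GL (Fin 2) ℂ}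
    {c₀ c₁ : Fin 4 → ℤ} (hA : ((A⁻¹ : GL (Fin 2) ℂ) : Matrix (Fin 2) (Fin 2) ℂ) = cmat ω c₀ c₁)
    (g : Fin 4 → ℤ) (p : H3) :
    p ∈ moebius A '' {q | pairing (toReal g) (coord ω q) = 0} ↔
      pairing (toReal (pull t n c₀ c₁ g)) (coord ω p) = 0 := by
  rw [mem_moebius_image, ← h.pairing_moebius hA, Set.mem_ofPred_eq,
    mul_eq_zero_iff_left (denom_pos _ _).ne']

end IsQuadGen

/-! ### Ideal points of the cell. -/

namespace IsQuadGen

variable {ω : ℂ} {t n : ℤ}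

theorem lvec_apply_three (h : IsQuadGen ω t n) (v : Fin 4 → ℤ) :
    (lvec t n v 3 : ℝ) = ‖cvec ω v 1‖ ^ 2 := by
  have : cvec ω v 1 = v 2 + v 3 * ω := rfl
  rw [this, h.norm_sq_int]
  norm_cast
  simp [lvec]
  ring

/-- The points above a finite integral boundary point. -/
theorem coord_above (h : IsQuadGen ω t n) {v : Fin 4 → ℤ} (hv : 0 < lvec t n v 3) {T : ℝ}
    (hT : 0 < T) : coord ω ⟨(cvec ω v 0 / cvec ω v 1, T), hT⟩
      = (lvec t n v 3 : ℝ)⁻¹ • toReal (lvec t n v) + T ^ 2 • ![1, 0, 0, 0] := by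
  have hv' : (0 : ℝ) < lvec t n v 3 := by exact_mod_cast hv
  have h3 := h.lvec_apply_three v
  have hq : cvec ω v 1 ≠ 0 := by
    intro h0
    rw [h0] at h3
    simp at h3
    omega
  have hq' : conj (cvec ω v 1) ≠ 0 := by simpa using hq
  have h3' : ((lvec t n v 3 : ℝ) : ℂ) = cvec ω v 1 * conj (cvec ω v 1) := by
    rw [h3, ← normSq_cast]; push_cast; rfl
  apply h.herm_injective
  rw [← h.posMat_eq, herm_add, herm_smul, ← h.lightMat_cvec]
  ext i j
  fin_cases i <;> fin_cases j <;>
    simp only [posMat, lightMat, herm, vecMulVec_apply, Fin.zero_eta, Fin.mk_one, Matrix.of_apply,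
      cons_val', cons_val_zero, cons_val_one, cons_val_fin_one, Matrix.add_apply,
      Matrix.smul_apply, Complex.real_smul, Complex.ofReal_inv, h3', Pi.star_apply,
      RCLike.star_def, Pi.smul_apply, smul_eq_mul, Complex.ofReal_add, Complex.ofReal_pow,
      normSq_cast, map_div₀, cons_val]
  · push_cast; field_simp
  · push_cast; field_simp; ring
  · push_cast; field_simp; simp
  · push_cast; field_simp; simp

end IsQuadGen

namespace CellData

variable {ω : ℂ} {t n : ℤ} {m N : ℕ} {vert : Fin m → Fin 4 → ℤ} {face : Fin N → Fin 4 → ℤ}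
  {o : Fin m}

/-- The coordinates of a point above a finite vertex are a positive multiple of its light vector
plus a positive multiple of the light vector of `∞`, and all faces are nonnegative at both. -/
theorem above_mem_cell (D : CellData t n vert face o) (h : IsQuadGen ω t n) {i : Fin m}
    (hi : i ≠ o) {T : ℝ} (hT : 0 < T) :
    (⟨(cvec ω (vert i) 0 / cvec ω (vert i) 1, T), hT⟩ : H3) ∈ cell ω face := by
  intro j
  have h3 : (0 : ℝ) < lvec t n (vert i) 3 := by exact_mod_cast D.finite i hi
  rw [h.coord_above (D.finite i hi), pairing_add, pairing_smul, pairing_smul, pairing_toReal]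
  have h1 : (0 : ℝ) ≤ (pairing (face j) (lvec t n (vert i)) : ℤ) := by
    exact_mod_cast D.nonneg j i
  have h2 : (0 : ℝ) ≤ face j 0 := by exact_mod_cast D.coeff_nonneg j
  have h4 : pairing (toReal (face j)) ![1, 0, 0, 0] = face j 0 := by simp [pairing, toReal]
  rw [h4]
  positivity

theorem vcusp_apex (D : CellData t n vert face o) : vcusp ω (vert o) = OnePoint.infty := by
  rw [D.apex]
  simp [vcusp, cusp, cvec]

theorem vcusp_finite (D : CellData t n vert face o) (h : IsQuadGen ω t n) {i : Fin m}
    (hi : i ≠ o) :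
    vcusp ω (vert i) = ((cvec ω (vert i) 0 / cvec ω (vert i) 1 : ℂ) : OnePoint ℂ) := by
  rw [vcusp, cusp, if_neg]
  intro h0
  have h1 := h.lvec_apply_three (vert i)
  rw [h0] at h1
  have := D.finite i hi
  simp at h1
  omega

/-- An ideal point of the cell is one of the given vertices. -/
theorem eq_vertex_of_mem_closure (D : CellData t n vert face o) (h : IsQuadGen ω t n) {z : ℂ}
    (hz : ((z, 0) : ℂ × ℝ) ∈ closure (Subtype.val '' cell ω face)) :
    ∃ i, i ≠ o ∧ z = cvec ω (vert i) 0 / cvec ω (vert i) 1 := by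
  -- `C` extends `coord` to height zero, where the face inequalities persist by continuity and the
  -- cone theorem still applies.
  let C : ℂ × ℝ → Fin 4 → ℝ := fun p =>
    ![‖p.1‖ ^ 2 + p.2 ^ 2, p.1.re - p.1.im / ω.im * ω.re, p.1.im / ω.im, 1]
  have hC : ∀ g, Continuous fun p => pairing g (C p) := fun g => by
    simp only [pairing, C, cons_val]
    fun_prop
  have hx : ∀ j, 0 ≤ pairing (toReal (face j)) (C (z, 0)) := by
    have hcl : IsClosed {p : ℂ × ℝ | ∀ j, 0 ≤ pairing (toReal (face j)) (C p)} := by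
      have : {p : ℂ × ℝ | ∀ j, 0 ≤ pairing (toReal (face j)) (C p)}
          = ⋂ j, {p | 0 ≤ pairing (toReal (face j)) (C p)} := by ext p; simp
      rw [this]
      exact isClosed_iInter fun j => isClosed_le continuous_const (hC _)
    have hsub : (Subtype.val '' cell ω face : Set (ℂ × ℝ)) ⊆
        {p : ℂ × ℝ | ∀ j, 0 ≤ pairing (toReal (face j)) (C p)} := by
      rintro _ ⟨p, hp, rfl⟩
      exact hp
    exact closure_minimal hsub hcl hz
  obtain ⟨c, hc, he⟩ := D.exists_cone hx
  have hX : herm ω (C (z, 0)) = lightMat ![z, 1] := by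
    have hi := h.im_pos.ne'
    have hz1 : ((C (z, 0) 1 : ℝ) + (C (z, 0) 2 : ℝ) * ω : ℂ) = z := by
      apply Complex.ext
      · simp [C]
      · simp [C]; field_simp
    rw [herm, hz1]
    ext i j
    fin_cases i <;> fin_cases j <;> simp [lightMat, vecMulVec_apply, C]
    exact normSq_cast z
  -- The form of `H` at `v v*` is `|v₀ - z v₁|²`, which is zero at `(z, 1)`. So every vertex with
  -- nonzero coefficient satisfies `v₀ = z v₁`.
  let H : Matrix (Fin 2) (Fin 2) ℂ := !![1, -z; -conj z, z * conj z]
  have hH : ∀ v, traceForm H (lightMat v) = ‖v 0 - z * v 1‖ ^ 2 := fun v => by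
    rw [traceForm, trace_mul_lightMat]
    have : ((‖v 0 - z * v 1‖ ^ 2 : ℝ) : ℂ)
        = H 0 0 * (v 0 * conj (v 0)) + H 0 1 * (v 1 * conj (v 0))
      + H 1 0 * (v 0 * conj (v 1)) + H 1 1 * (v 1 * conj (v 1)) := by
      push_cast
      rw [normSq_cast]
      simp [H]
      ring
    rw [← this, Complex.ofReal_re]
  have hsum : lightMat ![z, 1] = ∑ i, c i • lightMat (cvec ω (vert i)) := by
    rw [← hX, he, herm_sum]
    simp only [herm_smul, ← h.lightMat_cvec]
  have h0 : ∑ i, c i * ‖cvec ω (vert i) 0 - z * cvec ω (vert i) 1‖ ^ 2 = 0 := by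
    have h1 := hH ![z, 1]
    rw [hsum, traceForm, Matrix.mul_sum, Matrix.trace_sum, Complex.re_sum] at h1
    simp only [Matrix.mul_smul, Matrix.trace_smul, Complex.real_smul, Complex.re_ofReal_mul] at h1
    have h2 : ∀ i, (H * lightMat (cvec ω (vert i))).trace.re
        = ‖cvec ω (vert i) 0 - z * cvec ω (vert i) 1‖ ^ 2 := fun i => hH _
    simp only [h2] at h1
    rw [h1]
    simp
  -- The last coordinate vanishes at the apex, so this sum yields a finite vertex with nonzero
  -- coefficient.
  have h3 : ∑ i, c i * lvec t n (vert i) 3 = 1 := by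
    have := congrFun he 3
    rw [Finset.sum_apply] at this
    simp [C, toReal] at this
    exact this.symm
  obtain ⟨i, -, hi⟩ := Finset.exists_ne_zero_of_sum_ne_zero (by rw [h3]; exact one_ne_zero)
  have hci : c i ≠ 0 := left_ne_zero_of_mul hi
  have hio : i ≠ o := by
    rintro rfl
    apply right_ne_zero_of_mul hi
    rw [D.apex]
    simp [lvec]
  refine ⟨i, hio, ?_⟩
  have hq : cvec ω (vert i) 1 ≠ 0 := by
    intro h0
    have h1 := h.lvec_apply_three (vert i)
    rw [h0] at h1
    have := D.finite i hio
    simp at h1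
    omega
  have h4 := (Finset.sum_eq_zero_iff_of_nonneg fun i _ =>
    mul_nonneg (hc i) (sq_nonneg _)).1 h0 i (Finset.mem_univ i)
  have h5 := (mul_eq_zero.1 h4).resolve_left hci
  have h6 : cvec ω (vert i) 0 - z * cvec ω (vert i) 1 = 0 := by simpa using h5
  rw [eq_div_iff hq]
  linear_combination -h6

theorem idealPoints_cell (D : CellData t n vert face o) (h : IsQuadGen ω t n) :
    idealPoints (cell ω face) = Set.range fun i => vcusp ω (vert i) := by
  ext x
  constructor
  · rintro (⟨z, rfl, hz⟩ | ⟨rfl, -⟩)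
    · obtain ⟨i, hi, rfl⟩ := D.eq_vertex_of_mem_closure h hz
      exact ⟨i, D.vcusp_finite h hi⟩
    · exact ⟨o, D.vcusp_apex⟩
  · rintro ⟨i, rfl⟩
    by_cases hi : i = o
    · right
      refine ⟨by rw [hi]; exact D.vcusp_apex, fun hb => ?_⟩
      obtain ⟨k, hk⟩ := D.other
      obtain ⟨R, hR⟩ := hb.exists_norm_le
      have hpos : (0 : ℝ) < |R| + 1 := by positivity
      have h1 := hR _ ⟨_, D.above_mem_cell h hk hpos, rfl⟩
      have h2 := (norm_snd_le _).trans h1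
      simp only [Real.norm_eq_abs, abs_of_pos hpos] at h2
      have := le_abs_self R
      linarith
    · left
      refine ⟨_, D.vcusp_finite h hi, ?_⟩
      set z := cvec ω (vert i) 0 / cvec ω (vert i) 1 with hz
      have hcont : Continuous fun T : ℝ => (z, T) := by fun_prop
      have hlim : Filter.Tendsto (fun T : ℝ => (z, T)) (𝓝[>] 0) (𝓝 (z, 0)) :=
        (hcont.tendsto 0).mono_left nhdsWithin_le_nhds
      refine mem_closure_of_tendsto hlim ?_
      filter_upwards [self_mem_nhdsWithin] with T hT
      exact ⟨_, D.above_mem_cell h hi hT, rfl⟩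

theorem isHedron (D : CellData t n vert face o) (h : IsQuadGen ω t n) :
    IsHedron N (cell ω face) (Set.range (faceSet ω face))
      (Set.range fun i => vcusp ω (vert i)) where
  polyhedron := D.isPolyhedronWithFaces h
  card_faces := by
    rw [← Set.image_univ, Set.ncard_image_of_injective _ (D.faceSet_injective h), Set.ncard_univ]
    simp
  boundary := D.frontier_cell h
  cusps := D.idealPoints_cell h

end CellData

/-! ### The standard cell -/

theorem disc_neg (t n : ℤ) (g : Fin 4 → ℤ) : disc t n (-g) = disc t n g := by
  simp [disc]

theorem toReal_neg (g : Fin 4 → ℤ) : toReal (-g) = -toReal g := by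
  ext i; simp [toReal]

theorem pairing_neg_left (g x : Fin 4 → ℝ) : pairing (-g) x = -pairing g x := by
  simp [pairing]; ring

namespace IsQuadGen

variable {ω : ℂ} {t n : ℤ}

/-- Completing the square gives centre `-β / g 0` and squared radius `D / g 0 ^ 2`, where `β` is the
off-diagonal entry and `(4n - t²) D` is the discriminant. -/
theorem isHemisphere (h : IsQuadGen ω t n) {g : Fin 4 → ℤ} (hg : 0 < disc t n g) (h0 : 0 < g 0) :
    IsHemisphere {p | pairing (toReal g) (coord ω p) = 0} := by
  have hα : (0 : ℝ) < g 0 := by exact_mod_cast h0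
  have h1 := h.norm_offDiag g
  have h2 : (0 : ℝ) < ((4 * n - t ^ 2 : ℤ) : ℝ) := by exact_mod_cast h.disc_pos
  have h3 : (0 : ℝ) < (disc t n g : ℤ) := by exact_mod_cast hg
  rw [← h1] at h3
  have hD := (pos_iff_pos_of_mul_pos h3).1 h2
  set D := ‖offDiag ω g‖ ^ 2 - g 0 * g 3 with hDdef
  refine ⟨-(offDiag ω g / g 0), √D / g 0, div_pos (Real.sqrt_pos.2 hD) hα, ?_⟩
  ext p
  rw [Set.mem_ofPred_eq, Set.mem_ofPred_eq, ← h.planeForm_eq, div_pow, Real.sq_sqrt hD.le,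
    eq_div_iff (by positivity)]
  have e : ‖p.1.1 - -(offDiag ω g / g 0)‖ ^ 2 * (g 0 : ℝ) ^ 2
      = g 0 * (g 0 * ‖p.1.1‖ ^ 2 + 2 * (conj (offDiag ω g) * p.1.1).re) + ‖offDiag ω g‖ ^ 2 := by
    have hα' : (g 0 : ℂ) ≠ 0 := by exact_mod_cast h0.ne'
    have hre : ((2 * (conj (offDiag ω g) * p.1.1).re : ℝ) : ℂ)
        = conj (offDiag ω g) * p.1.1 + offDiag ω g * conj p.1.1 := by
      push_cast
      rw [Complex.re_eq_add_conj, map_mul, Complex.conj_conj]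
      ring
    have : ((‖p.1.1 - -(offDiag ω g / g 0)‖ ^ 2 * (g 0 : ℝ) ^ 2 : ℝ) : ℂ)
        = ((g 0 * (g 0 * ‖p.1.1‖ ^ 2 + 2 * (conj (offDiag ω g) * p.1.1).re)
          + ‖offDiag ω g‖ ^ 2 : ℝ) : ℂ) := by
      rw [Complex.ofReal_add, Complex.ofReal_mul, Complex.ofReal_mul, Complex.ofReal_add, hre]
      push_cast
      rw [normSq_cast, normSq_cast, normSq_cast]
      simp only [map_sub, map_neg, map_div₀, map_intCast]
      field_simp
      ring
    exact_mod_cast this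
  rw [add_mul, e, planeForm]
  constructor
  · intro h5
    linear_combination (g 0 : ℝ) * h5
  · intro h5
    have : (g 0 : ℝ) * (g 0 * (‖p.1.1‖ ^ 2 + p.1.2 ^ 2) + 2 * (conj (offDiag ω g) * p.1.1).re
        + g 3) = 0 := by
      linear_combination h5
    exact (mul_eq_zero.1 this).resolve_left hα.ne'

/-- If `g 0 = 0`, the zero set contains the whole vertical line through each of its points, but only
the top of a hemisphere lies over its centre. -/
theorem coeff_ne_zero_of_isHemisphere {g : Fin 4 → ℤ}
    (hY : IsHemisphere {p | pairing (toReal g) (coord ω p) = 0}) : g 0 ≠ 0 := by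
  intro h0
  obtain ⟨c, r, hr, hY⟩ := hY
  have h1 : (⟨(c, r), hr⟩ : H3) ∈ {p : H3 | pairing (toReal g) (coord ω p) = 0} := by
    rw [hY]; simp
  have h2 : (⟨(c, r / 2), half_pos hr⟩ : H3) ∈
      {p : H3 | pairing (toReal g) (coord ω p) = 0} := by
    rw [Set.mem_ofPred_eq, pairing_vertical (ω := ω) g ⟨(c, r), hr⟩ ⟨(c, r / 2), half_pos hr⟩ rfl, h0]
    have h1' : pairing (toReal g) (coord ω ⟨(c, r), hr⟩) = 0 := h1
    rw [h1']
    simp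
  rw [hY] at h2
  simp at h2
  nlinarith

end IsQuadGen

/-- The vertical faces of the cell are the walls, its other faces lie in hemispheres. -/
structure WallData (d : ℕ) (t n : ℤ) {N : ℕ} (face : Fin N → Fin 4 → ℤ) : Prop where
  wall : ∀ X, IsWall d X ↔
    ∃ j, face j 0 = 0 ∧ X = {p | pairing (toReal (face j)) (coord (omega d) p) = 0}
  mem_W : ∀ p : H3, p.1.1 ∈ W d ↔
    ∀ j, face j 0 = 0 → 0 ≤ pairing (toReal (face j)) (coord (omega d) p)
  wall_disc : ∀ j, face j 0 = 0 → disc t n (face j) = 1 ∨ disc t n (face j) = n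
  floor : ∀ j, face j 0 ≠ 0 → ∃ c₀ c₁ : Fin 4 → ℤ, (detRe n c₀ c₁ = 1 ∧ detIm t c₀ c₁ = 0) ∧
    ∃ k, face k 0 = 0 ∧ (pull t n c₀ c₁ (face j) = face k ∨ pull t n c₀ c₁ (face j) = -face k)

/-! ### The standard cell equals the polyhedron given by the integral data. -/

namespace CellData

variable {t n : ℤ} {m N : ℕ} {vert : Fin m → Fin 4 → ℤ} {face : Fin N → Fin 4 → ℤ}
  {o : Fin m} {d : ℕ}

theorem floor_subset_hemispheres (D : CellData t n vert face o)
    (h : IsQuadGen (omega d) t n) (hW : WallData d t n face) {j : Fin N} (hj : face j 0 ≠ 0) :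
    {p | pairing (toReal (face j)) (coord (omega d) p) = 0} ⊆ hemispheres d := by
  obtain ⟨c₀, c₁, ⟨hre, him⟩, k, hk, hpull⟩ := hW.floor j hj
  obtain ⟨A, hA, hAc⟩ := h.exists_mem_bianchi hre him
  refine Set.subset_sUnion_of_mem ⟨h.isHemisphere (D.disc_pos j)
    ((D.coeff_nonneg j).lt_of_ne hj.symm), A, hA, _, (hW.wall _).2 ⟨k, hk, rfl⟩, ?_⟩
  ext p
  rw [mem_moebius_image]
  obtain ⟨q, rfl⟩ : ∃ q, p = moebius A q := ⟨_, (moebius_apply_inv A p).symm⟩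
  rw [moebius_inv_apply, Set.mem_ofPred_eq, Set.mem_ofPred_eq,
    ← mul_eq_zero_iff_left (denom_pos A q).ne', h.pairing_moebius hAc]
  rcases hpull with e | e <;> rw [e]
  rw [toReal_neg, pairing_neg_left, neg_eq_zero]

/-- The integral forms of the hemispheres are nonnegative at the vertices of the cell. -/
theorem exists_form_of_mem_hemispheres (h : IsQuadGen (omega d) t n) (hW : WallData d t n face)
    (hclaim : ∀ g : Fin 4 → ℤ, 0 < g 0 → disc t n g = 1 ∨ disc t n g = n →
      ∀ i, 0 ≤ pairing g (lvec t n (vert i)))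
    {q : H3} (hq : q ∈ hemispheres d) :
    ∃ g : Fin 4 → ℤ, 0 < g 0 ∧ pairing (toReal g) (coord (omega d) q) = 0 ∧
      ∀ i, 0 ≤ pairing g (lvec t n (vert i)) := by
  obtain ⟨Y, ⟨hY, A, hA, X, hX, rfl⟩, hqY⟩ := hq
  obtain ⟨k, hk, rfl⟩ := (hW.wall X).1 hX
  obtain ⟨c₀, c₁, hc, hdet⟩ := h.exists_of_mem_bianchi (inv_mem hA)
  have hYe := Set.ext (h.mem_moebius_image_plane hc (face k))
  have hdisc := h.disc_pull c₀ c₁ (face k) (by rw [hdet]; simp)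
  rw [Set.ext (h.mem_moebius_image_plane hc (face k))] at hqY hY
  have hne := IsQuadGen.coeff_ne_zero_of_isHemisphere hY
  set g := pull t n c₀ c₁ (face k) with hg
  have hqY' : pairing (toReal g) (coord (omega d) q) = 0 := hqY
  have hKg : disc t n g = 1 ∨ disc t n g = n := by
    rw [hdisc]; exact hW.wall_disc k hk
  -- A sign change alters neither the plane nor the discriminant, so the leading coefficient may be
  -- taken positive.
  rcases lt_or_gt_of_ne hne with hneg | hpos
  · refine ⟨-g, by simpa using hneg, ?_, hclaim _ (by simpa using hneg) (by rwa [disc_neg])⟩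
    rw [toReal_neg, pairing_neg_left, hqY', neg_zero]
  · exact ⟨g, hpos, hqY', hclaim _ hpos hKg⟩

theorem standardCell_eq (D : CellData t n vert face o)
    (h : IsQuadGen (omega d) t n) (hW : WallData d t n face)
    (hclaim : ∀ g : Fin 4 → ℤ, 0 < g 0 → disc t n g = 1 ∨ disc t n g = n →
      ∀ i, 0 ≤ pairing g (lvec t n (vert i))) :
    standardCell d = cell (omega d) face := by
  apply Set.Subset.antisymm
  · refine closure_minimal ?_ (isClosed_cell _ _)
    rintro p ⟨hpW, hp⟩ j
    by_cases hj : face j 0 = 0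
    · exact (hW.mem_W p).1 hpW j hj
    · by_contra! hneg
      have hα : (0 : ℝ) < face j 0 := by
        exact_mod_cast (D.coeff_nonneg j).lt_of_ne (Ne.symm hj)
      -- `S` is the squared height at which the vertical line through `p` meets the plane of face
      -- `j`. This plane is one of the hemispheres, so `p` would lie below a point of a hemisphere.
      set S := p.1.2 ^ 2 - pairing (toReal (face j)) (coord (omega d) p) / face j 0 with hS
      have hSp : p.1.2 ^ 2 < S := by
        have := div_neg_of_neg_of_pos hneg hα
        linarith
      have hS0 : 0 < S := (pow_pos p.2 2).trans hSp
      let q : H3 := ⟨(p.1.1, √S), Real.sqrt_pos.2 hS0⟩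
      have hq : q ∈ hemispheres d := by
        apply D.floor_subset_hemispheres h hW hj
        rw [Set.mem_ofPred_eq, pairing_vertical (face j) p q rfl]
        have hq2 : q.1.2 ^ 2 = S := Real.sq_sqrt hS0.le
        rw [hq2, hS]
        field_simp
        ring
      have h1 : √S < p.1.2 := hp q hq rfl
      have h2 := Real.lt_sqrt_of_sq_lt hSp
      exact absurd h1 h2.not_gt
  · intro p hp
    obtain ⟨c, hc, hx⟩ := D.exists_cone hp
    -- Points of the cell are only on or above the hemispheres; raising them slightly makes the
    -- inequality strict, and the closure recovers them.
    let φ : ℝ → H3 := fun e => ⟨(p.1.1, p.1.2 * Real.exp e), mul_pos p.2 (Real.exp_pos _)⟩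
    have hφ : Continuous φ := by
      apply Continuous.subtype_mk; fun_prop
    have hφ0 : φ 0 = p := by
      apply Subtype.ext; simp [φ]
    have hlim : Filter.Tendsto φ (𝓝[>] 0) (𝓝 p) := by
      have := (hφ.tendsto 0).mono_left (nhdsWithin_le_nhds (s := Set.Ioi 0))
      rwa [hφ0] at this
    refine mem_closure_of_tendsto hlim ?_
    filter_upwards [self_mem_nhdsWithin] with e he
    have he' : (0 : ℝ) < e := he
    refine ⟨(hW.mem_W p).2 fun j _ => hp j, fun q hq hqz => ?_⟩
    obtain ⟨g, hg0, hgq, hgv⟩ := exists_form_of_mem_hemispheres h hW hclaim hq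
    have hα : (0 : ℝ) < g 0 := by exact_mod_cast hg0
    -- The form is nonnegative at the generators of the cone, hence at `p`.
    have hgp : 0 ≤ pairing (toReal g) (coord (omega d) p) := by
      rw [hx, pairing_sum]
      refine Finset.sum_nonneg fun i _ => ?_
      rw [pairing_smul, pairing_toReal]
      exact mul_nonneg (hc i) (by exact_mod_cast hgv i)
    rw [pairing_vertical g p q hqz] at hgq
    have h1 : (g 0 : ℝ) * (q.1.2 ^ 2 - p.1.2 ^ 2) ≤ 0 := by linarith
    have h2 : q.1.2 ^ 2 ≤ p.1.2 ^ 2 := by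
      by_contra! hlt
      have := mul_pos hα (sub_pos.2 hlt)
      linarith
    have h3 : q.1.2 ≤ p.1.2 := (pow_le_pow_iff_left₀ q.2.le p.2.le two_ne_zero).1 h2
    have h4 : p.1.2 < p.1.2 * Real.exp e := lt_mul_of_one_lt_right p.2 (Real.one_lt_exp_iff.2 he')
    exact h3.trans_lt h4

end CellData

/-! ### Farey polygons as convex hulls -/

/-- Over the line `ℝ w` everything depends on the real parameter `y` and the height `s` alone: the
condition is `‖w‖² (y - a)(y - b) + s² ≥ 0`. -/
theorem mem_outside_iff (w : ℂ) (a b y : ℝ) {p : H3} (hz : p.1.1 = y * w) :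
    p ∈ outside (a * w) (b * w) ↔
      0 ≤ ‖w‖ ^ 2 * y ^ 2 + p.1.2 ^ 2 - ‖w‖ ^ 2 * (y * (a + b)) + ‖w‖ ^ 2 * (a * b) := by
  have e1 : (b * w - a * w : ℂ) = ((b - a : ℝ) : ℂ) * w := by push_cast; ring
  have e2 : (y * w - (a * w + b * w) / 2 : ℂ) = ((y - (a + b) / 2 : ℝ) : ℂ) * w := by
    push_cast; ring
  rw [outside, Set.mem_ofPred_eq, hz, e1, e2, norm_mul, norm_mul, Complex.norm_real,
    Complex.norm_real, mul_pow, div_pow, mul_pow, Real.norm_eq_abs, Real.norm_eq_abs, sq_abs,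
    sq_abs, ← sub_nonneg]
  ring_nf

theorem mem_overSegment_zero_iff (w : ℂ) {p : H3} :
    p ∈ overSegment 0 w ↔ ∃ y : ℝ, (0 ≤ y ∧ y ≤ 1) ∧ p.1.1 = y * w := by
  rw [overSegment, Set.mem_ofPred_eq, segment_eq_image]
  simp only [Set.mem_image, Set.mem_Icc, smul_zero, zero_add, Complex.real_smul, eq_comm]

theorem posMat_eq_iff {p : H3} {w : ℂ} {y : ℝ} (hz : p.1.1 = y * w) {X : Matrix (Fin 2) (Fin 2) ℂ}
    (hX : X.IsHermitian) :
    posMat p = X ↔ ((‖w‖ ^ 2 * y ^ 2 + p.1.2 ^ 2 : ℝ) : ℂ) = X 0 0 ∧ y * w = X 0 1 ∧ 1 = X 1 1 := by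
  have hn : ‖(y * w : ℂ)‖ ^ 2 = ‖w‖ ^ 2 * y ^ 2 := by
    rw [norm_mul, Complex.norm_real, Real.norm_eq_abs, mul_pow, sq_abs, mul_comm]
  constructor
  · rintro rfl
    simp only [posMat, hz, hn, Matrix.of_apply, cons_val', cons_val_zero, cons_val_one,
      cons_val_fin_one, and_self]
  · rintro ⟨h0, h1, h2⟩
    have h3 : X 1 0 = conj (X 0 1) := (hX.apply 1 0).symm
    ext i j
    fin_cases i <;> fin_cases j
    · rw [← hn, ← hz] at h0
      exact h0
    · simpa [posMat, hz] using h1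
    · simp [posMat, hz, h3, ← h1]
    · simpa [posMat] using h2

theorem lightMat_apply (v : Fin 2 → ℂ) (i j : Fin 2) : lightMat v i j = v i * conj (v j) := rfl

theorem isHermitian_sum_lightMat {ι : Type*} [Fintype ι] (c : ι → ℝ) (v : ι → Fin 2 → ℂ) :
    (∑ i, c i • lightMat (v i)).IsHermitian := by
  rw [Matrix.IsHermitian, conjTranspose_sum]
  refine Finset.sum_congr rfl fun i _ => ?_
  rw [conjTranspose_smul, lightMat, conjTranspose_vecMulVec, star_star]
  simp

/-- Comparing matrix entries forces the coefficients: `1 - y` at `0`, `y` at `1`, and the remaining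
height at `∞`. Their signs are exactly the inequalities that define the triangle. -/
theorem triangle_eq_hull :
    triangle = hull fun i => lightMat ((![![0, 1], ![1, 0], ![1, 1]] : Fin 3 → Fin 2 → ℂ) i) := by
  ext p
  have hout : ∀ y : ℝ, p.1.1 = y * 1 → (p ∈ outside 0 1 ↔ 0 ≤ y ^ 2 + p.1.2 ^ 2 - y) := by
    intro y hy
    have := mem_outside_iff 1 0 1 y hy
    simpa using this
  constructor
  · rintro ⟨hs, ho⟩
    obtain ⟨y, ⟨h0, h1⟩, hz⟩ := (mem_overSegment_zero_iff 1).1 hs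
    have hT := (hout y hz).1 ho
    refine ⟨![1 - y, y ^ 2 + p.1.2 ^ 2 - y, y], fun i => ?_,
      (posMat_eq_iff hz (isHermitian_sum_lightMat _ _)).2 ?_⟩
    · fin_cases i <;> simp <;> linarith
    · simp [Fin.sum_univ_succ, lightMat_apply]
  · rintro ⟨c, hc, he⟩
    have c0 := hc 0
    have c1 := hc 1
    have c2 := hc 2
    have h01 : p.1.1 = c 2 * 1 := by
      have := congrFun (congrFun he 0) 1
      simpa [Fin.sum_univ_succ, lightMat_apply, posMat] using this
    obtain ⟨e0, e1, e2⟩ := (posMat_eq_iff h01 (isHermitian_sum_lightMat _ _)).1 he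
    simp [Fin.sum_univ_succ, lightMat_apply] at e0 e1 e2
    norm_cast at e0 e2
    refine ⟨(mem_overSegment_zero_iff 1).2 ⟨c 2, ⟨c2, by linarith⟩, h01⟩, (hout _ h01).2 ?_⟩
    linarith

/-! ### Quadrangles and hexagons as hulls. -/

namespace IsQuadGen

variable {t n : ℤ} {d : ℕ}

theorem norm_omega_sq (h : IsQuadGen (omega d) t n) : ‖omega d‖ ^ 2 = n := by
  have := h.norm_sq_int 0 1
  simpa using this

theorem div_conj_eq (h : IsQuadGen (omega d) t n) (hn : n ≠ 0) (a : ℝ) :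
    a / conj (omega d) = ((a / n : ℝ) : ℂ) * omega d := by
  have hω : omega d ≠ 0 := fun h0 => by
    have := h.im_pos
    rw [h0] at this
    simp at this
  have hω' : conj (omega d) ≠ 0 := by simpa using hω
  have hn' : (n : ℂ) ≠ 0 := by exact_mod_cast hn
  rw [div_eq_iff hω']
  push_cast
  rw [mul_assoc, h.mul_conj]
  field_simp

/-- For `n = 2` the cusp `1/ω̄` is `ω/2`. The quadrangle is cut at `y = 1/2` into two ideal
triangles with a vertex at `∞`, in each of which three coefficients are determined as for the
triangle; the others are zero. -/
theorem quadrangle_eq_hull (h : IsQuadGen (omega d) t 2) :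
    quadrangle d = hull fun i => lightMat ((![![0, 1], ![1, 0], ![omega d, 1],
      ![1, conj (omega d)]] : Fin 4 → Fin 2 → ℂ) i) := by
  ext p
  have hω := h.mul_conj
  have hω' := (mul_comm _ _).trans h.mul_conj
  have hnorm := h.norm_omega_sq
  have e1 : (1 / conj (omega d) : ℂ) = ((1 / 2 : ℝ) : ℂ) * omega d := by
    have := h.div_conj_eq two_ne_zero 1
    simpa using this
  have hout : ∀ y : ℝ, p.1.1 = y * omega d → (p ∈ quadrangle d ↔ (0 ≤ y ∧ y ≤ 1) ∧
      0 ≤ 2 * y ^ 2 + p.1.2 ^ 2 - y ∧ 0 ≤ 2 * y ^ 2 + p.1.2 ^ 2 - 3 * y + 1) := by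
    intro y hy
    have h1 := mem_outside_iff (omega d) 0 (1 / 2) y hy
    have h2 := mem_outside_iff (omega d) (1 / 2) 1 y hy
    rw [hnorm] at h1 h2
    have h3 : p ∈ overSegment 0 (omega d) ↔ 0 ≤ y ∧ y ≤ 1 := by
      rw [mem_overSegment_zero_iff]
      constructor
      · rintro ⟨y', hy', e⟩
        rw [hy] at e
        have := (h.coord_unique (x := 0) (x' := 0) (y := y) (y' := y') (by simpa using e)).2
        rwa [this]
      · exact fun hy' => ⟨y, hy', hy⟩
    simp only [Complex.ofReal_zero, zero_mul, Complex.ofReal_one, one_mul] at h1 h2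
    rw [quadrangle, e1, Set.mem_inter_iff, Set.mem_inter_iff, h1, h2, h3, and_assoc]
    norm_num
    intro _ _
    constructor <;> rintro ⟨h4, h5⟩ <;> constructor <;> linarith
  constructor
  · intro hp
    obtain ⟨y, -, hz⟩ := (mem_overSegment_zero_iff (omega d)).1 hp.1.1
    obtain ⟨⟨h0, h1⟩, h2, h3⟩ := (hout y hz).1 hp
    rcases le_total y (1 / 2) with hy | hy
    · refine ⟨![1 - 2 * y, 2 * y ^ 2 + p.1.2 ^ 2 - y, 0, y], fun i => ?_,
        (posMat_eq_iff hz (isHermitian_sum_lightMat _ _)).2 ?_⟩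
      · fin_cases i <;> simp <;> linarith
      · simp [Fin.sum_univ_succ, lightMat_apply, hω', hnorm]
        ring
    · refine ⟨![0, 2 * y ^ 2 + p.1.2 ^ 2 - 3 * y + 1, 2 * y - 1, 1 - y], fun i => ?_,
        (posMat_eq_iff hz (isHermitian_sum_lightMat _ _)).2 ?_⟩
      · fin_cases i <;> simp <;> linarith
      · simp [Fin.sum_univ_succ, lightMat_apply, hω, hω', hnorm]
        refine ⟨?_, ?_, ?_⟩ <;> ring
  · rintro ⟨c, hc, he⟩
    have c0 := hc 0
    have c1 := hc 1
    have c2 := hc 2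
    have c3 := hc 3
    have h01 : p.1.1 = (c 2 + c 3 : ℝ) * omega d := by
      have := congrFun (congrFun he 0) 1
      simp [Fin.sum_univ_succ, lightMat_apply, posMat] at this
      rw [this]
      push_cast
      ring
    obtain ⟨e0, -, e2⟩ := (posMat_eq_iff h01 (isHermitian_sum_lightMat _ _)).1 he
    simp [Fin.sum_univ_succ, lightMat_apply, hω, hω', hnorm] at e0 e2
    have f0 : 2 * (c 2 + c 3) ^ 2 + p.1.2 ^ 2 = c 1 + (c 2 * 2 + c 3) := by
      apply Complex.ofReal_injective
      push_cast
      exact e0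
    have f2 : 1 = c 0 + (c 2 + c 3 * 2) := by
      apply Complex.ofReal_injective
      push_cast
      exact e2
    rw [hout _ h01]
    refine ⟨⟨?_, ?_⟩, ?_, ?_⟩ <;> linarith

theorem hexagon_eq_hull (h : IsQuadGen (omega d) t 3) :
    hexagon d = hull fun i => lightMat ((![![0, 1], ![1, 0], ![omega d, 1],
      ![2, conj (omega d)], ![omega d, 2], ![1, conj (omega d)]] : Fin 6 → Fin 2 → ℂ) i) := by
  ext p
  have hω := h.mul_conj
  have hω' := (mul_comm _ _).trans h.mul_conj
  have conj_two : conj (2 : ℂ) = 2 := map_ofNat _ 2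
  have hnorm := h.norm_omega_sq
  have e1 : (1 / conj (omega d) : ℂ) = ((1 / 3 : ℝ) : ℂ) * omega d := by
    have := h.div_conj_eq three_ne_zero 1
    simpa using this
  have e2 : (2 / conj (omega d) : ℂ) = ((2 / 3 : ℝ) : ℂ) * omega d := by
    have := h.div_conj_eq three_ne_zero 2
    simpa using this
  have e3 : omega d / 2 = ((1 / 2 : ℝ) : ℂ) * omega d := by push_cast; ring
  have hout : ∀ y : ℝ, p.1.1 = y * omega d → (p ∈ hexagon d ↔ (0 ≤ y ∧ y ≤ 1) ∧
      0 ≤ 3 * y ^ 2 + p.1.2 ^ 2 - y ∧ 0 ≤ 3 * y ^ 2 + p.1.2 ^ 2 - 5 / 2 * y + 1 / 2 ∧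
      0 ≤ 3 * y ^ 2 + p.1.2 ^ 2 - 7 / 2 * y + 1 ∧ 0 ≤ 3 * y ^ 2 + p.1.2 ^ 2 - 5 * y + 2) := by
    intro y hy
    have h1 := mem_outside_iff (omega d) 0 (1 / 3) y hy
    have h2 := mem_outside_iff (omega d) (1 / 3) (1 / 2) y hy
    have h3 := mem_outside_iff (omega d) (1 / 2) (2 / 3) y hy
    have h4 := mem_outside_iff (omega d) (2 / 3) 1 y hy
    rw [hnorm] at h1 h2 h3 h4
    have h5 : p ∈ overSegment 0 (omega d) ↔ 0 ≤ y ∧ y ≤ 1 := by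
      rw [mem_overSegment_zero_iff]
      constructor
      · rintro ⟨y', hy', e⟩
        rw [hy] at e
        have := (h.coord_unique (x := 0) (x' := 0) (y := y) (y' := y') (by simpa using e)).2
        rwa [this]
      · exact fun hy' => ⟨y, hy', hy⟩
    simp only [Complex.ofReal_zero, zero_mul, Complex.ofReal_one, one_mul] at h1 h4
    rw [hexagon, e1, e2, e3, Set.mem_inter_iff, Set.mem_inter_iff, Set.mem_inter_iff,
      Set.mem_inter_iff, h1, h2, h3, h4, h5]
    push_cast
    constructor
    · rintro ⟨⟨⟨⟨h6, h7⟩, h8⟩, h9⟩, h10⟩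
      refine ⟨h6, ?_, ?_, ?_, ?_⟩ <;> linarith
    · rintro ⟨h6, h7, h8, h9, h10⟩
      refine ⟨⟨⟨⟨h6, ?_⟩, ?_⟩, ?_⟩, ?_⟩ <;> linarith
  constructor
  · intro hp
    obtain ⟨y, -, hz⟩ := (mem_overSegment_zero_iff (omega d)).1 hp.1.1.1.1
    obtain ⟨⟨h0, h1⟩, h2, h3, h4, h5⟩ := (hout y hz).1 hp
    have fin : ∀ c : Fin 6 → ℝ, (0 ≤ c 0 ∧ 0 ≤ c 1 ∧ 0 ≤ c 2 ∧ 0 ≤ c 3 ∧ 0 ≤ c 4 ∧ 0 ≤ c 5) →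
        3 * y ^ 2 + p.1.2 ^ 2 = c 1 + 3 * c 2 + 4 * c 3 + 3 * c 4 + c 5 →
        y = c 2 + 2 * c 3 + 2 * c 4 + c 5 → 1 = c 0 + c 2 + 3 * c 3 + 4 * c 4 + 3 * c 5 →
        p ∈ hull fun i => lightMat ((![![0, 1], ![1, 0], ![omega d, 1],
          ![2, conj (omega d)], ![omega d, 2], ![1, conj (omega d)]] : Fin 6 → Fin 2 → ℂ) i) := by
      rintro c ⟨c0, c1, c2, c3, c4, c5⟩ f0 f1 f2
      refine ⟨c, fun i => by fin_cases i <;> assumption,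
        (posMat_eq_iff hz (isHermitian_sum_lightMat _ _)).2 ?_⟩
      have f0' : ((3 * y ^ 2 + p.1.2 ^ 2 : ℝ) : ℂ) = _ := congrArg Complex.ofReal f0
      have f1' := congrArg Complex.ofReal f1
      have f2' := congrArg Complex.ofReal f2
      push_cast at f0' f1' f2'
      simp [Fin.sum_univ_succ, lightMat_apply, hω, hω', hnorm, conj_two]
      refine ⟨?_, ?_, ?_⟩
      · rw [f0']; ring
      · rw [f1']; ring
      · rw [f2']; ring
    -- For `n = 3` the finite cusps lie at `y = 0, 1/3, 1/2, 2/3, 1`, so the hexagon is cut into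
    -- four ideal triangles with a vertex at `∞`.
    rcases le_total y (1 / 2) with hy | hy
    · rcases le_total y (1 / 3) with hy' | hy'
      · refine fin ![1 - 3 * y, 3 * y ^ 2 + p.1.2 ^ 2 - y, 0, 0, 0, y] ?_ ?_ ?_ ?_ <;> simp
        refine ⟨?_, ?_, ?_⟩ <;> linarith
      · refine fin ![0, 3 * y ^ 2 + p.1.2 ^ 2 - 5 / 2 * y + 1 / 2, 0, 0, (3 * y - 1) / 2,
          1 - 2 * y] ?_ ?_ ?_ ?_ <;> simp
        · refine ⟨?_, ?_, ?_⟩ <;> linarith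
        all_goals ring
    · rcases le_total y (2 / 3) with hy' | hy'
      · refine fin ![0, 3 * y ^ 2 + p.1.2 ^ 2 - 7 / 2 * y + 1, 0, 2 * y - 1, 1 - 3 / 2 * y, 0]
          ?_ ?_ ?_ ?_ <;> simp
        · refine ⟨?_, ?_, ?_⟩ <;> linarith
        all_goals ring
      · refine fin ![0, 3 * y ^ 2 + p.1.2 ^ 2 - 5 * y + 2, 3 * y - 2, 1 - y, 0, 0]
          ?_ ?_ ?_ ?_ <;> simp
        · refine ⟨?_, ?_, ?_⟩ <;> linarith
        all_goals ring
  · rintro ⟨c, hc, he⟩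
    have c0 := hc 0
    have c1 := hc 1
    have c2 := hc 2
    have c3 := hc 3
    have c4 := hc 4
    have c5 := hc 5
    have h01 : p.1.1 = (c 2 + 2 * c 3 + 2 * c 4 + c 5 : ℝ) * omega d := by
      have := congrFun (congrFun he 0) 1
      simp [Fin.sum_univ_succ, lightMat_apply, posMat, conj_two] at this
      rw [this]
      push_cast
      ring
    obtain ⟨e0, -, e2⟩ := (posMat_eq_iff h01 (isHermitian_sum_lightMat _ _)).1 he
    simp [Fin.sum_univ_succ, lightMat_apply, hω, hω', hnorm, conj_two] at e0 e2
    have f0 : 3 * (c 2 + 2 * c 3 + 2 * c 4 + c 5) ^ 2 + p.1.2 ^ 2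
        = c 1 + 3 * c 2 + 4 * c 3 + 3 * c 4 + c 5 := by
      apply Complex.ofReal_injective
      push_cast
      linear_combination e0
    have f2 : 1 = c 0 + c 2 + 3 * c 3 + 4 * c 4 + 3 * c 5 := by
      apply Complex.ofReal_injective
      push_cast
      linear_combination e2
    rw [hout _ h01]
    refine ⟨⟨?_, ?_⟩, ?_, ?_, ?_, ?_⟩ <;> linarith

end IsQuadGen

/-! ### The faces of the cell as Farey polygons -/

theorem cusp_eq_of_lightMat_eq {u v : Fin 2 → ℂ} (h : lightMat u = lightMat v) :
    cusp (u 0) (u 1) = cusp (v 0) (v 1) := by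
  have h01 : u 0 * conj (u 1) = v 0 * conj (v 1) := congrFun (congrFun h 0) 1
  have h11 : u 1 * conj (u 1) = v 1 * conj (v 1) := congrFun (congrFun h 1) 1
  by_cases hu : u 1 = 0
  · have hv : v 1 = 0 := by
      rw [hu, zero_mul] at h11
      simpa using h11.symm
    rw [cusp, cusp, if_pos hu, if_pos hv]
  · have hv : v 1 ≠ 0 := by
      intro hv
      rw [hv, zero_mul] at h11
      exact hu (by simpa using h11)
    have hu' : conj (u 1) ≠ 0 := by simpa using hu
    have hv' : conj (v 1) ≠ 0 := by simpa using hv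
    rw [cusp, cusp, if_neg hu, if_neg hv, ← mul_div_mul_right (u 0) (u 1) hu',
      ← mul_div_mul_right (v 0) (v 1) hv', h01, h11]

theorem mul_eq_mul_of_cusp_eq {p q r s : ℂ} (h : cusp p q = cusp r s) : p * s = q * r := by
  by_cases hq : q = 0
  · by_cases hs : s = 0
    · rw [hq, hs]; ring
    · rw [cusp, cusp, if_pos hq, if_neg hs] at h
      exact absurd h (OnePoint.infty_ne_coe _)
  · by_cases hs : s = 0
    · rw [cusp, cusp, if_neg hq, if_pos hs] at h
      exact absurd h (OnePoint.coe_ne_infty _)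
    · rw [cusp, cusp, if_neg hq, if_neg hs] at h
      have := OnePoint.coe_injective h
      rw [div_eq_div_iff hq hs] at this
      rw [this]; ring

theorem toReal_injective : Function.Injective toReal := by
  intro u v h
  ext i
  exact Int.cast_injective (congrFun h i)

/-! ### Reduced fractions and neighbouring cusps. -/

namespace IsQuadGen

variable {t n : ℤ} {d : ℕ}

theorem lvec_injective {ω : ℂ} (h : IsQuadGen ω t n) {u v : Fin 4 → ℤ} :
    lightMat (cvec ω u) = lightMat (cvec ω v) ↔ lvec t n u = lvec t n v := by
  rw [h.lightMat_cvec, h.lightMat_cvec, h.herm_injective.eq_iff, toReal_injective.eq_iff]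

theorem cvec_mem (h : IsQuadGen (omega d) t n) (v : Fin 4 → ℤ) (i : Fin 2) :
    cvec (omega d) v i ∈ intRing d := by
  rw [h.mem_intRing]
  fin_cases i
  · exact ⟨v 0, v 1, rfl⟩
  · exact ⟨v 2, v 3, rfl⟩

theorem det_mul_conj {ω : ℂ} (h : IsQuadGen ω t n) {u v : Fin 4 → ℤ}
    (huv : polar t n (lvec t n u) (lvec t n v) = 1) :
    (cvec ω u 0 * cvec ω v 1 - cvec ω u 1 * cvec ω v 0) *
      conj (cvec ω u 0 * cvec ω v 1 - cvec ω u 1 * cvec ω v 0) = 1 := by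
  have h1 := h.polar_lvec u v
  have h2 : (cmat ω u v).det = cvec ω u 0 * cvec ω v 1 - cvec ω u 1 * cvec ω v 0 := by
    rw [cmat, det_fin_two_of]
    simp [cvec]
    ring
  rw [huv, h2] at h1
  rw [← normSq_cast]
  exact_mod_cast h1

/-- A reduced fraction is determined by its value up to a unit. -/
theorem lvec_eq_of_cusp_eq (h : IsQuadGen (omega d) t n) {u u' v v' : Fin 4 → ℤ}
    (hu : polar t n (lvec t n u) (lvec t n u') = 1) (hv : polar t n (lvec t n v) (lvec t n v') = 1)
    (huv : vcusp (omega d) u = vcusp (omega d) v) : lvec t n u = lvec t n v := by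
  have eu := h.det_mul_conj hu
  have ev := h.det_mul_conj hv
  have mu := h.cvec_mem u
  have mu' := h.cvec_mem u'
  have mv := h.cvec_mem v
  have mv' := h.cvec_mem v'
  rw [← h.lvec_injective]
  set U := cvec (omega d) u
  set U' := cvec (omega d) u'
  set V := cvec (omega d) v
  set V' := cvec (omega d) v'
  set e := U 0 * U' 1 - U 1 * U' 0 with he
  set f := V 0 * V' 1 - V 1 * V' 0 with hf
  have hf0 : f ≠ 0 := left_ne_zero_of_mul_eq_one ev
  have me : e ∈ intRing d := sub_mem (mul_mem (mu 0) (mu' 1)) (mul_mem (mu 1) (mu' 0))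
  have mf : f ∈ intRing d := sub_mem (mul_mem (mv 0) (mv' 1)) (mul_mem (mv 1) (mv' 0))
  have hx : U 0 * V 1 = U 1 * V 0 := mul_eq_mul_of_cusp_eq huv
  -- `U'` and `V'` complete `U` and `V` to matrices with unit determinants `e` and `f`. By Cramer's
  -- rule the proportionality factors `a`, `b` lie in the ring; being mutually inverse they have
  -- norm 1, and such a factor disappears from `v v*`.
  set a := conj e * (V 0 * U' 1 - V 1 * U' 0) with ha
  set b := conj f * (U 0 * V' 1 - U 1 * V' 0) with hb
  have ma : a ∈ intRing d :=
    mul_mem (h.conj_mem me) (sub_mem (mul_mem (mv 0) (mu' 1)) (mul_mem (mv 1) (mu' 0)))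
  have mb : b ∈ intRing d :=
    mul_mem (h.conj_mem mf) (sub_mem (mul_mem (mu 0) (mv' 1)) (mul_mem (mu 1) (mv' 0)))
  have hV0 : V 0 = a * U 0 := by
    linear_combination -V 0 * eu + conj e * U' 0 * hx + (V 0 * conj e) * he
  have hV1 : V 1 = a * U 1 := by
    linear_combination -V 1 * eu + conj e * U' 1 * hx + (V 1 * conj e) * he
  have hU0 : U 0 = b * V 0 := by
    linear_combination -U 0 * ev - conj f * V' 0 * hx + (U 0 * conj f) * hf
  have hU1 : U 1 = b * V 1 := by
    linear_combination -U 1 * ev - conj f * V' 1 * hx + (U 1 * conj f) * hf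
  have hab : a * b = 1 := by
    apply mul_right_cancel₀ hf0
    have : f = a * b * f := by
      nth_rewrite 1 [hf]
      rw [hV0, hV1, hU0, hU1, hf]
      ring
    rw [← this, one_mul]
  have hna := h.norm_eq_one_of_mul ma mb hab
  have hna' : a * conj a = 1 := by
    rw [← normSq_cast, hna]; simp
  ext i j
  rw [lightMat_apply, lightMat_apply]
  have hV : ∀ i, V i = a * U i := fun i => by fin_cases i <;> assumption
  rw [hV i, hV j, map_mul]
  linear_combination -(U i * conj (U j)) * hna'

theorem isCoprime_of_polar (h : IsQuadGen (omega d) t n) {u v : Fin 4 → ℤ}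
    (huv : polar t n (lvec t n u) (lvec t n v) = 1) :
    IsCoprime (⟨_, h.cvec_mem u 0⟩ : intRing d) ⟨_, h.cvec_mem u 1⟩ := by
  have e := h.det_mul_conj huv
  have me : cvec (omega d) u 0 * cvec (omega d) v 1 - cvec (omega d) u 1 * cvec (omega d) v 0
      ∈ intRing d := sub_mem (mul_mem (h.cvec_mem u 0) (h.cvec_mem v 1))
        (mul_mem (h.cvec_mem u 1) (h.cvec_mem v 0))
  refine ⟨⟨_, mul_mem (h.cvec_mem v 1) (h.conj_mem me)⟩,
    ⟨_, neg_mem (mul_mem (h.cvec_mem v 0) (h.conj_mem me))⟩, ?_⟩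
  apply Subtype.ext
  refine Eq.trans ?_ e
  push_cast
  ring

theorem polar_comm (t n : ℤ) (u v : Fin 4 → ℤ) : polar t n u v = polar t n v u := by
  simp only [polar]; ring

theorem neighbouring_of_polar (h : IsQuadGen (omega d) t n) {u v : Fin 4 → ℤ}
    (huv : polar t n (lvec t n u) (lvec t n v) = 1) :
    Neighbouring d (vcusp (omega d) u) (vcusp (omega d) v) := by
  refine ⟨⟨_, h.cvec_mem u 0⟩, ⟨_, h.cvec_mem u 1⟩, ⟨_, h.cvec_mem v 0⟩, ⟨_, h.cvec_mem v 1⟩,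
    h.isCoprime_of_polar huv, h.isCoprime_of_polar (by rwa [polar_comm]), rfl, rfl, ?_⟩
  have e := h.det_mul_conj huv
  rw [← normSq_cast] at e
  have e' : ‖cvec (omega d) u 0 * cvec (omega d) v 1
      - cvec (omega d) u 1 * cvec (omega d) v 0‖ ^ 2 = 1 := by exact_mod_cast e
  exact (pow_eq_one_iff_of_nonneg (norm_nonneg _) two_ne_zero).1 e'

theorem polar_matVec {ω : ℂ} (h : IsQuadGen ω t n) {c₀ c₁ : Fin 4 → ℤ}
    (hdet : ‖(cmat ω c₀ c₁).det‖ = 1) (u v : Fin 4 → ℤ) :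
    polar t n (lvec t n (matVec t n c₀ c₁ u)) (lvec t n (matVec t n c₀ c₁ v))
      = polar t n (lvec t n u) (lvec t n v) := by
  have h1 := h.polar_lvec (matVec t n c₀ c₁ u) (matVec t n c₀ c₁ v)
  have hcols : ∀ u v, cmat ω u v = Matrix.of fun i j => (![cvec ω u, cvec ω v] j) i := by
    intro u v
    ext i j
    fin_cases i <;> fin_cases j <;> simp [cmat, cvec]
  have e : cmat ω (matVec t n c₀ c₁ u) (matVec t n c₀ c₁ v) = cmat ω c₀ c₁ * cmat ω u v := by
    rw [hcols (matVec t n c₀ c₁ u), hcols u, ← h.cmat_mulVec, ← h.cmat_mulVec]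
    ext i j
    fin_cases i <;> fin_cases j <;> simp [Matrix.mul_apply]
  rw [e, det_mul, norm_mul, hdet, one_mul, h.polar_lvec] at h1
  exact_mod_cast h1.symm

end IsQuadGen

/-- Every way to extend the partial assignment `done` of vertices to given light vectors by an
assignment for the remaining ones, so that all polar forms agree, fills a face. -/
def FillsFace (t n : ℤ) {m N : ℕ} (face : Fin N → Fin 4 → ℤ) (l : Fin m → Fin 4 → ℤ) :
    List (Fin m × (Fin 4 → ℤ)) → List (Fin 4 → ℤ) → Prop
  | done, [] => ∃ j, ∀ a, pairing (face j) (l a) = 0 ↔ a ∈ done.map Prod.fst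
  | done, u :: us => ∀ a, (∀ e ∈ done, polar t n (l e.1) (l a) = polar t n e.2 u) →
      FillsFace t n face l ((a, u) :: done) us

instance decidableFillsFace (t n : ℤ) {m N : ℕ} (face : Fin N → Fin 4 → ℤ)
    (l : Fin m → Fin 4 → ℤ) : ∀ done us, Decidable (FillsFace t n face l done us)
  | done, [] => by unfold FillsFace; infer_instance
  | done, u :: us => by
    unfold FillsFace
    have := fun a => decidableFillsFace t n face l ((a, u) :: done) us
    infer_instance

/-- The universally quantified search is specialised to the one assignment `ps`, vertex by vertex;
at each stage the `polar` conditions against the vertices already placed hold by assumption. -/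
theorem FillsFace.exists_face {t n : ℤ} {m N : ℕ} {face : Fin N → Fin 4 → ℤ}
    {l : Fin m → Fin 4 → ℤ} (ps : List (Fin m × (Fin 4 → ℤ))) :
    ∀ done, FillsFace t n face l done (ps.map Prod.snd) →
      (∀ e ∈ done ++ ps, ∀ e' ∈ done ++ ps, polar t n (l e.1) (l e'.1) = polar t n e.2 e'.2) →
      ∃ j, ∀ a, pairing (face j) (l a) = 0 ↔ a ∈ (done ++ ps).map Prod.fst := by
  induction ps with
  | nil =>
    intro done h _
    simpa [FillsFace] using h
  | cons p ps ih =>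
    intro done h hp
    have h1 := h p.1 fun e he => hp e (by simp [he]) p (by simp)
    obtain ⟨j, hj⟩ := ih _ h1 fun e he e' he' => hp e (by simp at he ⊢; tauto) e'
      (by simp at he' ⊢; tauto)
    refine ⟨j, fun a => (hj a).trans ?_⟩
    simp only [List.map_append, List.map_cons, List.mem_append, List.mem_cons]
    tauto

/-- The matrix with columns `c₀`, `c₁` maps the given vectors onto the vertices of the face `g`. -/
def MapsOntoFace (t n : ℤ) {m r : ℕ} (l : Fin m → Fin 4 → ℤ) (iv : Fin r → Fin 4 → ℤ)
    (g c₀ c₁ : Fin 4 → ℤ) : Prop :=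
  (∀ i, ∃ a, pairing g (l a) = 0 ∧ lvec t n (matVec t n c₀ c₁ (iv i)) = l a) ∧
    ∀ a, pairing g (l a) = 0 → ∃ i, lvec t n (matVec t n c₀ c₁ (iv i)) = l a

instance (t n : ℤ) {m r : ℕ} (l : Fin m → Fin 4 → ℤ) (iv : Fin r → Fin 4 → ℤ)
    (g c₀ c₁ : Fin 4 → ℤ) : Decidable (MapsOntoFace t n l iv g c₀ c₁) := by
  unfold MapsOntoFace; infer_instance

/-! ### Matching Farey polygons with the faces of the cell. -/

namespace CellData

variable {t n : ℤ} {m N : ℕ} {vert : Fin m → Fin 4 → ℤ} {face : Fin N → Fin 4 → ℤ}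
  {o : Fin m} {d : ℕ} {G : Subgroup (GL (Fin 2) ℂ)} {r : ℕ} {iv : Fin r → Fin 4 → ℤ}
  {P : Set H3}

/-- The matrix sends the standard vertices to reduced vectors with listed cusps, hence to the listed
light vectors themselves. It preserves `polar`, so the resulting assignment is among those searched,
and the image polygon and the face it fills are hulls of the same light vectors. -/
theorem mem_range_faceSet (D : CellData t n vert face o) (h : IsQuadGen (omega d) t n)
    (hred : ∀ i, ∃ k, polar t n (lvec t n (vert i)) (lvec t n (vert k)) = 1)
    (hG : G ≤ extendedBianchi d) (hP : P = hull fun i => lightMat (cvec (omega d) (iv i)))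
    (hiv : ∀ i, ∃ k, polar t n (lvec t n (iv i)) (lvec t n (iv k)) = 1)
    (hfill : FillsFace t n face (fun i => lvec t n (vert i)) []
      (List.ofFn fun i => lvec t n (iv i)))
    {Q : Set H3} {c : Fin r → OnePoint ℂ}
    (hQ : IsImagePolygon G P (fun i => cvec (omega d) (iv i)) Q c)
    (hc : ∀ i, c i ∈ Set.range fun a => vcusp (omega d) (vert a)) :
    Q ∈ Set.range (faceSet (omega d) face) := by
  obtain ⟨A, hA, rfl, hcA⟩ := hQ
  obtain ⟨c₀, c₁, hAc, hdet⟩ := h.exists_of_mem_extendedBianchi (hG hA)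
  choose k hk using hc
  have hl : ∀ i, lvec t n (matVec t n c₀ c₁ (iv i)) = lvec t n (vert (k i)) := by
    intro i
    obtain ⟨i', hi'⟩ := hiv i
    obtain ⟨a, ha⟩ := hred (k i)
    refine h.lvec_eq_of_cusp_eq (u' := matVec t n c₀ c₁ (iv i')) (v' := vert a) ?_ ha ?_
    · rw [h.polar_matVec hdet, hi']
    · have h1 : vcusp (omega d) (vert (k i)) = c i := hk i
      rw [h1, hcA, hAc, h.cmat_mulVec]
      rfl
  have hpol : ∀ i i', polar t n (lvec t n (vert (k i))) (lvec t n (vert (k i')))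
      = polar t n (lvec t n (iv i)) (lvec t n (iv i')) := fun i i' => by
    rw [← hl, ← hl, h.polar_matVec hdet]
  obtain ⟨j, hj⟩ := FillsFace.exists_face (List.ofFn fun i => (k i, lvec t n (iv i))) []
    (by rw [List.map_ofFn]; exact hfill) (by
      intro e he e' he'
      simp only [List.nil_append, List.mem_ofFn] at he he'
      obtain ⟨i, rfl⟩ := he
      obtain ⟨i', rfl⟩ := he'
      exact hpol i i')
  have hj' : ∀ a, pairing (face j) (lvec t n (vert a)) = 0 ↔ ∃ i, k i = a := by
    intro a
    rw [hj a]
    simp [List.mem_ofFn, List.map_ofFn]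
  refine ⟨j, ?_⟩
  rw [D.faceSet_eq_hull h, hP, moebius_image_hull]
  have e : ∀ i, (A : Matrix (Fin 2) (Fin 2) ℂ) * lightMat (cvec (omega d) (iv i))
      * (A : Matrix (Fin 2) (Fin 2) ℂ)ᴴ = lightMat (cvec (omega d) (vert (k i))) := fun i => by
    rw [← lightMat_mulVec, hAc, h.cmat_mulVec, h.lvec_injective, hl]
  simp only [e]
  apply hull_congr_range
  · rintro ⟨a, ha⟩
    obtain ⟨i, rfl⟩ := (hj' a).1 ha
    exact ⟨i, rfl⟩
  · intro i
    exact ⟨⟨k i, (hj' _).2 ⟨i, rfl⟩⟩, rfl⟩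

theorem exists_isImagePolygon [NeZero r] (D : CellData t n vert face o)
    (h : IsQuadGen (omega d) t n)
    (hP : P = hull fun i => lightMat (cvec (omega d) (iv i)))
    (hiv : ∀ i, polar t n (lvec t n (iv i)) (lvec t n (iv (i + 1))) = 1)
    {c₀ c₁ : Fin 4 → ℤ}
    (hA : ∃ A ∈ G, (A : Matrix (Fin 2) (Fin 2) ℂ) = cmat (omega d) c₀ c₁)
    (hdet : polar t n (lvec t n c₀) (lvec t n c₁) = 1) {j : Fin N}
    (hmap : MapsOntoFace t n (fun i => lvec t n (vert i)) iv (face j) c₀ c₁) :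
    ∃ c, IsImagePolygon G P (fun i => cvec (omega d) (iv i)) (faceSet (omega d) face j) c ∧
      ConnectsNeighbours d (Set.range fun a => vcusp (omega d) (vert a)) c := by
  obtain ⟨A, hA, hAc⟩ := hA
  have hdet' : ‖(cmat (omega d) c₀ c₁).det‖ = 1 := by
    have h1 := h.polar_lvec c₀ c₁
    rw [hdet] at h1
    exact (pow_eq_one_iff_of_nonneg (norm_nonneg _) two_ne_zero).1 (by simpa using h1)
  refine ⟨fun i => vcusp (omega d) (matVec t n c₀ c₁ (iv i)), ⟨A, hA, ?_, fun i => ?_⟩,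
    fun i => ?_, fun i => ?_⟩
  · rw [D.faceSet_eq_hull h, hP, moebius_image_hull]
    have e : ∀ i, (A : Matrix (Fin 2) (Fin 2) ℂ) * lightMat (cvec (omega d) (iv i))
        * (A : Matrix (Fin 2) (Fin 2) ℂ)ᴴ
        = lightMat (cvec (omega d) (matVec t n c₀ c₁ (iv i))) := fun i => by
      rw [← lightMat_mulVec, hAc, h.cmat_mulVec]
    simp only [e]
    apply hull_congr_range
    · rintro ⟨a, ha⟩
      obtain ⟨i, hi⟩ := hmap.2 a ha
      exact ⟨i, h.lvec_injective.2 hi.symm⟩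
    · intro i
      obtain ⟨a, ha, hi⟩ := hmap.1 i
      exact ⟨⟨a, ha⟩, h.lvec_injective.2 hi⟩
  · rw [hAc, h.cmat_mulVec]
    rfl
  · obtain ⟨a, -, hi⟩ := hmap.1 i
    exact ⟨a, cusp_eq_of_lightMat_eq (h.lvec_injective.2 hi.symm)⟩
  · apply h.neighbouring_of_polar
    rw [h.polar_matVec hdet', hiv]

end CellData

/-! ### Walls -/

theorem isQuadGen_omega_of_mod {d : ℕ} (hd : d % 4 = 3) {n : ℤ} (hn : 4 * n = d + 1) :
    IsQuadGen (omega d) 1 n := by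
  have hs : ((√d : ℝ) : ℂ) * ((√d : ℝ) : ℂ) = d := by
    rw [← Complex.ofReal_mul, Real.mul_self_sqrt (Nat.cast_nonneg d)]; simp
  have hn' : (4 * n : ℂ) = d + 1 := by exact_mod_cast hn
  have hp : 0 < √(d : ℝ) := Real.sqrt_pos.2 (by exact_mod_cast (by omega : 0 < d))
  have h2 : conj (2 : ℂ) = 2 := map_ofNat _ 2
  rw [omega, if_pos hd]
  refine ⟨?_, ?_, ?_⟩
  · simp [h2]; ring
  · simp only [map_div₀, map_add, map_one, map_mul, Complex.conj_ofReal, Complex.conj_I, h2]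
    linear_combination (-1 / 4 : ℂ) * hn' + (1 / 4 : ℂ) * hs - (√d * √d / 4 : ℂ) * Complex.I_sq
  · simpa using hp

theorem isQuadGen_omega {d : ℕ} (hd : d % 4 ≠ 3) (h0 : 0 < d) : IsQuadGen (omega d) 0 d := by
  have hs : ((√d : ℝ) : ℂ) * ((√d : ℝ) : ℂ) = d := by
    rw [← Complex.ofReal_mul, Real.mul_self_sqrt (Nat.cast_nonneg d)]; simp
  have hp : 0 < √(d : ℝ) := Real.sqrt_pos.2 (by exact_mod_cast h0)
  rw [omega, if_neg hd]
  refine ⟨?_, ?_, ?_⟩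
  · simp
  · simp only [map_mul, Complex.conj_ofReal, Complex.conj_I, Int.cast_natCast]
    linear_combination hs - (√d * √d : ℂ) * Complex.I_sq
  · simpa using hp

namespace IsQuadGen

variable {ω : ℂ} {t n : ℤ}

theorem mem_line_iff (h : IsQuadGen ω t n) (p : H3) (a₁ a₂ b₁ b₂ : ℝ) (hab : a₁ ≠ b₁ ∨ a₂ ≠ b₂) :
    p.1.1 ∈ line[ℝ, (a₁ + a₂ * ω : ℂ), (b₁ + b₂ * ω : ℂ)] ↔
      (coord ω p 1 - a₁) * (b₂ - a₂) = (coord ω p 2 - a₂) * (b₁ - a₁) := by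
  rw [mem_affineSpan_pair_iff_exists_lineMap_eq, ← h.coord_spec p]
  constructor
  · rintro ⟨r, hr⟩
    rw [AffineMap.lineMap_apply, vsub_eq_sub, vadd_eq_add, Complex.real_smul] at hr
    have := h.coord_unique (x := r * (b₁ - a₁) + a₁) (y := r * (b₂ - a₂) + a₂)
      (x' := coord ω p 1) (y' := coord ω p 2) (by rw [← hr]; push_cast; ring)
    rw [← this.1, ← this.2]
    ring
  · intro he
    have key : ∃ r : ℝ, coord ω p 1 = r * (b₁ - a₁) + a₁ ∧ coord ω p 2 = r * (b₂ - a₂) + a₂ := by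
      by_cases h1 : a₁ = b₁
      · have h2 : b₂ - a₂ ≠ 0 := sub_ne_zero.2 (hab.resolve_left (not_not.2 h1)).symm
        refine ⟨(coord ω p 2 - a₂) / (b₂ - a₂), ?_, by field_simp; ring⟩
        rw [h1, sub_self, mul_zero, mul_eq_zero, or_iff_left h2] at he
        rw [h1]
        linarith
      · have h2 : b₁ - a₁ ≠ 0 := sub_ne_zero.2 (Ne.symm h1)
        refine ⟨(coord ω p 1 - a₁) / (b₁ - a₁), by field_simp; ring, ?_⟩
        rw [div_mul_eq_mul_div, he]
        field_simp
        ring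
    obtain ⟨r, h1, h2⟩ := key
    refine ⟨r, ?_⟩
    rw [AffineMap.lineMap_apply, vsub_eq_sub, vadd_eq_add, Complex.real_smul, h1, h2]
    push_cast
    ring

theorem exists_linear_coord (h : IsQuadGen ω t n) : ∃ X Y : ℂ →ₗ[ℝ] ℝ, (X 1 = 1 ∧ Y 1 = 0) ∧
    (X ω = 0 ∧ Y ω = 1) ∧ ∀ p : H3, X p.1.1 = coord ω p 1 ∧ Y p.1.1 = coord ω p 2 := by
  have hi := h.im_pos.ne'
  refine ⟨Complex.reLm - (ω.re / ω.im) • Complex.imLm, (1 / ω.im) • Complex.imLm, ?_, ?_,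
    fun p => ?_⟩
  · simp
  · constructor
    · simp; field_simp; ring
    · simp; field_simp
  · constructor
    · simp [coord]; ring
    · simp [coord]; ring

theorem mem_triangle_iff (h : IsQuadGen ω t n) (p : H3) :
    p.1.1 ∈ convexHull ℝ {0, 1, ω} ↔
      0 ≤ coord ω p 1 ∧ 0 ≤ coord ω p 2 ∧ coord ω p 1 + coord ω p 2 ≤ 1 := by
  obtain ⟨X, Y, ⟨X1, Y1⟩, ⟨Xω, Yω⟩, hXY⟩ := h.exists_linear_coord
  constructor
  · intro hp
    have hK : Convex ℝ (X ⁻¹' Set.Ici 0 ∩ (Y ⁻¹' Set.Ici 0 ∩ (X + Y) ⁻¹' Set.Iic 1)) :=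
      ((convex_Ici 0).linear_preimage X).inter
        (((convex_Ici 0).linear_preimage Y).inter ((convex_Iic 1).linear_preimage (X + Y)))
    have := convexHull_min (t := X ⁻¹' Set.Ici 0 ∩ (Y ⁻¹' Set.Ici 0 ∩ (X + Y) ⁻¹' Set.Iic 1))
      (by rintro z (rfl | rfl | rfl) <;> simp [X1, Y1, Xω, Yω]) hK hp
    simpa [(hXY p).1, (hXY p).2] using this
  · rintro ⟨hx, hy, hxy⟩
    refine mem_convexHull_of_exists_fintype (ι := Fin 3)
      ![1 - coord ω p 1 - coord ω p 2, coord ω p 1, coord ω p 2] ![0, 1, ω] ?_ ?_ ?_ ?_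
    · intro i; fin_cases i <;> simp <;> linarith
    · simp [Fin.sum_univ_succ]
    · intro i; fin_cases i <;> simp
    · rw [← h.coord_spec p]
      simp [Fin.sum_univ_succ]

theorem mem_rectangle_iff (h : IsQuadGen ω t n) (p : H3) :
    p.1.1 ∈ convexHull ℝ {0, 1, ω, ω + 1} ↔
      (0 ≤ coord ω p 1 ∧ coord ω p 1 ≤ 1) ∧ 0 ≤ coord ω p 2 ∧ coord ω p 2 ≤ 1 := by
  obtain ⟨X, Y, ⟨X1, Y1⟩, ⟨Xω, Yω⟩, hXY⟩ := h.exists_linear_coord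
  constructor
  · intro hp
    have hK : Convex ℝ (X ⁻¹' Set.Icc 0 1 ∩ Y ⁻¹' Set.Icc 0 1) :=
      ((convex_Icc 0 1).linear_preimage X).inter ((convex_Icc 0 1).linear_preimage Y)
    have := convexHull_min (t := X ⁻¹' Set.Icc 0 1 ∩ Y ⁻¹' Set.Icc 0 1)
      (by rintro z (rfl | rfl | rfl | rfl) <;> simp [X1, Y1, Xω, Yω]) hK hp
    simpa [(hXY p).1, (hXY p).2] using this
  · rintro ⟨⟨hx, hx'⟩, hy, hy'⟩
    set x := coord ω p 1 with hxd
    set y := coord ω p 2 with hyd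
    -- Bilinear weights of a point of the unit square with respect to its four corners.
    refine mem_convexHull_of_exists_fintype (ι := Fin 4)
      ![(1 - x) * (1 - y), x * (1 - y), (1 - x) * y, x * y] ![0, 1, ω, ω + 1] ?_ ?_ ?_ ?_
    · have hx'' := sub_nonneg.2 hx'
      have hy'' := sub_nonneg.2 hy'
      intro i; fin_cases i <;> simp <;> positivity
    · simp [Fin.sum_univ_succ]; ring
    · intro i; fin_cases i <;> simp
    · rw [← h.coord_spec p]
      simp [Fin.sum_univ_succ]
      ring

end IsQuadGen

theorem pairing_vertical_coord (ω : ℂ) (a b c : ℤ) (p : H3) :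
    pairing (toReal ![0, a, b, c]) (coord ω p) = a * coord ω p 1 + b * coord ω p 2 + c := by
  simp [pairing, toReal, coord]

/-- Columns of a unimodular matrix which maps a vertical face onto the plane of the face `j`. -/
def IsWallMatrix (t n : ℤ) {N : ℕ} (face : Fin N → Fin 4 → ℤ) (j : Fin N)
    (c : (Fin 4 → ℤ) × (Fin 4 → ℤ)) : Prop :=
  (detRe n c.1 c.2 = 1 ∧ detIm t c.1 c.2 = 0) ∧
    ∃ k, face k 0 = 0 ∧ (pull t n c.1 c.2 (face j) = face k ∨ pull t n c.1 c.2 (face j) = -face k)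

instance (t n : ℤ) {N : ℕ} (face : Fin N → Fin 4 → ℤ) (j : Fin N)
    (c : (Fin 4 → ℤ) × (Fin 4 → ℤ)) : Decidable (IsWallMatrix t n face j c) := by
  unfold IsWallMatrix; infer_instance

theorem wallData_of_mod {d : ℕ} (hd : d % 4 = 3) {n : ℤ} (h : IsQuadGen (omega d) 1 n) {N : ℕ}
    {face : Fin N → Fin 4 → ℤ}
    (hf : ∀ j, face j 0 = 0 →
      face j = ![0, 0, 1, 0] ∨ face j = ![0, -1, -1, 1] ∨ face j = ![0, 1, 0, 0])
    (h₁ : ∃ j, face j = ![0, 0, 1, 0]) (h₂ : ∃ j, face j = ![0, -1, -1, 1])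
    (h₃ : ∃ j, face j = ![0, 1, 0, 0])
    (M : Fin N → (Fin 4 → ℤ) × (Fin 4 → ℤ))
    (hM : ∀ j, face j 0 ≠ 0 → IsWallMatrix 1 n face j (M j)) :
    WallData d 1 n face where
  wall X := by
    have l₁ : ∀ p : H3, p.1.1 ∈ line[ℝ, (0 : ℂ), 1] ↔
        pairing (toReal ![0, 0, 1, 0]) (coord (omega d) p) = 0 := fun p => by
      have := h.mem_line_iff p 0 0 1 0 (by simp)
      rw [pairing_vertical_coord]
      simpa [eq_comm] using this
    have l₂ : ∀ p : H3, p.1.1 ∈ line[ℝ, (1 : ℂ), omega d] ↔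
        pairing (toReal ![0, -1, -1, 1]) (coord (omega d) p) = 0 := fun p => by
      have := h.mem_line_iff p 1 0 0 1 (by simp)
      rw [pairing_vertical_coord]
      simp at this
      rw [this]
      push_cast
      constructor <;> intro <;> linarith
    have l₃ : ∀ p : H3, p.1.1 ∈ line[ℝ, omega d, (0 : ℂ)] ↔
        pairing (toReal ![0, 1, 0, 0]) (coord (omega d) p) = 0 := fun p => by
      have := h.mem_line_iff p 0 1 0 0 (by simp)
      rw [pairing_vertical_coord]
      simpa using this
    simp only [IsWall, edges, if_pos hd, Set.mem_insert_iff, Set.mem_singleton_iff]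
    constructor
    · rintro ⟨e, rfl | rfl | rfl, rfl⟩
      · obtain ⟨j, hj⟩ := h₁
        exact ⟨j, by rw [hj]; rfl, by rw [hj]; exact Set.ext l₁⟩
      · obtain ⟨j, hj⟩ := h₂
        exact ⟨j, by rw [hj]; rfl, by rw [hj]; exact Set.ext l₂⟩
      · obtain ⟨j, hj⟩ := h₃
        exact ⟨j, by rw [hj]; rfl, by rw [hj]; exact Set.ext l₃⟩
    · rintro ⟨j, hj, rfl⟩
      rcases hf j hj with e | e | e <;> rw [e]
      · exact ⟨(0, 1), by simp, (Set.ext l₁).symm⟩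
      · exact ⟨(1, omega d), by simp, (Set.ext l₂).symm⟩
      · exact ⟨(omega d, 0), by simp, (Set.ext l₃).symm⟩
  mem_W p := by
    rw [W, if_pos hd, h.mem_triangle_iff]
    constructor
    · rintro ⟨hx, hy, hxy⟩ j hj
      rcases hf j hj with e | e | e <;> rw [e, pairing_vertical_coord] <;> push_cast <;> linarith
    · intro hp
      obtain ⟨j₁, e₁⟩ := h₁
      obtain ⟨j₂, e₂⟩ := h₂
      obtain ⟨j₃, e₃⟩ := h₃
      have p₁ := hp j₁ (by rw [e₁]; rfl)
      have p₂ := hp j₂ (by rw [e₂]; rfl)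
      have p₃ := hp j₃ (by rw [e₃]; rfl)
      rw [e₁, pairing_vertical_coord] at p₁
      rw [e₂, pairing_vertical_coord] at p₂
      rw [e₃, pairing_vertical_coord] at p₃
      push_cast at p₁ p₂ p₃
      refine ⟨?_, ?_, ?_⟩ <;> linarith
  wall_disc j hj := by
    rcases hf j hj with e | e | e <;> rw [e] <;> simp [disc]
  floor j hj := ⟨_, _, hM j hj⟩

theorem wallData_of_mod_ne {d : ℕ} (hd : d % 4 ≠ 3) {n : ℤ} (h : IsQuadGen (omega d) 0 n) {N : ℕ}
    {face : Fin N → Fin 4 → ℤ}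
    (hf : ∀ j, face j 0 = 0 → face j = ![0, 0, 1, 0] ∨ face j = ![0, -1, 0, 1] ∨
      face j = ![0, 0, -1, 1] ∨ face j = ![0, 1, 0, 0])
    (h₁ : ∃ j, face j = ![0, 0, 1, 0]) (h₂ : ∃ j, face j = ![0, -1, 0, 1])
    (h₃ : ∃ j, face j = ![0, 0, -1, 1]) (h₄ : ∃ j, face j = ![0, 1, 0, 0])
    (M : Fin N → (Fin 4 → ℤ) × (Fin 4 → ℤ))
    (hM : ∀ j, face j 0 ≠ 0 → IsWallMatrix 0 n face j (M j)) :
    WallData d 0 n face where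
  wall X := by
    have l₁ : ∀ p : H3, p.1.1 ∈ line[ℝ, (0 : ℂ), 1] ↔
        pairing (toReal ![0, 0, 1, 0]) (coord (omega d) p) = 0 := fun p => by
      have := h.mem_line_iff p 0 0 1 0 (by simp)
      rw [pairing_vertical_coord]
      simpa [eq_comm] using this
    have l₂ : ∀ p : H3, p.1.1 ∈ line[ℝ, (1 : ℂ), omega d + 1] ↔
        pairing (toReal ![0, -1, 0, 1]) (coord (omega d) p) = 0 := fun p => by
      have := h.mem_line_iff p 1 0 1 1 (by simp)
      rw [pairing_vertical_coord]
      simp [add_comm] at this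
      rw [this]
      push_cast
      constructor <;> intro <;> linarith
    have l₃ : ∀ p : H3, p.1.1 ∈ line[ℝ, omega d + 1, omega d] ↔
        pairing (toReal ![0, 0, -1, 1]) (coord (omega d) p) = 0 := fun p => by
      have := h.mem_line_iff p 1 1 0 1 (by simp)
      rw [pairing_vertical_coord]
      simp [add_comm] at this
      rw [this]
      push_cast
      constructor <;> intro <;> linarith
    have l₄ : ∀ p : H3, p.1.1 ∈ line[ℝ, omega d, (0 : ℂ)] ↔
        pairing (toReal ![0, 1, 0, 0]) (coord (omega d) p) = 0 := fun p => by
      have := h.mem_line_iff p 0 1 0 0 (by simp)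
      rw [pairing_vertical_coord]
      simpa using this
    simp only [IsWall, edges, if_neg hd, Set.mem_insert_iff, Set.mem_singleton_iff]
    constructor
    · rintro ⟨e, rfl | rfl | rfl | rfl, rfl⟩
      · obtain ⟨j, hj⟩ := h₁
        exact ⟨j, by rw [hj]; rfl, by rw [hj]; exact Set.ext l₁⟩
      · obtain ⟨j, hj⟩ := h₂
        exact ⟨j, by rw [hj]; rfl, by rw [hj]; exact Set.ext l₂⟩
      · obtain ⟨j, hj⟩ := h₃
        exact ⟨j, by rw [hj]; rfl, by rw [hj]; exact Set.ext l₃⟩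
      · obtain ⟨j, hj⟩ := h₄
        exact ⟨j, by rw [hj]; rfl, by rw [hj]; exact Set.ext l₄⟩
    · rintro ⟨j, hj, rfl⟩
      rcases hf j hj with e | e | e | e <;> rw [e]
      · exact ⟨(0, 1), by simp, (Set.ext l₁).symm⟩
      · exact ⟨(1, omega d + 1), by simp, (Set.ext l₂).symm⟩
      · exact ⟨(omega d + 1, omega d), by simp, (Set.ext l₃).symm⟩
      · exact ⟨(omega d, 0), by simp, (Set.ext l₄).symm⟩
  mem_W p := by
    rw [W, if_neg hd, h.mem_rectangle_iff]
    constructor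
    · rintro ⟨⟨hx, hx'⟩, hy, hy'⟩ j hj
      rcases hf j hj with e | e | e | e <;> rw [e, pairing_vertical_coord] <;> push_cast <;>
        linarith
    · intro hp
      obtain ⟨j₁, e₁⟩ := h₁
      obtain ⟨j₂, e₂⟩ := h₂
      obtain ⟨j₃, e₃⟩ := h₃
      obtain ⟨j₄, e₄⟩ := h₄
      have p₁ := hp j₁ (by rw [e₁]; rfl)
      have p₂ := hp j₂ (by rw [e₂]; rfl)
      have p₃ := hp j₃ (by rw [e₃]; rfl)
      have p₄ := hp j₄ (by rw [e₄]; rfl)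
      rw [e₁, pairing_vertical_coord] at p₁
      rw [e₂, pairing_vertical_coord] at p₂
      rw [e₃, pairing_vertical_coord] at p₃
      rw [e₄, pairing_vertical_coord] at p₄
      push_cast at p₁ p₂ p₃ p₄
      refine ⟨⟨?_, ?_⟩, ?_, ?_⟩ <;> linarith
  wall_disc j hj := by
    rcases hf j hj with e | e | e | e <;> rw [e] <;> simp [disc]
  floor j hj := ⟨_, _, hM j hj⟩

/-! ### Forms of small discriminant at the vertices -/

/-- For a light vector `x` of a cusp `z`, the pairing is `g 0 * x 3` times `|z - c|² - r²`, with `c`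
and `r` the centre and radius of the hemisphere of `g`. The right side is the term in `|z - c|²`,
written as a sum of squares. -/
theorem pairing_identity (t n : ℤ) (g x : Fin 4 → ℤ)
    (hx : x 0 * x 3 = x 1 ^ 2 + t * (x 1 * x 2) + n * x 2 ^ 2) :
    4 * ((4 * n - t ^ 2) * g 0 * x 3 * pairing g x + disc t n g * x 3 ^ 2)
      = (4 * n - t ^ 2) * (x 3 * g 1 + g 0 * (2 * x 1 + t * x 2)) ^ 2
        + (2 * (x 3 * g 2 + g 0 * (t * x 1 + 2 * (n * x 2)))
          - t * (x 3 * g 1 + g 0 * (2 * x 1 + t * x 2))) ^ 2 := by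
  simp only [pairing, disc]
  linear_combination (4 * (4 * n - t ^ 2) * g 0 ^ 2) * hx

theorem lvec_null (t n : ℤ) (v : Fin 4 → ℤ) :
    lvec t n v 0 * lvec t n v 3 = lvec t n v 1 ^ 2 + t * (lvec t n v 1 * lvec t n v 2)
      + n * lvec t n v 2 ^ 2 := by
  simp only [lvec, cons_val]
  ring

/-- A negative integer value is at most `-1`; nonnegativity of the sum of squares then forces `4n -
t² ≤ disc t n g * x 3`. -/
theorem pairing_nonneg_of_disc_lt {t n : ℤ} (hΔ : 0 < 4 * n - t ^ 2) {g x : Fin 4 → ℤ}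
    (hx : x 0 * x 3 = x 1 ^ 2 + t * (x 1 * x 2) + n * x 2 ^ 2) (hx3 : 0 < x 3) (hg : 0 < g 0)
    (hlt : disc t n g * x 3 < 4 * n - t ^ 2) : 0 ≤ pairing g x := by
  by_contra! hF
  have h1 := pairing_identity t n g x hx
  set Δ := 4 * n - t ^ 2
  have h2 : 0 ≤ 4 * (Δ * g 0 * x 3 * pairing g x + disc t n g * x 3 ^ 2) := by
    rw [h1]; positivity
  have h3 : Δ * x 3 ≤ Δ * x 3 * (g 0 * -pairing g x) :=
    le_mul_of_one_le_right (by positivity) (one_le_mul_of_one_le_of_one_le hg (by omega))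
  have h4 : disc t n g * x 3 * x 3 < Δ * x 3 := mul_lt_mul_of_pos_right hlt hx3
  nlinarith

/-- All integral forms of the given discriminants are nonnegative at the given vector. -/
theorem pairing_nonneg_of_lt {t n : ℤ} (hΔ : 0 < 4 * n - t ^ 2) {v : Fin 4 → ℤ}
    (hv : v = ![1, 0, 0, 0] ∨ (0 < lvec t n v 3 ∧ lvec t n v 3 < 4 * n - t ^ 2 ∧
      n * lvec t n v 3 < 4 * n - t ^ 2)) {g : Fin 4 → ℤ} (hg : 0 < g 0)
    (hK : disc t n g = 1 ∨ disc t n g = n) : 0 ≤ pairing g (lvec t n v) := by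
  rcases hv with rfl | ⟨h0, h1, h2⟩
  · simpa [pairing, lvec] using hg.le
  · refine pairing_nonneg_of_disc_lt hΔ (lvec_null t n v) h0 hg ?_
    rcases hK with e | e <;> rw [e]
    · rwa [one_mul]
    · exact h2

/-! ### Farey polygons in coordinates -/

/-- The vertices `0`, `∞`, `1` of the triangle. -/
def triangleVert : Fin 3 → Fin 4 → ℤ := ![![0, 0, 1, 0], ![1, 0, 0, 0], ![1, 0, 1, 0]]

/-- The vertices `0`, `∞`, `ω`, `1/ω̄` of the quadrangle. -/
def quadrangleVert (t : ℤ) : Fin 4 → Fin 4 → ℤ :=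
  ![![0, 0, 1, 0], ![1, 0, 0, 0], ![0, 1, 1, 0], ![1, 0, t, -1]]

/-- The vertices `0`, `∞`, `ω`, `2/ω̄`, `ω/2`, `1/ω̄` of the hexagon. -/
def hexagonVert (t : ℤ) : Fin 6 → Fin 4 → ℤ :=
  ![![0, 0, 1, 0], ![1, 0, 0, 0], ![0, 1, 1, 0], ![2, 0, t, -1], ![0, 1, 2, 0], ![1, 0, t, -1]]

theorem cvec_triangleVert (ω : ℂ) :
    (fun i => cvec ω (triangleVert i)) = ![![0, 1], ![1, 0], ![1, 1]] := by
  ext i j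
  fin_cases i <;> fin_cases j <;> simp [cvec, triangleVert]

namespace IsQuadGen

variable {ω : ℂ} {t n : ℤ}

theorem cvec_quadrangleVert (h : IsQuadGen ω t n) :
    (fun i => cvec ω (quadrangleVert t i)) = ![![0, 1], ![1, 0], ![ω, 1], ![1, conj ω]] := by
  ext i j
  fin_cases i <;> fin_cases j <;> simp [cvec, quadrangleVert, h.conj_eq]
  ring

theorem cvec_hexagonVert (h : IsQuadGen ω t n) : (fun i => cvec ω (hexagonVert t i))
    = ![![0, 1], ![1, 0], ![ω, 1], ![2, conj ω], ![ω, 2], ![1, conj ω]] := by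
  ext i j
  fin_cases i <;> fin_cases j <;> simp [cvec, hexagonVert, h.conj_eq]
  all_goals ring

end IsQuadGen

/-- Columns of a unimodular matrix. -/
def IsUnimodular (t n : ℤ) (c : (Fin 4 → ℤ) × (Fin 4 → ℤ)) : Prop :=
  (detRe n c.1 c.2 = 1 ∧ detIm t c.1 c.2 = 0) ∧ polar t n (lvec t n c.1) (lvec t n c.2) = 1

instance (t n : ℤ) (c : (Fin 4 → ℤ) × (Fin 4 → ℤ)) : Decidable (IsUnimodular t n c) := by
  unfold IsUnimodular; infer_instance

/-- The sum of the vertices in a given plane. -/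
def vertexSum {m : ℕ} (l : Fin m → Fin 4 → ℤ) (g : Fin 4 → ℤ) : Fin 4 → ℤ :=
  fun c => ∑ i, if pairing g (l i) = 0 then l i c else 0

namespace CellData

variable {t n : ℤ} {m N : ℕ} {vert : Fin m → Fin 4 → ℤ} {face : Fin N → Fin 4 → ℤ}
  {o : Fin m} {d : ℕ}

/-- The sum of the vertices on a face lies in its relative interior. The plane `0` contains every
vertex, so its vertex sum is an interior point of the cell. -/
theorem of_vertexSum (nonneg : ∀ j i, 0 ≤ pairing (face j) (lvec t n (vert i)))
    (disc_pos : ∀ j, 0 < disc t n (face j)) (apex : vert o = ![1, 0, 0, 0])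
    (finite : ∀ i, i ≠ o → 0 < lvec t n (vert i) 3) (other : ∃ i, i ≠ o)
    (floor : ∃ j, 0 < pairing (face j) (lvec t n (vert o)))
    (cert : FloorCert face (fun i => lvec t n (vert i)) o)
    (point : ∀ j, let w := vertexSum (fun i => lvec t n (vert i)) (face j)
      Timelike t n w ∧ pairing (face j) w = 0 ∧ ∀ k, k ≠ j → 0 < pairing (face k) w)
    (inner : let w := vertexSum (fun i => lvec t n (vert i)) 0
      Timelike t n w ∧ ∀ k, 0 < pairing (face k) w) : CellData t n vert face o :=
  ⟨nonneg, disc_pos, apex, finite, other, floor, cert, fun j => ⟨_, point j⟩, ⟨_, inner⟩⟩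

theorem fareyTriangles_subset (D : CellData t n vert face o) (h : IsQuadGen (omega d) t n)
    (hred : ∀ i, ∃ k, polar t n (lvec t n (vert i)) (lvec t n (vert k)) = 1)
    (hiv : ∀ i, ∃ k, polar t n (lvec t n (triangleVert i)) (lvec t n (triangleVert k)) = 1)
    (hfill : FillsFace t n face (fun i => lvec t n (vert i)) []
      (List.ofFn fun i => lvec t n (triangleVert i)))
    {G : Subgroup (GL (Fin 2) ℂ)} (hG : G ≤ extendedBianchi d) :
    fareyTriangles d G (Set.range fun i => vcusp (omega d) (vert i))
      ⊆ Set.range (faceSet (omega d) face) := by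
  rintro Q ⟨c, hQ, hc, -⟩
  rw [IsFareyTriangle, ← cvec_triangleVert (omega d)] at hQ
  have hP := triangle_eq_hull
  rw [← cvec_triangleVert (omega d)] at hP
  exact D.mem_range_faceSet h hred hG hP hiv hfill hQ hc

theorem fareyQuadrangles_subset (D : CellData t 2 vert face o) (h : IsQuadGen (omega d) t 2)
    (hred : ∀ i, ∃ k, polar t 2 (lvec t 2 (vert i)) (lvec t 2 (vert k)) = 1)
    (hiv : ∀ i, ∃ k, polar t 2 (lvec t 2 (quadrangleVert t i)) (lvec t 2 (quadrangleVert t k)) = 1)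
    (hfill : FillsFace t 2 face (fun i => lvec t 2 (vert i)) []
      (List.ofFn fun i => lvec t 2 (quadrangleVert t i))) :
    fareyQuadrangles d (Set.range fun i => vcusp (omega d) (vert i))
      ⊆ Set.range (faceSet (omega d) face) := by
  rintro Q ⟨c, hQ, hc, -⟩
  rw [IsFareyQuadrangle, ← h.cvec_quadrangleVert] at hQ
  have hP := h.quadrangle_eq_hull
  rw [← h.cvec_quadrangleVert] at hP
  exact D.mem_range_faceSet h hred (IsQuadGen.bianchi_le_extendedBianchi d) hP hiv hfill hQ hc

theorem fareyHexagons_subset (D : CellData t 3 vert face o) (h : IsQuadGen (omega d) t 3)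
    (hred : ∀ i, ∃ k, polar t 3 (lvec t 3 (vert i)) (lvec t 3 (vert k)) = 1)
    (hiv : ∀ i, ∃ k, polar t 3 (lvec t 3 (hexagonVert t i)) (lvec t 3 (hexagonVert t k)) = 1)
    (hfill : FillsFace t 3 face (fun i => lvec t 3 (vert i)) []
      (List.ofFn fun i => lvec t 3 (hexagonVert t i))) :
    fareyHexagons d (Set.range fun i => vcusp (omega d) (vert i))
      ⊆ Set.range (faceSet (omega d) face) := by
  rintro Q ⟨c, hQ, hc, -⟩
  rw [IsFareyHexagon, ← h.cvec_hexagonVert] at hQ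
  have hP := h.hexagon_eq_hull
  rw [← h.cvec_hexagonVert] at hP
  exact D.mem_range_faceSet h hred (IsQuadGen.bianchi_le_extendedBianchi d) hP hiv hfill hQ hc

theorem mem_fareyTriangles (D : CellData t n vert face o) (h : IsQuadGen (omega d) t n)
    (hiv : ∀ i, polar t n (lvec t n (triangleVert i)) (lvec t n (triangleVert (i + 1))) = 1)
    {G : Subgroup (GL (Fin 2) ℂ)} {c : (Fin 4 → ℤ) × (Fin 4 → ℤ)}
    (hA : ∃ A ∈ G, (A : Matrix (Fin 2) (Fin 2) ℂ) = cmat (omega d) c.1 c.2)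
    (hdet : polar t n (lvec t n c.1) (lvec t n c.2) = 1) {j : Fin N}
    (hmap : MapsOntoFace t n (fun i => lvec t n (vert i)) triangleVert (face j) c.1 c.2) :
    faceSet (omega d) face j
      ∈ fareyTriangles d G (Set.range fun i => vcusp (omega d) (vert i)) := by
  have hP := triangle_eq_hull
  rw [← cvec_triangleVert (omega d)] at hP
  obtain ⟨c, hQ, hc⟩ := D.exists_isImagePolygon h hP hiv hA hdet hmap
  refine ⟨c, ?_, hc⟩
  rwa [IsFareyTriangle, ← cvec_triangleVert (omega d)]

theorem mem_fareyQuadrangles (D : CellData t 2 vert face o) (h : IsQuadGen (omega d) t 2)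
    (hiv : ∀ i, polar t 2 (lvec t 2 (quadrangleVert t i)) (lvec t 2 (quadrangleVert t (i + 1))) = 1)
    {c : (Fin 4 → ℤ) × (Fin 4 → ℤ)} (hc : IsUnimodular t 2 c) {j : Fin N}
    (hmap : MapsOntoFace t 2 (fun i => lvec t 2 (vert i)) (quadrangleVert t) (face j) c.1 c.2) :
    faceSet (omega d) face j
      ∈ fareyQuadrangles d (Set.range fun i => vcusp (omega d) (vert i)) := by
  have hP := h.quadrangle_eq_hull
  rw [← h.cvec_quadrangleVert] at hP
  obtain ⟨c, hQ, hc⟩ := D.exists_isImagePolygon h hP hiv (h.exists_mem_bianchi hc.1.1 hc.1.2)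
    hc.2 hmap
  refine ⟨c, ?_, hc⟩
  rwa [IsFareyQuadrangle, ← h.cvec_quadrangleVert]

theorem mem_fareyHexagons (D : CellData t 3 vert face o) (h : IsQuadGen (omega d) t 3)
    (hiv : ∀ i, polar t 3 (lvec t 3 (hexagonVert t i)) (lvec t 3 (hexagonVert t (i + 1))) = 1)
    {c : (Fin 4 → ℤ) × (Fin 4 → ℤ)} (hc : IsUnimodular t 3 c) {j : Fin N}
    (hmap : MapsOntoFace t 3 (fun i => lvec t 3 (vert i)) (hexagonVert t) (face j) c.1 c.2) :
    faceSet (omega d) face j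
      ∈ fareyHexagons d (Set.range fun i => vcusp (omega d) (vert i)) := by
  have hP := h.hexagon_eq_hull
  rw [← h.cvec_hexagonVert] at hP
  obtain ⟨c, hQ, hc⟩ := D.exists_isImagePolygon h hP hiv (h.exists_mem_bianchi hc.1.1 hc.1.2)
    hc.2 hmap
  refine ⟨c, ?_, hc⟩
  rwa [IsFareyHexagon, ← h.cvec_hexagonVert]

end CellData

/-! ### The five cells -/

/-- The representatives of the cusps listed for `d = 1`. -/
def vert1 : Fin 6 → Fin 4 → ℤ :=
  ![![0, 0, 1, 0], ![1, 0, 0, 0], ![1, 0, 1, 0], ![0, 1, 1, 0], ![1, 1, 1, 0], ![1, 0, 1, -1]]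

/-- The faces for `d = 1`. -/
def face1 : Fin 8 → Fin 4 → ℤ :=
  ![![0, -1, 0, 1], ![0, 0, -1, 1], ![0, 0, 1, 0], ![0, 1, 0, 0], ![1, -2, -1, 1],
    ![1, -1, -2, 1], ![1, -1, 0, 0], ![1, 0, -1, 0]]

/-- Columns of matrices which map a standard polygon onto the faces for `d = 1`. -/
def mat1 : Fin 8 → (Fin 4 → ℤ) × (Fin 4 → ℤ) :=
  ![(![0, -1, 0, -1], ![1, 0, 0, 0]), (![0, 1, 1, 0], ![1, 0, 0, 0]),
    (![1, 0, 0, 0], ![0, 0, 1, 0]), (![0, 1, 0, 0], ![0, 0, 1, 0]),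
    (![-1, 1, 0, 1], ![1, 0, 1, 0]), (![1, -1, 0, -1], ![0, 1, 1, 0]),
    (![0, 1, 0, 1], ![0, 0, 1, 0]), (![1, 0, 0, -1], ![0, 0, 1, 0])]

/-- Columns of unimodular matrices which map a wall onto the planes of the faces for `d = 1`. -/
def wallMat1 : Fin 8 → (Fin 4 → ℤ) × (Fin 4 → ℤ) :=
  ![(![-1, 0, -1, 0], ![1, 0, 0, 0]), (![0, -1, -1, 0], ![1, 0, 0, 0]),
    (![1, 0, 0, 0], ![0, 0, 1, 0]), (![1, 0, 0, 0], ![0, 0, 1, 0]),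
    (![1, -1, 0, -1], ![1, 0, 1, 0]), (![1, 1, 1, 0], ![0, 1, 1, 0]),
    (![1, 0, 1, 0], ![0, 0, 1, 0]), (![1, 0, 0, -1], ![0, 0, 1, 0])]

/-- The representatives of the cusps listed for `d = 2`. -/
def vert2 : Fin 12 → Fin 4 → ℤ :=
  ![![0, 0, 1, 0], ![1, 0, 0, 0], ![1, 0, 1, 0], ![0, 1, 1, 0], ![1, 1, 1, 0], ![1, 0, 0, -1],
    ![1, -1, 0, -1], ![1, 1, 2, 0], ![-1, 1, 1, 1], ![2, 0, 1, -1], ![1, 0, 1, -1], ![0, 1, 1, 1]]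

/-- The faces for `d = 2`. -/
def face2 : Fin 14 → Fin 4 → ℤ :=
  ![![0, -1, 0, 1], ![0, 0, -1, 1], ![0, 0, 1, 0], ![0, 1, 0, 0], ![1, -2, -3, 2],
    ![1, -2, -1, 1], ![1, -1, -4, 2], ![1, -1, 0, 0], ![1, 0, -3, 1], ![1, 0, -1, 0],
    ![2, -3, -4, 2], ![2, -2, -5, 2], ![2, -2, -3, 1], ![2, -1, -4, 1]]

/-- Columns of matrices which map a standard polygon onto the faces for `d = 2`. -/
def mat2 : Fin 14 → (Fin 4 → ℤ) × (Fin 4 → ℤ) :=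
  ![(![-1, 0, -1, 0], ![1, 0, 0, 0]), (![-1, -1, -1, 0], ![1, 0, 0, 0]),
    (![1, 0, 0, 0], ![0, 0, 1, 0]), (![1, 0, 0, 0], ![0, 0, 1, 0]),
    (![-2, 0, -1, 1], ![1, 1, 1, 0]), (![0, -1, -1, -1], ![1, 0, 1, 0]),
    (![-1, 1, 1, 1], ![0, 1, 1, 0]), (![1, 0, 1, 0], ![0, 0, 1, 0]),
    (![-1, 0, 0, 1], ![0, 1, 1, 0]), (![1, 0, 0, -1], ![0, 0, 1, 0]),
    (![2, 0, 1, -1], ![1, -1, 0, -1]), (![1, -1, -1, -1], ![1, 1, 2, 0]),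
    (![-1, 0, -1, 1], ![1, 1, 2, 0]), (![-1, 1, 1, 1], ![1, 0, 0, -1])]

/-- The representatives of the cusps listed for `d = 3`. -/
def vert3 : Fin 4 → Fin 4 → ℤ :=
  ![![0, 0, 1, 0], ![1, 0, 0, 0], ![1, 0, 1, 0], ![0, 1, 1, 0]]

/-- The faces for `d = 3`. -/
def face3 : Fin 4 → Fin 4 → ℤ :=
  ![![0, -1, -1, 1], ![0, 0, 1, 0], ![0, 1, 0, 0], ![1, -1, -1, 0]]

/-- Columns of matrices which map a standard polygon onto the faces for `d = 3`. -/
def mat3 : Fin 4 → (Fin 4 → ℤ) × (Fin 4 → ℤ) :=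
  ![(![-1, 0, -1, 1], ![0, 1, 0, 0]), (![1, 0, 0, 0], ![0, 0, 1, 0]),
    (![1, -1, 0, -1], ![0, 0, 0, 1]), (![0, 1, 0, 1], ![0, 0, 1, -1])]

/-- The representatives of the cusps listed for `d = 7`. -/
def vert7 : Fin 6 → Fin 4 → ℤ :=
  ![![0, 0, 1, 0], ![1, 0, 0, 0], ![1, 0, 1, 0], ![0, 1, 1, 0], ![1, 0, 1, -1], ![-1, 1, 0, 1]]

/-- The faces for `d = 7`. -/
def face7 : Fin 5 → Fin 4 → ℤ :=
  ![![0, -1, -1, 1], ![0, 0, 1, 0], ![0, 1, 0, 0], ![1, -1, -3, 1], ![1, -1, -1, 0]]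

/-- Columns of matrices which map a standard polygon onto the faces for `d = 7`. -/
def mat7 : Fin 5 → (Fin 4 → ℤ) × (Fin 4 → ℤ) :=
  ![(![-1, 0, -1, 0], ![1, 0, 0, 0]), (![1, 0, 0, 0], ![0, 0, 1, 0]),
    (![1, 0, 0, 0], ![0, 0, 1, 0]), (![-1, 0, -1, 1], ![0, 1, 1, 0]),
    (![0, 0, -1, 0], ![1, 0, 1, 0])]

/-- The representatives of the cusps listed for `d = 11`. -/
def vert11 : Fin 12 → Fin 4 → ℤ :=
  ![![0, 0, 1, 0], ![1, 0, 0, 0], ![1, 0, 1, 0], ![0, 1, 1, 0], ![1, 0, 1, -1], ![-1, 1, 0, 1],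
    ![0, 1, 2, 0], ![1, 1, 2, 0], ![-2, 1, 0, 1], ![2, 0, 1, -1], ![-1, 1, 1, 1], ![2, 0, 2, -1]]

/-- The faces for `d = 11`. -/
def face11 : Fin 8 → Fin 4 → ℤ :=
  ![![0, -1, -1, 1], ![0, 0, 1, 0], ![0, 1, 0, 0], ![1, -1, -5, 2], ![1, -1, -1, 0],
    ![2, -3, -6, 2], ![2, -2, -7, 2], ![2, -1, -5, 1]]

/-- Columns of matrices which map a standard polygon onto the faces for `d = 11`. -/
def mat11 : Fin 8 → (Fin 4 → ℤ) × (Fin 4 → ℤ) :=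
  ![(![-1, 0, -1, 0], ![1, 0, 0, 0]), (![1, 0, 0, 0], ![0, 0, 1, 0]),
    (![1, 0, 0, 0], ![0, 0, 1, 0]), (![-2, 0, -1, 1], ![0, 1, 1, 0]),
    (![0, 0, -1, 0], ![1, 0, 1, 0]), (![-1, -1, -2, 0], ![-1, 1, 0, 1]),
    (![-2, 0, -2, 1], ![1, 1, 2, 0]), (![-1, 1, 1, 1], ![1, 0, 1, -1])]

/-! ### Verification of the integral data for the five values of `d`. -/

theorem isQuadGen_omega1 : IsQuadGen (omega 1) 0 1 :=
  by simpa using isQuadGen_omega (d := 1) (by norm_num) (by norm_num)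

theorem cellData1 : CellData 0 1 vert1 face1 1 :=
  .of_vertexSum (by decide +kernel) (by decide +kernel) rfl (by decide +kernel)
    (by decide +kernel) (by decide +kernel) (by decide +kernel) (by decide +kernel)
    (by decide +kernel)

/-- Matrices other than `mat1` are needed: those may have determinant a unit different from 1, while
hemispheres are images of walls under determinant 1. -/
theorem wallData1 : WallData 1 0 1 face1 :=
  wallData_of_mod_ne (by norm_num) isQuadGen_omega1 (by decide +kernel) (by decide +kernel)
    (by decide +kernel) (by decide +kernel) (by decide +kernel) wallMat1 (by decide +kernel)

theorem range_vcusp_vert1 : (Set.range fun i => vcusp (omega 1) (vert1 i)) = cusps1 := by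
  have : (fun i => vcusp (omega 1) (vert1 i)) =
      ![cusp 0 1, cusp 1 0, cusp 1 1, cusp (omega 1) 1, cusp (omega 1 + 1) 1, cusp 1 (1 - omega
        1)] := by
    ext1 i
    fin_cases i <;> simp [vcusp, cvec, vert1]  <;> ring_nf
  rw [this, cusps1]
  simp only [Matrix.range_cons, Matrix.range_empty, Set.union_empty, Set.singleton_union]

theorem isQuadGen_omega2 : IsQuadGen (omega 2) 0 2 :=
  by simpa using isQuadGen_omega (d := 2) (by norm_num) (by norm_num)

theorem cellData2 : CellData 0 2 vert2 face2 1 :=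
  .of_vertexSum (by decide +kernel) (by decide +kernel) rfl (by decide +kernel)
    (by decide +kernel) (by decide +kernel) (by decide +kernel) (by decide +kernel)
    (by decide +kernel)

/-- The standard triangle and quadrangle lie in the walls over `[0, 1]` and `[0, ω]`, so a matrix of
determinant 1 that maps one of them onto a face also maps a wall onto its plane, and `mat2` can be
used again. -/
theorem wallData2 : WallData 2 0 2 face2 :=
  wallData_of_mod_ne (by norm_num) isQuadGen_omega2 (by decide +kernel) (by decide +kernel)
    (by decide +kernel) (by decide +kernel) (by decide +kernel) mat2 (by decide +kernel)

theorem range_vcusp_vert2 : (Set.range fun i => vcusp (omega 2) (vert2 i)) = cusps2 := by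
  have : (fun i => vcusp (omega 2) (vert2 i)) =
      ![cusp 0 1, cusp 1 0, cusp 1 1, cusp (omega 2) 1, cusp (omega 2 + 1) 1, cusp 1 (-omega 2),
        cusp (1 - omega 2) (-omega 2), cusp (omega 2 + 1) 2, cusp (omega 2 - 1) (omega 2 +
        1), cusp 2 (1 - omega 2), cusp 1 (1 - omega 2), cusp (omega 2) (omega 2 + 1)] := by
    ext1 i
    fin_cases i <;> simp [vcusp, cvec, vert2]  <;> ring_nf
  rw [this, cusps2]
  simp only [Matrix.range_cons, Matrix.range_empty, Set.union_empty, Set.singleton_union]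

theorem isQuadGen_omega3 : IsQuadGen (omega 3) 1 1 :=
  isQuadGen_omega_of_mod (by norm_num) (by norm_num)

theorem cellData3 : CellData 1 1 vert3 face3 1 :=
  .of_vertexSum (by decide +kernel) (by decide +kernel) rfl (by decide +kernel)
    (by decide +kernel) (by decide +kernel) (by decide +kernel) (by decide +kernel)
    (by decide +kernel)

theorem wallData3 : WallData 3 1 1 face3 :=
  wallData_of_mod (by norm_num) isQuadGen_omega3 (by decide +kernel) (by decide +kernel)
    (by decide +kernel) (by decide +kernel) mat3 (by decide +kernel)

theorem range_vcusp_vert3 : (Set.range fun i => vcusp (omega 3) (vert3 i)) = cusps3 := by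
  have : (fun i => vcusp (omega 3) (vert3 i)) =
      ![cusp 0 1, cusp 1 0, cusp 1 1, cusp (omega 3) 1] := by
    ext1 i
    fin_cases i <;> simp [vcusp, cvec, vert3] 
  rw [this, cusps3]
  simp only [Matrix.range_cons, Matrix.range_empty, Set.union_empty, Set.singleton_union]

theorem isQuadGen_omega7 : IsQuadGen (omega 7) 1 2 :=
  isQuadGen_omega_of_mod (by norm_num) (by norm_num)

theorem cellData7 : CellData 1 2 vert7 face7 1 :=
  .of_vertexSum (by decide +kernel) (by decide +kernel) rfl (by decide +kernel)
    (by decide +kernel) (by decide +kernel) (by decide +kernel) (by decide +kernel)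
    (by decide +kernel)

theorem wallData7 : WallData 7 1 2 face7 :=
  wallData_of_mod (by norm_num) isQuadGen_omega7 (by decide +kernel) (by decide +kernel)
    (by decide +kernel) (by decide +kernel) mat7 (by decide +kernel)

theorem range_vcusp_vert7 : (Set.range fun i => vcusp (omega 7) (vert7 i)) = cusps7 := by
  have : (fun i => vcusp (omega 7) (vert7 i)) =
      ![cusp 0 1, cusp 1 0, cusp 1 1, cusp (omega 7) 1, cusp 1 (1 - omega 7), cusp (omega 7 - 1)
        (omega 7)] := by
    ext1 i
    fin_cases i <;> simp [vcusp, cvec, vert7]  <;> ring_nf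
  rw [this, cusps7]
  simp only [Matrix.range_cons, Matrix.range_empty, Set.union_empty, Set.singleton_union]

theorem isQuadGen_omega11 : IsQuadGen (omega 11) 1 3 :=
  isQuadGen_omega_of_mod (by norm_num) (by norm_num)

theorem cellData11 : CellData 1 3 vert11 face11 1 :=
  .of_vertexSum (by decide +kernel) (by decide +kernel) rfl (by decide +kernel)
    (by decide +kernel) (by decide +kernel) (by decide +kernel) (by decide +kernel)
    (by decide +kernel)

theorem wallData11 : WallData 11 1 3 face11 :=
  wallData_of_mod (by norm_num) isQuadGen_omega11 (by decide +kernel) (by decide +kernel)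
    (by decide +kernel) (by decide +kernel) mat11 (by decide +kernel)

theorem range_vcusp_vert11 : (Set.range fun i => vcusp (omega 11) (vert11 i)) = cusps11 := by
  have : (fun i => vcusp (omega 11) (vert11 i)) =
      ![cusp 0 1, cusp 1 0, cusp 1 1, cusp (omega 11) 1, cusp 1 (1 - omega 11), cusp (omega 11 -
        1) (omega 11), cusp (omega 11) 2, cusp (omega 11 + 1) 2, cusp (omega 11 - 2) (omega
        11), cusp 2 (1 - omega 11), cusp (omega 11 - 1) (omega 11 + 1), cusp 2 (2 - omega
        11)] := by
    ext1 i
    fin_cases i <;> simp [vcusp, cvec, vert11]  <;> ring_nf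
  rw [this, cusps11]
  simp only [Matrix.range_cons, Matrix.range_empty, Set.union_empty, Set.singleton_union]

/-! ### The forms of the walls at the vertices -/

theorem pairing_vert1_nonneg {g : Fin 4 → ℤ} (hg : 0 < g 0) (hK : disc 0 1 g = 1 ∨ disc 0 1 g = 1)
    (i : Fin 6) : 0 ≤ pairing g (lvec 0 1 (vert1 i)) :=
  pairing_nonneg_of_lt (by norm_num) (by revert i; decide +kernel) hg hK

/-- Here `4n - t² = 8`, and only the cusp `(ω + 1)/2`, with last coordinate 4, misses the general
bound: for discriminant 2 it holds with equality. -/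
theorem pairing_vert2_nonneg {g : Fin 4 → ℤ} (hg : 0 < g 0) (hK : disc 0 2 g = 1 ∨ disc 0 2 g = 2)
    (i : Fin 12) : 0 ≤ pairing g (lvec 0 2 (vert2 i)) := by
  by_cases hi : i = 7
  · subst hi
    have hl : lvec 0 2 (vert2 7) = ![3, 2, 2, 4] := by decide +kernel
    rw [hl]
    by_contra! hF
    -- This is `pairing_identity` divided by 64. A negative value forces the right side to be 0,
    -- which gives `g = (1, -1, -2, g 3)` with value `4 * g 3 - 3`, and this is never `-1`.
    have key : 2 * (g 0 + g 1) ^ 2 + (g 2 + 2 * g 0) ^ 2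
        = disc 0 2 g + 2 * (g 0 * pairing g ![3, 2, 2, 4]) := by
      simp [disc, pairing]; ring
    have hgF : g 0 * pairing g ![3, 2, 2, 4] ≤ -g 0 := by nlinarith
    have s1 := sq_nonneg (g 0 + g 1)
    have s2 := sq_nonneg (g 2 + 2 * g 0)
    have h0 : g 0 = 1 := by rcases hK with e | e <;> rw [e] at key <;> omega
    have hF1 : pairing g ![3, 2, 2, 4] = -1 := by
      rw [h0] at key s1 s2
      rcases hK with e | e <;> rw [e] at key <;> omega
    have hsq : (g 0 + g 1) ^ 2 = 0 ∧ (g 2 + 2 * g 0) ^ 2 = 0 := by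
      rw [hF1] at key
      rcases hK with e | e <;> rw [e] at key <;> constructor <;> omega
    have h1 := pow_eq_zero_iff two_ne_zero |>.1 hsq.1
    have h2 := pow_eq_zero_iff two_ne_zero |>.1 hsq.2
    simp [pairing] at hF1
    omega
  · exact pairing_nonneg_of_lt (by norm_num) (by revert i; decide +kernel) hg hK

theorem pairing_vert3_nonneg {g : Fin 4 → ℤ} (hg : 0 < g 0) (hK : disc 1 1 g = 1 ∨ disc 1 1 g = 1)
    (i : Fin 4) : 0 ≤ pairing g (lvec 1 1 (vert3 i)) :=
  pairing_nonneg_of_lt (by norm_num) (by revert i; decide +kernel) hg hK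

theorem pairing_vert7_nonneg {g : Fin 4 → ℤ} (hg : 0 < g 0) (hK : disc 1 2 g = 1 ∨ disc 1 2 g = 2)
    (i : Fin 6) : 0 ≤ pairing g (lvec 1 2 (vert7 i)) :=
  pairing_nonneg_of_lt (by norm_num) (by revert i; decide +kernel) hg hK

/-- The identity reads `11 B₁² + B₂² = 44 x₃ g₀F + 4 disc x₃²`. For a negative `F` the right side is
nonnegative only if `g₀F = -1` and the discriminant is 3; it is then 16 for `x₃ = 4` and 80 for `x₃
= 5`, whence the bounds 9 and 81 on the squares. -/
theorem bounds_of_pairing_neg {g x : Fin 4 → ℤ}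
    (hx : x 0 * x 3 = x 1 ^ 2 + 1 * (x 1 * x 2) + 3 * x 2 ^ 2) (hx3 : x 3 = 4 ∨ x 3 = 5)
    (hg : 0 < g 0) (hK : disc 1 3 g = 1 ∨ disc 1 3 g = 3) (hF : pairing g x < 0) :
    (g 0 = 1 ∧ pairing g x = -1 ∧ disc 1 3 g = 3) ∧
      (x 3 * g 1 + g 0 * (2 * x 1 + x 2)) ^ 2 < 3 ^ 2 ∧
      (2 * (x 3 * g 2 + g 0 * (x 1 + 6 * x 2)) - (x 3 * g 1 + g 0 * (2 * x 1 + x 2))) ^ 2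
        < 9 ^ 2 := by
  have key := pairing_identity 1 3 g x hx
  have e : g 0 * (1 * x 1 + 2 * (3 * x 2)) = g 0 * (x 1 + 6 * x 2) := by ring
  rw [e, one_mul, one_mul] at key
  set B₁ := x 3 * g 1 + g 0 * (2 * x 1 + x 2)
  set B₂ := 2 * (x 3 * g 2 + g 0 * (x 1 + 6 * x 2)) - B₁
  have h1 := sq_nonneg B₁
  have h2 := sq_nonneg B₂
  set F := pairing g x
  have hgF : g 0 * F ≤ -g 0 := by nlinarith
  have hgF' : g 0 * F ≤ F := by nlinarith
  have key' : 11 * B₁ ^ 2 + B₂ ^ 2 = 44 * x 3 * (g 0 * F) + 4 * disc 1 3 g * x 3 ^ 2 := by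
    rw [← sub_eq_zero] at key ⊢
    linear_combination -key
  have hlow : -2 < g 0 * F ∧ disc 1 3 g = 3 := by
    rcases hx3 with e | e <;> rw [e] at key' <;> rcases hK with e' | e' <;> rw [e'] at key' ⊢ <;>
      omega
  have hF1 : F = -1 := by omega
  have h0 : g 0 = 1 := by omega
  refine ⟨⟨h0, hF1, hlow.2⟩, ?_⟩
  rw [hF1, h0, hlow.2] at key'
  rcases hx3 with e | e <;> rw [e] at key' <;> constructor <;> omega

/-- Here `4n - t² = 11`, and the four cusps singled out have last coordinate 4 or 5, so discriminant
3 exceeds the general bound (12 and 15). -/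
theorem pairing_vert11_nonneg {g : Fin 4 → ℤ} (hg : 0 < g 0)
    (hK : disc 1 3 g = 1 ∨ disc 1 3 g = 3) (i : Fin 12) :
    0 ≤ pairing g (lvec 1 3 (vert11 i)) := by
  by_cases hi : i = 6 ∨ i = 7 ∨ i = 10 ∨ i = 11
  · by_contra! hF
    have hi3 : lvec 1 3 (vert11 i) 3 = 4 ∨ lvec 1 3 (vert11 i) 3 = 5 := by
      clear hF
      revert i; decide +kernel
    obtain ⟨⟨h0, hF1, hd⟩, h1, h2⟩ := bounds_of_pairing_neg (lvec_null _ _ _) hi3 hg hK hF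
    have b1 := abs_lt_of_sq_lt_sq' h1 (by norm_num)
    have b2 := abs_lt_of_sq_lt_sq' h2 (by norm_num)
    rw [h0] at b1 b2
    rw [disc, h0] at hd
    rw [pairing, h0] at hF1
    rcases hi with rfl | rfl | rfl | rfl <;> simp [lvec, vert11] at b1 b2 hF1 <;>
    · have hl : -3 ≤ g 1 := by omega
      have hu : g 1 ≤ 1 := by omega
      have hl' : -8 ≤ g 2 := by omega
      have hu' : g 2 ≤ 1 := by omega
      -- For each remaining pair no integer `g 3` is compatible with value `-1`, discriminant 3 and
      -- the bounds.
      interval_cases g 1 <;> interval_cases g 2 <;> omega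
  · exact pairing_nonneg_of_lt (by norm_num) (by revert i; decide +kernel) hg hK

/-! ### The faces of the five cells -/

theorem fareyTriangles_cusps1 : fareyTriangles 1 (extendedBianchi 1) cusps1
    = Set.range (faceSet (omega 1) face1) := by
  rw [← range_vcusp_vert1]
  apply Set.Subset.antisymm
  · exact cellData1.fareyTriangles_subset isQuadGen_omega1 (by decide +kernel) (by decide +kernel)
      (by decide +kernel) le_rfl
  · rintro _ ⟨j, rfl⟩
    have hm : ∀ j, polar 0 1 (lvec 0 1 (mat1 j).1) (lvec 0 1 (mat1 j).2) = 1 ∧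
        MapsOntoFace 0 1 (fun i => lvec 0 1 (vert1 i)) triangleVert (face1 j)
          (mat1 j).1 (mat1 j).2 := by decide +kernel
    exact cellData1.mem_fareyTriangles isQuadGen_omega1 (by decide +kernel)
      (isQuadGen_omega1.exists_mem_extendedBianchi (hm j).1) (hm j).1 (hm j).2

theorem farey_cusps2 : fareyTriangles 2 (bianchi 2) cusps2 ∪ fareyQuadrangles 2 cusps2
    = Set.range (faceSet (omega 2) face2) := by
  rw [← range_vcusp_vert2]
  apply Set.Subset.antisymm
  · exact Set.union_subset
      (cellData2.fareyTriangles_subset isQuadGen_omega2 (by decide +kernel) (by decide +kernel)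
        (by decide +kernel) (IsQuadGen.bianchi_le_extendedBianchi 2))
      (cellData2.fareyQuadrangles_subset isQuadGen_omega2 (by decide +kernel) (by decide +kernel)
        (by decide +kernel))
  · rintro _ ⟨j, rfl⟩
    have hm : ∀ j, IsUnimodular 0 2 (mat2 j) ∧
        (MapsOntoFace 0 2 (fun i => lvec 0 2 (vert2 i)) triangleVert (face2 j)
          (mat2 j).1 (mat2 j).2 ∨
        MapsOntoFace 0 2 (fun i => lvec 0 2 (vert2 i)) (quadrangleVert 0) (face2 j)
          (mat2 j).1 (mat2 j).2) := by decide +kernel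
    obtain ⟨hu, hm | hm⟩ := hm j
    · exact Or.inl (cellData2.mem_fareyTriangles isQuadGen_omega2 (by decide +kernel)
        (isQuadGen_omega2.exists_mem_bianchi hu.1.1 hu.1.2) hu.2 hm)
    · exact Or.inr (cellData2.mem_fareyQuadrangles isQuadGen_omega2 (by decide +kernel) hu hm)

theorem fareyTriangles_cusps3 : fareyTriangles 3 (bianchi 3) cusps3
    = Set.range (faceSet (omega 3) face3) := by
  rw [← range_vcusp_vert3]
  apply Set.Subset.antisymm
  · exact cellData3.fareyTriangles_subset isQuadGen_omega3 (by decide +kernel) (by decide +kernel)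
      (by decide +kernel) (IsQuadGen.bianchi_le_extendedBianchi 3)
  · rintro _ ⟨j, rfl⟩
    have hm : ∀ j, IsUnimodular 1 1 (mat3 j) ∧
        MapsOntoFace 1 1 (fun i => lvec 1 1 (vert3 i)) triangleVert (face3 j)
          (mat3 j).1 (mat3 j).2 := by decide +kernel
    obtain ⟨hu, hm⟩ := hm j
    exact cellData3.mem_fareyTriangles isQuadGen_omega3 (by decide +kernel)
      (isQuadGen_omega3.exists_mem_bianchi hu.1.1 hu.1.2) hu.2 hm

theorem farey_cusps7 : fareyTriangles 7 (bianchi 7) cusps7 ∪ fareyQuadrangles 7 cusps7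
    = Set.range (faceSet (omega 7) face7) := by
  rw [← range_vcusp_vert7]
  apply Set.Subset.antisymm
  · exact Set.union_subset
      (cellData7.fareyTriangles_subset isQuadGen_omega7 (by decide +kernel) (by decide +kernel)
        (by decide +kernel) (IsQuadGen.bianchi_le_extendedBianchi 7))
      (cellData7.fareyQuadrangles_subset isQuadGen_omega7 (by decide +kernel) (by decide +kernel)
        (by decide +kernel))
  · rintro _ ⟨j, rfl⟩
    have hm : ∀ j, IsUnimodular 1 2 (mat7 j) ∧
        (MapsOntoFace 1 2 (fun i => lvec 1 2 (vert7 i)) triangleVert (face7 j)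
          (mat7 j).1 (mat7 j).2 ∨
        MapsOntoFace 1 2 (fun i => lvec 1 2 (vert7 i)) (quadrangleVert 1) (face7 j)
          (mat7 j).1 (mat7 j).2) := by decide +kernel
    obtain ⟨hu, hm | hm⟩ := hm j
    · exact Or.inl (cellData7.mem_fareyTriangles isQuadGen_omega7 (by decide +kernel)
        (isQuadGen_omega7.exists_mem_bianchi hu.1.1 hu.1.2) hu.2 hm)
    · exact Or.inr (cellData7.mem_fareyQuadrangles isQuadGen_omega7 (by decide +kernel) hu hm)

theorem farey_cusps11 : fareyTriangles 11 (bianchi 11) cusps11 ∪ fareyHexagons 11 cusps11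
    = Set.range (faceSet (omega 11) face11) := by
  rw [← range_vcusp_vert11]
  apply Set.Subset.antisymm
  · exact Set.union_subset
      (cellData11.fareyTriangles_subset isQuadGen_omega11 (by decide +kernel) (by decide +kernel)
        (by decide +kernel) (IsQuadGen.bianchi_le_extendedBianchi 11))
      (cellData11.fareyHexagons_subset isQuadGen_omega11 (by decide +kernel) (by decide +kernel)
        (by decide +kernel))
  · rintro _ ⟨j, rfl⟩
    have hm : ∀ j, IsUnimodular 1 3 (mat11 j) ∧
        (MapsOntoFace 1 3 (fun i => lvec 1 3 (vert11 i)) triangleVert (face11 j)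
          (mat11 j).1 (mat11 j).2 ∨
        MapsOntoFace 1 3 (fun i => lvec 1 3 (vert11 i)) (hexagonVert 1) (face11 j)
          (mat11 j).1 (mat11 j).2) := by decide +kernel
    obtain ⟨hu, hm | hm⟩ := hm j
    · exact Or.inl (cellData11.mem_fareyTriangles isQuadGen_omega11 (by decide +kernel)
        (isQuadGen_omega11.exists_mem_bianchi hu.1.1 hu.1.2) hu.2 hm)
    · exact Or.inr (cellData11.mem_fareyHexagons isQuadGen_omega11 (by decide +kernel) hu hm)

end FareyCell
end

theorem mainTheorem6 :
    FareyCell.IsHedron 8 (FareyCell.standardCell 1)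
      (FareyCell.fareyTriangles 1 (FareyCell.extendedBianchi 1) FareyCell.cusps1)
      FareyCell.cusps1 ∧
    FareyCell.IsHedron 14 (FareyCell.standardCell 2)
      (FareyCell.fareyTriangles 2 (FareyCell.bianchi 2) FareyCell.cusps2 ∪
        FareyCell.fareyQuadrangles 2 FareyCell.cusps2)
      FareyCell.cusps2 ∧
    FareyCell.IsHedron 4 (FareyCell.standardCell 3)
      (FareyCell.fareyTriangles 3 (FareyCell.bianchi 3) FareyCell.cusps3)
      FareyCell.cusps3 ∧
    FareyCell.IsHedron 5 (FareyCell.standardCell 7)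
      (FareyCell.fareyTriangles 7 (FareyCell.bianchi 7) FareyCell.cusps7 ∪
        FareyCell.fareyQuadrangles 7 FareyCell.cusps7)
      FareyCell.cusps7 ∧
    FareyCell.IsHedron 8 (FareyCell.standardCell 11)
      (FareyCell.fareyTriangles 11 (FareyCell.bianchi 11) FareyCell.cusps11 ∪
        FareyCell.fareyHexagons 11 FareyCell.cusps11)
      FareyCell.cusps11 := by
  open FareyCell in
  refine ⟨?_, ?_, ?_, ?_, ?_⟩
  · rw [cellData1.standardCell_eq isQuadGen_omega1 wallData1 fun g hg hK =>
      pairing_vert1_nonneg hg hK, fareyTriangles_cusps1, ← range_vcusp_vert1]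
    exact cellData1.isHedron isQuadGen_omega1
  · rw [cellData2.standardCell_eq isQuadGen_omega2 wallData2 fun g hg hK =>
      pairing_vert2_nonneg hg hK, farey_cusps2, ← range_vcusp_vert2]
    exact cellData2.isHedron isQuadGen_omega2
  · rw [cellData3.standardCell_eq isQuadGen_omega3 wallData3 fun g hg hK =>
      pairing_vert3_nonneg hg hK, fareyTriangles_cusps3, ← range_vcusp_vert3]
    exact cellData3.isHedron isQuadGen_omega3
  · rw [cellData7.standardCell_eq isQuadGen_omega7 wallData7 fun g hg hK =>
      pairing_vert7_nonneg hg hK, farey_cusps7, ← range_vcusp_vert7]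
    exact cellData7.isHedron isQuadGen_omega7
  · rw [cellData11.standardCell_eq isQuadGen_omega11 wallData11 fun g hg hK =>
      pairing_vert11_nonneg hg hK, farey_cusps11, ← range_vcusp_vert11]
    exact cellData11.isHedron isQuadGen_omega11
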